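/- Let $\mathbb{K}$ be a field of characteristic $0$, let $N, W, U$ be finite-dimensional $\mathbb{K}$-vector spaces, $g := \dim N$, and let $(a_1,\dots,a_g)$ be a basis of $N$ with dual basis $(a^1,\dots,a^g)$ of $N^\vee$. Consider the algebras $$A := S^*(S^2(N)) \otimes S^*(N\otimes W)\otimes \Lambda^*(N^\vee\otimes U),\qquad C := S^*(\Lambda^2(N)) \otimes \Lambda^*(N\otimes W)\otimes S^*(N^\vee\otimes U)$$ with their obvious trigradings, $A_{p,q,r} = S^p(S^2(N)) \otimes S^q(N\otimes W)\otimes \Lambda^r(N^\vee\otimes U)$ and $C_{p,q,r} = S^p(\Lambda^2(N)) \otimes \Lambda^q(N\otimes W)\otimes S^r(N^\vee\otimes U)$, and the action of $\mathrm{GL}(N)$ induced by its actions on $N$ and $N^\vee$. Let $$G\colon S^*(\Lambda^2(U))\otimes\Lambda^*(W\otimes U)\to A,\qquad H\colon S^*(\Lambda^2(U))\otimes\Lambda^*(W\otimes U)\to C$$ be the algebra maps given on generators by $$G(u_1\wedge u_2) = \sum_{i,j=1}^g (a_i\cdot a_j)\otimes 1\otimes\big((a^i\otimes u_1)\wedge(a^j\otimes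 u_2)\big),\qquad G(w\otimes u)=\sum_{i=1}^g 1\otimes(a_i\otimes w)\otimes(a^i\otimes u),$$ $$H(u_1\wedge u_2) = \sum_{i,j=1}^g (a_i\wedge a_j)\otimes 1\otimes\big((a^i\otimes u_1)\cdot(a^j\otimes u_2)\big),\qquad H(w\otimes u)=\sum_{i=1}^g 1\otimes(a_i\otimes w)\otimes(a^i\otimes u).$$ Then, for all integers $p,q,r\ge 0$: 1. $A_{p,q,r}^{\mathrm{GL}(N)} = C_{p,q,r}^{\mathrm{GL}(N)} = 0$ unless $2p+q-r=0$. 2. $A_{p,q,r}^{\mathrm{SL}(N)} = C_{p,q,r}^{\mathrm{SL}(N)} = 0$ unless $g$ divides $2p+q-r$. 3. $G$ and $H$ take values in the $\mathrm{GL}(N)$-invariants, and the induced maps $$S^p(\Lambda^2(U))\otimes\Lambda^q(W\otimes U)\xrightarrow{\;G\;}A_{p,q,2p+q}^{\mathrm{GL}(N)}\subset A_{p,q,2p+q}^{\mathrm{SL}(N)},\qquad S^p(\Lambda^2(U))\otimes\Lambda^q(W\otimes U)\xrightarrow{\;H\;}C_{p,q,2p+q}^{\mathrm{GL}(N)}\subset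 C_{p,q,2p+q}^{\mathrm{SL}(N)}$$ are surjective, both onto the $\mathrm{GL}(N)$-invariants and onto the $\mathrm{SL}(N)$-invariants, and they are isomorphisms if $2p+q\le g$. -/

import Mathlib

open scoped TensorProduct

noncomputable section

namespace InvThy

/-! ### Symmetric powers, functoriality, induced representations -/

section Powers

variable (K : Type*) [Field K] (V : Type*) [AddCommGroup V] [Module K V]

/-- The symmetric power `S^n(V)`: the degree `n` part of the symmetric algebra of `V`. -/
abbrev symPow (n : ℕ) : Submodule K (SymmetricAlgebra K V) :=
  LinearMap.range (SymmetricAlgebra.ι K V) ^ n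

variable {K V}

/-- The product `x · y ∈ S^2(V)`. -/
def symMul (x y : V) : symPow K V 2 :=
  ⟨SymmetricAlgebra.ι K V x * SymmetricAlgebra.ι K V y, by
    rw [symPow, pow_two]
    exact Submodule.mul_mem_mul ⟨x, rfl⟩ ⟨y, rfl⟩⟩

/-- The product `x ∧ y ∈ Λ^2(V)`. -/
def extMul (x y : V) : ⋀[K]^2 V := exteriorPower.ιMulti K 2 ![x, y]

variable {V' : Type*} [AddCommGroup V'] [Module K V']

/-- The algebra map `S^*(V) → S^*(V')` induced by a linear map. -/
def symMap (f : V →ₗ[K] V') : SymmetricAlgebra K V →ₐ[K] SymmetricAlgebra K V' :=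
  SymmetricAlgebra.lift (SymmetricAlgebra.ι K V' ∘ₗ f)

lemma symMap_mem (f : V →ₗ[K] V') (n : ℕ) (x : SymmetricAlgebra K V) (hx : x ∈ symPow K V n) :
    symMap f x ∈ symPow K V' n := by
  have h : (symPow K V n).map (symMap f).toLinearMap ≤ symPow K V' n := by
    rw [Submodule.map_pow]
    refine pow_le_pow_left' ?_ n
    rintro _ ⟨_, ⟨v, rfl⟩, rfl⟩
    exact ⟨f v, by simp [symMap]⟩
  exact h ⟨x, hx, rfl⟩

variable {Γ : Type*} [Group Γ]

lemma symMap_one : symMap (1 : V →ₗ[K] V) = AlgHom.id K _ := by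
  apply SymmetricAlgebra.algHom_ext
  ext v
  simp [symMap]

lemma symMap_mul (f f' : V →ₗ[K] V) : symMap (f * f') = (symMap f).comp (symMap f') := by
  apply SymmetricAlgebra.algHom_ext
  ext v
  simp [symMap]

/-- The representation on `S^*(V)` by algebra automorphisms induced by one on `V`. -/
def symRep (ρ : Representation K Γ V) : Representation K Γ (SymmetricAlgebra K V) where
  toFun g := (symMap (ρ g)).toLinearMap
  map_one' := by rw [map_one, symMap_one]; rfl
  map_mul' g h := by rw [map_mul, symMap_mul]; rfl

/-- The representation on `Λ^*(V)` by algebra automorphisms induced by one on `V`. -/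
def extRep (ρ : Representation K Γ V) : Representation K Γ (ExteriorAlgebra K V) where
  toFun g := (ExteriorAlgebra.map (ρ g)).toLinearMap
  map_one' := by
    rw [map_one]
    change (ExteriorAlgebra.map LinearMap.id).toLinearMap = _
    rw [ExteriorAlgebra.map_id]; rfl
  map_mul' g h := by
    rw [map_mul]
    change (ExteriorAlgebra.map (ρ g ∘ₗ ρ h)).toLinearMap = _
    rw [← ExteriorAlgebra.map_comp_map]; rfl

/-- The induced representation on `S^n(V)`. -/
def symPowRep (n : ℕ) (ρ : Representation K Γ V) : Representation K Γ (symPow K V n) where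
  toFun g := (symMap (ρ g)).toLinearMap.restrict (symMap_mem (ρ g) n)
  map_one' := by
    ext x
    change symMap (ρ 1) (x : SymmetricAlgebra K V) = x
    rw [map_one, symMap_one]; rfl
  map_mul' g h := by
    ext x
    change symMap (ρ (g * h)) (x : SymmetricAlgebra K V) =
      symMap (ρ g) (symMap (ρ h) (x : SymmetricAlgebra K V))
    rw [map_mul, symMap_mul]; rfl

/-- The induced representation on `Λ^n(V)`. -/
def extPowRep (n : ℕ) (ρ : Representation K Γ V) : Representation K Γ (⋀[K]^n V) where
  toFun g := exteriorPower.map n (ρ g)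
  map_one' := by rw [map_one]; exact exteriorPower.map_id
  map_mul' g h := by rw [map_mul]; exact exteriorPower.map_comp (ρ h) (ρ g)

end Powers

/-! ### Algebra maps out of `S^*(V) ⊗ Λ^*(V')` -/

section Lift

variable {K : Type*} [Field K] {V V' : Type*} [AddCommGroup V] [Module K V]
  [AddCommGroup V'] [Module K V'] {B : Type*} [Ring B] [Algebra K B]

/-- The algebra map `S^*(V) → B` extending a linear map `V → B` with central values. -/
def symLift (f : V →ₗ[K] B) (hf : ∀ v, f v ∈ Subalgebra.center K B) :
    SymmetricAlgebra K V →ₐ[K] B :=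
  (Subalgebra.center K B).val.comp
    (SymmetricAlgebra.lift (f.codRestrict (Subalgebra.toSubmodule (Subalgebra.center K B)) hf :
      V →ₗ[K] Subalgebra.center K B))

@[simp]
lemma symLift_ι (f : V →ₗ[K] B) (hf : ∀ v, f v ∈ Subalgebra.center K B) (v : V) :
    symLift f hf (SymmetricAlgebra.ι K V v) = f v := by
  simp only [symLift, AlgHom.comp_apply, SymmetricAlgebra.lift_ι_apply]
  rfl

lemma symLift_commute (f : V →ₗ[K] B) (hf : ∀ v, f v ∈ Subalgebra.center K B)
    (x : SymmetricAlgebra K V) (b : B) : Commute (symLift f hf x) b := by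
  have h : symLift f hf x ∈ Subalgebra.center K B := by
    rw [symLift, AlgHom.comp_apply]
    exact Subtype.property _
  exact (Subalgebra.mem_center_iff.1 h b).symm

/-- The algebra map `S^*(V) ⊗ Λ^*(V') → B` extending `f` on `V` and `h` on `V'`, where `f` has
central values and the values of `h` have square zero. -/
def symExtLift (f : V →ₗ[K] B) (hf : ∀ v, f v ∈ Subalgebra.center K B)
    (h : V' →ₗ[K] B) (hh : ∀ v, h v * h v = 0) :
    SymmetricAlgebra K V ⊗[K] ExteriorAlgebra K V' →ₐ[K] B :=
  Algebra.TensorProduct.lift (symLift f hf) (ExteriorAlgebra.lift K ⟨h, hh⟩) fun x _ =>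
    symLift_commute f hf x _

@[simp]
lemma symExtLift_ι_left (f : V →ₗ[K] B) (hf : ∀ v, f v ∈ Subalgebra.center K B)
    (h : V' →ₗ[K] B) (hh : ∀ v, h v * h v = 0) (v : V) :
    symExtLift f hf h hh (SymmetricAlgebra.ι K V v ⊗ₜ 1) = f v := by
  simp [symExtLift]

@[simp]
lemma symExtLift_ι_right (f : V →ₗ[K] B) (hf : ∀ v, f v ∈ Subalgebra.center K B)
    (h : V' →ₗ[K] B) (hh : ∀ v, h v * h v = 0) (v : V') :
    symExtLift f hf h hh (1 ⊗ₜ ExteriorAlgebra.ι K v) = h v := by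
  simp [symExtLift]

end Lift

/-! ### The algebras -/

section Algebras

variable (K : Type*) [Field K] (N W U : Type*) [AddCommGroup N] [Module K N]
  [AddCommGroup W] [Module K W] [AddCommGroup U] [Module K U]

/-- `A = S^*(S^2 N) ⊗ S^*(N ⊗ W) ⊗ Λ^*(N^∨ ⊗ U)`. -/
abbrev AlgA : Type _ :=
  (SymmetricAlgebra K (symPow K N 2) ⊗[K] SymmetricAlgebra K (N ⊗[K] W)) ⊗[K]
    ExteriorAlgebra K (Module.Dual K N ⊗[K] U)

/-- `C = S^*(Λ^2 N) ⊗ Λ^*(N ⊗ W) ⊗ S^*(N^∨ ⊗ U)`. -/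
abbrev AlgC : Type _ :=
  (SymmetricAlgebra K (⋀[K]^2 N) ⊗[K] ExteriorAlgebra K (N ⊗[K] W)) ⊗[K]
    SymmetricAlgebra K (Module.Dual K N ⊗[K] U)

/-- The common source `S^*(Λ^2 U) ⊗ Λ^*(W ⊗ U)` of the two algebra maps. -/
abbrev AlgSrc : Type _ :=
  SymmetricAlgebra K (⋀[K]^2 U) ⊗[K] ExteriorAlgebra K (W ⊗[K] U)

/-- `A_{p,q,r} = S^p(S^2 N) ⊗ S^q(N ⊗ W) ⊗ Λ^r(N^∨ ⊗ U)`, as a subspace of `A`. -/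
def gradedA (p q r : ℕ) : Submodule K (AlgA K N W U) :=
  LinearMap.range (TensorProduct.map
    (TensorProduct.map (symPow K (symPow K N 2) p).subtype (symPow K (N ⊗[K] W) q).subtype)
    (⋀[K]^r (Module.Dual K N ⊗[K] U)).subtype)

/-- `C_{p,q,r} = S^p(Λ^2 N) ⊗ Λ^q(N ⊗ W) ⊗ S^r(N^∨ ⊗ U)`, as a subspace of `C`. -/
def gradedC (p q r : ℕ) : Submodule K (AlgC K N W U) :=
  LinearMap.range (TensorProduct.map
    (TensorProduct.map (symPow K (⋀[K]^2 N) p).subtype (⋀[K]^q (N ⊗[K] W)).subtype)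
    (symPow K (Module.Dual K N ⊗[K] U) r).subtype)

/-- The inclusion of the bidegree `(p,q)` part `S^p(Λ^2 U) ⊗ Λ^q(W ⊗ U)` of the source. -/
def srcIncl (p q : ℕ) :
    symPow K (⋀[K]^2 U) p ⊗[K] ⋀[K]^q (W ⊗[K] U) →ₗ[K] AlgSrc K W U :=
  TensorProduct.map (symPow K (⋀[K]^2 U) p).subtype (⋀[K]^q (W ⊗[K] U)).subtype

/-- The tautological representation of `GL(N)` on `N`. -/
def stdRep : Representation K (N ≃ₗ[K] N) N :=
  LinearEquiv.automorphismGroup.toLinearMapMonoidHom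

variable {K N}

/-- The action on `A` induced by an action on `N` (the actions on `W` and `U` being trivial). -/
def repA {Γ : Type*} [Group Γ] (ρ : Representation K Γ N) :
    Representation K Γ (AlgA K N W U) :=
  ((symRep (symPowRep 2 ρ)).tprod (symRep (ρ.tprod (Representation.trivial K Γ W)))).tprod
    (extRep (ρ.dual.tprod (Representation.trivial K Γ U)))

/-- The action on `C` induced by an action on `N` (the actions on `W` and `U` being trivial). -/
def repC {Γ : Type*} [Group Γ] (ρ : Representation K Γ N) :
    Representation K Γ (AlgC K N W U) :=
  ((symRep (extPowRep 2 ρ)).tprod (extRep (ρ.tprod (Representation.trivial K Γ W)))).tprod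
    (symRep (V := Module.Dual K N ⊗[K] U) (ρ.dual.tprod (Representation.trivial K Γ U)))

variable (K N)

/-- `A_{p,q,r}^{GL(N)}`. -/
def invGLA (p q r : ℕ) : Submodule K (AlgA K N W U) :=
  gradedA K N W U p q r ⊓ Representation.invariants (V := AlgA K N W U) (repA W U (stdRep K N))

/-- `A_{p,q,r}^{SL(N)}`. -/
def invSLA (p q r : ℕ) : Submodule K (AlgA K N W U) :=
  gradedA K N W U p q r ⊓
    Representation.invariants (V := AlgA K N W U)
      (repA W U ((stdRep K N).comp (SpecialLinearGroup.toLinearEquiv (R := K) (V := N))))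

/-- `C_{p,q,r}^{GL(N)}`. -/
def invGLC (p q r : ℕ) : Submodule K (AlgC K N W U) :=
  gradedC K N W U p q r ⊓ Representation.invariants (V := AlgC K N W U) (repC W U (stdRep K N))

/-- `C_{p,q,r}^{SL(N)}`. -/
def invSLC (p q r : ℕ) : Submodule K (AlgC K N W U) :=
  gradedC K N W U p q r ⊓
    Representation.invariants (V := AlgC K N W U)
      (repC W U ((stdRep K N).comp (SpecialLinearGroup.toLinearEquiv (R := K) (V := N))))

end Algebras

/-! ### The maps -/

section Aux

variable {K : Type*} [Field K]

lemma eq_zero_of_eq_neg [CharZero K] {M : Type*} [AddCommGroup M] [Module K M] {x : M}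
    (h : x = -x) : x = 0 := by
  have h2 : (2 : K) • x = 0 := by
    rw [two_smul]
    nth_rewrite 1 [h]
    exact neg_add_cancel x
  exact (smul_eq_zero.1 h2).resolve_left two_ne_zero

lemma tmul_mem_center {R S : Type*} [Ring R] [Algebra K R] [Ring S] [Algebra K S] {x : R} {y : S}
    (hx : x ∈ Subalgebra.center K R) (hy : y ∈ Subalgebra.center K S) :
    x ⊗ₜ[K] y ∈ Subalgebra.center K (R ⊗[K] S) := by
  rw [Subalgebra.mem_center_iff] at *
  intro b
  induction b with
  | zero => simp
  | tmul r s => simp [hx r, hy s]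
  | add b c hb hc => rw [add_mul, mul_add, hb, hc]

lemma mem_center_of_comm {R : Type*} [CommRing R] [Algebra K R] (x : R) :
    x ∈ Subalgebra.center K R :=
  Subalgebra.mem_center_iff.2 fun b => mul_comm b x

lemma ext_mul_comm_neg {V : Type*} [AddCommGroup V] [Module K V] (x y : V) :
    ExteriorAlgebra.ι K x * ExteriorAlgebra.ι K y =
      -(ExteriorAlgebra.ι K y * ExteriorAlgebra.ι K x) :=
  eq_neg_of_add_eq_zero_left (ExteriorAlgebra.ι_add_mul_swap x y)

lemma ext_mul_mem_center {V : Type*} [AddCommGroup V] [Module K V] (x y : V) :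
    ExteriorAlgebra.ι K x * ExteriorAlgebra.ι K y ∈
      Subalgebra.center K (ExteriorAlgebra K V) := by
  rw [Subalgebra.mem_center_iff]
  intro b
  induction b using ExteriorAlgebra.induction with
  | algebraMap r => exact Algebra.commutes r _
  | ι z =>
    rw [← mul_assoc, ext_mul_comm_neg z x, neg_mul, mul_assoc, ext_mul_comm_neg z y, mul_neg,
      neg_neg, mul_assoc]
  | mul b c hb hc => rw [mul_assoc, hc, ← mul_assoc, hb, mul_assoc]
  | add b c hb hc => rw [add_mul, mul_add, hb, hc]

lemma symMul_comm {V : Type*} [AddCommGroup V] [Module K V] (x y : V) :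
    symMul (K := K) x y = symMul y x :=
  Subtype.ext (mul_comm _ _)

lemma extMul_comm {V : Type*} [AddCommGroup V] [Module K V] (x y : V) :
    extMul (K := K) x y = -extMul y x := by
  apply Subtype.ext
  simp [extMul, ExteriorAlgebra.ιMulti_apply, ext_mul_comm_neg x y]

lemma sum_sum_eq_zero [CharZero K] {M I : Type*} [Fintype I] [AddCommGroup M] [Module K M]
    (F : I → I → M) (h : ∀ i j, F i j = -F j i) : ∑ i, ∑ j, F i j = 0 := by
  apply eq_zero_of_eq_neg (K := K)
  conv_lhs => rw [Finset.sum_comm]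
  rw [← Finset.sum_neg_distrib]
  refine Finset.sum_congr rfl fun i _ => ?_
  rw [← Finset.sum_neg_distrib]
  exact Finset.sum_congr rfl fun j _ => h j i

lemma sum_mul_sum_eq_neg {B I : Type*} [Fintype I] [Ring B] (f h : I → B)
    (hfh : ∀ i j, f i * h j = -(h j * f i)) :
    (∑ i, f i) * ∑ i, h i = -((∑ i, h i) * ∑ i, f i) := by
  rw [Finset.sum_mul_sum, Finset.sum_mul_sum, Finset.sum_comm, ← Finset.sum_neg_distrib]
  refine Finset.sum_congr rfl fun i _ => ?_
  rw [← Finset.sum_neg_distrib]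
  exact Finset.sum_congr rfl fun j _ => hfh j i

/-- A linear map whose values on pure tensors anticommute has values of square zero. -/
lemma sq_zero_of_anticomm [CharZero K] {V V' B : Type*} [AddCommGroup V] [Module K V]
    [AddCommGroup V'] [Module K V'] [Ring B] [Algebra K B] (f : V ⊗[K] V' →ₗ[K] B)
    (h : ∀ v v' w w', f (v ⊗ₜ v') * f (w ⊗ₜ w') = -(f (w ⊗ₜ w') * f (v ⊗ₜ v')))
    (x : V ⊗[K] V') : f x * f x = 0 := by
  have key : ∀ x y : V ⊗[K] V', f x * f y = -(f y * f x) := by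
    intro x y
    induction x with
    | zero => simp
    | tmul v v' =>
      induction y with
      | zero => simp
      | tmul w w' => exact h v v' w w'
      | add b c hb hc => rw [map_add, mul_add, add_mul, hb, hc, neg_add]
    | add b c hb hc => rw [map_add, mul_add, add_mul, hb, hc, neg_add]
  exact eq_zero_of_eq_neg (K := K) (key x x)

end Aux

section Maps

variable {K : Type*} [Field K] [CharZero K] {N : Type*} (W U : Type*)
  [AddCommGroup N] [Module K N] [AddCommGroup W] [Module K W] [AddCommGroup U] [Module K U]
  {I : Type*} [Fintype I] (a : Module.Basis I K N)

/-- The alternating map `(u₁, u₂) ↦ ∑_{i,j} (a_i · a_j) ⊗ 1 ⊗ ((a^i ⊗ u₁) ∧ (a^j ⊗ u₂))`. -/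
def phiAltA : U [⋀^Fin 2]→ₗ[K] AlgA K N W U where
  toFun u := ∑ i, ∑ j,
    (SymmetricAlgebra.ι K (symPow K N 2) (symMul (a i) (a j)) ⊗ₜ[K]
      (1 : SymmetricAlgebra K (N ⊗[K] W))) ⊗ₜ[K]
      (ExteriorAlgebra.ι K (a.coord i ⊗ₜ[K] u 0) * ExteriorAlgebra.ι K (a.coord j ⊗ₜ[K] u 1))
  map_update_add' := by
    intro _ u k x y
    fin_cases k <;>
      simp [TensorProduct.tmul_add, add_mul, mul_add, Finset.sum_add_distrib, Function.update]
  map_update_smul' := by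
    intro _ u k c x
    fin_cases k <;> simp [Finset.smul_sum, Function.update]
  map_eq_zero_of_eq' := by
    intro u k l h hkl
    have h01 : u 0 = u 1 := by
      fin_cases k <;> fin_cases l <;> simp_all
    rw [h01]
    refine sum_sum_eq_zero (K := K) (M := AlgA K N W U) _ fun i j => ?_
    rw [symMul_comm, ext_mul_comm_neg, TensorProduct.tmul_neg]

/-- `φ_A : Λ^2(U) → A`,
`u₁ ∧ u₂ ↦ ∑_{i,j} (a_i · a_j) ⊗ 1 ⊗ ((a^i ⊗ u₁) ∧ (a^j ⊗ u₂))`. -/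
def phiA : ⋀[K]^2 U →ₗ[K] AlgA K N W U :=
  exteriorPower.alternatingMapLinearEquiv (R := K) (n := 2) (M := U) (N := AlgA K N W U)
    (phiAltA W U a)

/-- `ψ_A : W ⊗ U → A`, `w ⊗ u ↦ ∑_i 1 ⊗ (a_i ⊗ w) ⊗ (a^i ⊗ u)`. -/
def psiA : W ⊗[K] U →ₗ[K] AlgA K N W U :=
  TensorProduct.lift (LinearMap.mk₂ K
    (fun w u => ∑ i, ((1 : SymmetricAlgebra K (symPow K N 2)) ⊗ₜ[K]
      SymmetricAlgebra.ι K (N ⊗[K] W) (a i ⊗ₜ[K] w)) ⊗ₜ[K]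
        ExteriorAlgebra.ι K (a.coord i ⊗ₜ[K] u))
    (by intros; simp [TensorProduct.tmul_add, TensorProduct.add_tmul, Finset.sum_add_distrib])
    (by intros; simp only [TensorProduct.tmul_smul, map_smul, Finset.smul_sum,
      ← TensorProduct.smul_tmul'])
    (by intros; simp [TensorProduct.tmul_add, Finset.sum_add_distrib])
    (by intros; simp [Finset.smul_sum]))

/-- The alternating map `(u₁, u₂) ↦ ∑_{i,j} (a_i ∧ a_j) ⊗ 1 ⊗ ((a^i ⊗ u₁) · (a^j ⊗ u₂))`. -/
def phiAltC : U [⋀^Fin 2]→ₗ[K] AlgC K N W U where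
  toFun u := ∑ i, ∑ j,
    (SymmetricAlgebra.ι K (⋀[K]^2 N) (extMul (a i) (a j)) ⊗ₜ[K]
      (1 : ExteriorAlgebra K (N ⊗[K] W))) ⊗ₜ[K]
      (SymmetricAlgebra.ι K (Module.Dual K N ⊗[K] U) (a.coord i ⊗ₜ[K] u 0) *
        SymmetricAlgebra.ι K (Module.Dual K N ⊗[K] U) (a.coord j ⊗ₜ[K] u 1))
  map_update_add' := by
    intro _ u k x y
    fin_cases k <;>
      simp [TensorProduct.tmul_add, add_mul, mul_add, Finset.sum_add_distrib, Function.update]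
  map_update_smul' := by
    intro _ u k c x
    fin_cases k <;> simp [Finset.smul_sum, Function.update]
  map_eq_zero_of_eq' := by
    intro u k l h hkl
    have h01 : u 0 = u 1 := by
      fin_cases k <;> fin_cases l <;> simp_all
    rw [h01]
    refine sum_sum_eq_zero (K := K) (M := AlgC K N W U) _ fun i j => ?_
    rw [extMul_comm, mul_comm, map_neg, TensorProduct.neg_tmul, TensorProduct.neg_tmul]

/-- `φ_C : Λ^2(U) → C`,
`u₁ ∧ u₂ ↦ ∑_{i,j} (a_i ∧ a_j) ⊗ 1 ⊗ ((a^i ⊗ u₁) · (a^j ⊗ u₂))`. -/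
def phiC : ⋀[K]^2 U →ₗ[K] AlgC K N W U :=
  exteriorPower.alternatingMapLinearEquiv (R := K) (n := 2) (M := U) (N := AlgC K N W U)
    (phiAltC W U a)

/-- `ψ_C : W ⊗ U → C`, `w ⊗ u ↦ ∑_i 1 ⊗ (a_i ⊗ w) ⊗ (a^i ⊗ u)`. -/
def psiC : W ⊗[K] U →ₗ[K] AlgC K N W U :=
  TensorProduct.lift (LinearMap.mk₂ K
    (fun w u => ∑ i, ((1 : SymmetricAlgebra K (⋀[K]^2 N)) ⊗ₜ[K]
      ExteriorAlgebra.ι K (a i ⊗ₜ[K] w)) ⊗ₜ[K]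
        SymmetricAlgebra.ι K (Module.Dual K N ⊗[K] U) (a.coord i ⊗ₜ[K] u))
    (by intros; simp [TensorProduct.tmul_add, TensorProduct.add_tmul, Finset.sum_add_distrib])
    (by intros; simp only [TensorProduct.tmul_smul, map_smul, Finset.smul_sum,
      ← TensorProduct.smul_tmul'])
    (by intros; simp [TensorProduct.tmul_add, Finset.sum_add_distrib])
    (by intros; simp [Finset.smul_sum]))

lemma phiA_mem_center (x : ⋀[K]^2 U) : phiA W U a x ∈ Subalgebra.center K (AlgA K N W U) := by
  have h : (⊤ : Submodule K (⋀[K]^2 U)) ≤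
      (Subalgebra.toSubmodule (Subalgebra.center K (AlgA K N W U))).comap (phiA W U a) := by
    rw [← exteriorPower.ιMulti_span, Submodule.span_le]
    rintro _ ⟨u, rfl⟩
    change phiA W U a (exteriorPower.ιMulti K 2 u) ∈ Subalgebra.center K (AlgA K N W U)
    rw [phiA, exteriorPower.alternatingMapLinearEquiv_apply_ιMulti]
    exact Subalgebra.sum_mem _ fun i _ => Subalgebra.sum_mem _ fun j _ =>
      tmul_mem_center (mem_center_of_comm _) (ext_mul_mem_center _ _)
  exact h (Submodule.mem_top (x := x))

lemma phiC_mem_center (x : ⋀[K]^2 U) : phiC W U a x ∈ Subalgebra.center K (AlgC K N W U) := by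
  have h : (⊤ : Submodule K (⋀[K]^2 U)) ≤
      (Subalgebra.toSubmodule (Subalgebra.center K (AlgC K N W U))).comap (phiC W U a) := by
    rw [← exteriorPower.ιMulti_span, Submodule.span_le]
    rintro _ ⟨u, rfl⟩
    change phiC W U a (exteriorPower.ιMulti K 2 u) ∈ Subalgebra.center K (AlgC K N W U)
    rw [phiC, exteriorPower.alternatingMapLinearEquiv_apply_ιMulti]
    exact Subalgebra.sum_mem _ fun i _ => Subalgebra.sum_mem _ fun j _ =>
      tmul_mem_center (tmul_mem_center (mem_center_of_comm _) (Subalgebra.one_mem _))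
        (mem_center_of_comm _)
  exact h (Submodule.mem_top (x := x))

lemma psiA_sq_zero (x : W ⊗[K] U) : psiA W U a x * psiA W U a x = 0 := by
  refine sq_zero_of_anticomm (B := AlgA K N W U) (psiA W U a) (fun w u w' u' => ?_) x
  simp only [psiA, TensorProduct.lift.tmul, LinearMap.mk₂_apply]
  refine sum_mul_sum_eq_neg (B := AlgA K N W U) _ _ fun i j => ?_
  rw [Algebra.TensorProduct.tmul_mul_tmul, Algebra.TensorProduct.tmul_mul_tmul,
    Algebra.TensorProduct.tmul_mul_tmul, Algebra.TensorProduct.tmul_mul_tmul, ext_mul_comm_neg,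
    TensorProduct.tmul_neg,
    mul_comm (SymmetricAlgebra.ι K (N ⊗[K] W) (a i ⊗ₜ[K] w))]

lemma psiC_sq_zero (x : W ⊗[K] U) : psiC W U a x * psiC W U a x = 0 := by
  refine sq_zero_of_anticomm (B := AlgC K N W U) (psiC W U a) (fun w u w' u' => ?_) x
  simp only [psiC, TensorProduct.lift.tmul, LinearMap.mk₂_apply]
  refine sum_mul_sum_eq_neg (B := AlgC K N W U) _ _ fun i j => ?_
  rw [Algebra.TensorProduct.tmul_mul_tmul, Algebra.TensorProduct.tmul_mul_tmul,
    Algebra.TensorProduct.tmul_mul_tmul, Algebra.TensorProduct.tmul_mul_tmul, ext_mul_comm_neg,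
    TensorProduct.tmul_neg, TensorProduct.neg_tmul,
    mul_comm (SymmetricAlgebra.ι K (Module.Dual K N ⊗[K] U) (a.coord i ⊗ₜ[K] u))]

/-- The algebra map `G : S^*(Λ^2 U) ⊗ Λ^*(W ⊗ U) → A` extending `φ_A` and `ψ_A`. -/
def mapG : AlgSrc K W U →ₐ[K] AlgA K N W U :=
  symExtLift (V := ⋀[K]^2 U) (V' := W ⊗[K] U) (B := AlgA K N W U)
    (phiA W U a) (phiA_mem_center W U a) (psiA W U a) (psiA_sq_zero W U a)

/-- The algebra map `H : S^*(Λ^2 U) ⊗ Λ^*(W ⊗ U) → C` extending `φ_C` and `ψ_C`. -/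
def mapH : AlgSrc K W U →ₐ[K] AlgC K N W U :=
  symExtLift (V := ⋀[K]^2 U) (V' := W ⊗[K] U) (B := AlgC K N W U)
    (phiC W U a) (phiC_mem_center W U a) (psiC W U a) (psiC_sq_zero W U a)

/-- The restriction of `G` to `S^p(Λ^2 U) ⊗ Λ^q(W ⊗ U)`. -/
def mapGpq (p q : ℕ) : symPow K (⋀[K]^2 U) p ⊗[K] ⋀[K]^q (W ⊗[K] U) →ₗ[K] AlgA K N W U :=
  (mapG W U a).toLinearMap ∘ₗ srcIncl K W U p q

/-- The restriction of `H` to `S^p(Λ^2 U) ⊗ Λ^q(W ⊗ U)`. -/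
def mapHpq (p q : ℕ) : symPow K (⋀[K]^2 U) p ⊗[K] ⋀[K]^q (W ⊗[K] U) →ₗ[K] AlgC K N W U :=
  (mapH W U a).toLinearMap ∘ₗ srcIncl K W U p q

end Maps

end InvThy

end

set_option linter.unusedSectionVars false
set_option autoImplicit false

noncomputable section

namespace InvThy

/-! ### Symmetric and exterior algebras with their contractions -/

/-! The algebras A and C are handled together. `SignedPower` abstracts S^*(V) and Λ^*(V), which
differ by a sign `e`, and A and C are two choices of signs in R₁ ⊗ R₂ ⊗ R₃. In characteristic 0 an
element f of tridegree (p,q,r) is recovered from its full contractions with basis covectors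
(`triReconstruct`, an iteration of Euler's identity `SignedPower.euler`). For fixed basis indices in
W and U these contractions form a tensor F(P,Q), with 2p+q indices P on the slots from N and r
indices Q on the slots from the dual of N. Invariance of f becomes invariance of F
(`triCoord_tensorAct`).

Vanishing comes from diagonal matrices. The scalar 2 multiplies F by 2^(2p+q-r). The matrices with
entries 2, 1/2 at i, j and 1 elsewhere force the number of occurrences of i in P minus that in Q to
be independent of i wherever F(P,Q) ≠ 0, so g divides 2p+q-r.

Surjectivity is the first fundamental theorem `FFT.mem_deltaSpan`: if 2p+q = r, an SL-invariant F is
a combination of the tensors δ_σ given by bijections σ of slots. Transvections and diagonal matrices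
make F invariant under the Lie algebra gl. For such F, the Casimir operator in the indices P is the
sum, over all pairs of slots, of contracting the pair and reinserting an identity tensor. The
Casimir operator is injective in positive degree, being a sum of squares over ℚ. Hence contracting
and reinserting is a bijection of the finite-dimensional space of invariants, and by induction on
the number of slots its values lie in the span of the δ_σ. The element attached to δ_σ is, up to a
scalar, the image of a monomial under G or H (`theta_perm`, `hom_srcMonomial`). As the image
consists of GL-invariants and contains all SL-invariants, both spaces of invariants equal it.

Injectivity for 2p+q ≤ g: the slots can be given pairwise distinct basis indices of N. Contracting
G(x) with the corresponding covectors leaves a single matching of slots and returns a coordinate of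
x (`triLam_hom`); all coordinates arise in this way. -/

/-- The structure common to the symmetric (`e = 1`) and the exterior (`e = -1`) algebra of `V`:
contractions with covectors, an augmentation and a commutation rule for generators. -/
structure SignedPower {K V R : Type*} [Field K] [AddCommGroup V] [Module K V] [Ring R]
    [Algebra K R] (ι : V →ₗ[K] R) (e : K) where
  contract : Module.Dual K V →ₗ[K] R →ₗ[K] R
  contract_one : ∀ l, contract l 1 = 0
  contract_ι_mul : ∀ l v x, contract l (ι v * x) = l v • x + e • (ι v * contract l x)
  aug : R →ₗ[K] K
  aug_one : aug 1 = 1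
  sign_sq : e * e = 1
  swap : ∀ v w, ι v * ι w = e • (ι w * ι v)
  perm : ∀ (n : ℕ) (σ : Equiv.Perm (Fin n)), ∃ c : K, ∀ v : Fin n → V,
    (List.ofFn fun i => ι (v (σ i))).prod = c • (List.ofFn fun i => ι (v i)).prod

section Instances

variable {K : Type*} [Field K] {V : Type*} [AddCommGroup V] [Module K V]

/-- The algebra map `x ↦ (x, ∂_l x)` from `S^*(V)` to its trivial square-zero extension. -/
def symContractHom (l : Module.Dual K V) :
    SymmetricAlgebra K V →ₐ[K]
      TrivSqZeroExt (SymmetricAlgebra K V) (SymmetricAlgebra K V) :=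
  SymmetricAlgebra.lift
    ((TrivSqZeroExt.inlAlgHom K (SymmetricAlgebra K V) (SymmetricAlgebra K V)).toLinearMap ∘ₗ
        SymmetricAlgebra.ι K V +
      (TrivSqZeroExt.inrHom (SymmetricAlgebra K V) (SymmetricAlgebra K V)).restrictScalars K ∘ₗ
        Algebra.linearMap K (SymmetricAlgebra K V) ∘ₗ l)

/-- The derivation of `S^*(V)` extending a linear form on `V`. -/
def symContractAux (l : Module.Dual K V) :
    SymmetricAlgebra K V →ₗ[K] SymmetricAlgebra K V :=
  (TrivSqZeroExt.sndHom (SymmetricAlgebra K V) (SymmetricAlgebra K V)).restrictScalars K ∘ₗ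
    (symContractHom l).toLinearMap

lemma fst_symContractHom (l : Module.Dual K V) (x : SymmetricAlgebra K V) :
    (symContractHom l x).fst = x := by
  have h : (TrivSqZeroExt.fstHom K (SymmetricAlgebra K V) (SymmetricAlgebra K V)).comp
      (symContractHom l) = AlgHom.id K _ := by
    apply SymmetricAlgebra.algHom_ext
    ext v
    simp [symContractHom]
  exact DFunLike.congr_fun h x

lemma symContractAux_ι (l : Module.Dual K V) (v : V) :
    symContractAux l (SymmetricAlgebra.ι K V v) = algebraMap K _ (l v) := by
  simp [symContractAux, symContractHom, Algebra.algebraMap_eq_smul_one]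

/-- The second component of a product in a square-zero extension is given by the Leibniz rule, so
multiplicativity of `symContractHom` makes its second component a derivation. -/
lemma symContractAux_mul (l : Module.Dual K V) (x y : SymmetricAlgebra K V) :
    symContractAux l (x * y) = x * symContractAux l y + y * symContractAux l x := by
  simp [symContractAux, TrivSqZeroExt.snd_mul, fst_symContractHom, mul_comm]

lemma symContractAux_algebraMap (l : Module.Dual K V) (r : K) :
    symContractAux l (algebraMap K _ r) = 0 := by
  simp [symContractAux, TrivSqZeroExt.algebraMap_eq_inl']

/-- The derivations of `S^*(V)` extending linear forms on `V`. -/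
def symContract : Module.Dual K V →ₗ[K] SymmetricAlgebra K V →ₗ[K] SymmetricAlgebra K V where
  toFun := symContractAux
  map_add' l l' := by
    ext x
    induction x using SymmetricAlgebra.induction with
    | algebraMap r => simp [symContractAux_algebraMap]
    | ι v => simp [symContractAux_ι]
    | mul x y hx hy =>
      simp only [LinearMap.add_apply, symContractAux_mul] at *
      rw [hx, hy]; ring
    | add x y hx hy => simp only [map_add, hx, hy]
  map_smul' c l := by
    ext x
    induction x using SymmetricAlgebra.induction with
    | algebraMap r => simp [symContractAux_algebraMap]
    | ι v => simp [symContractAux_ι, Algebra.smul_def]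
    | mul x y hx hy =>
      simp only [LinearMap.smul_apply, symContractAux_mul, RingHom.id_apply] at *
      rw [hx, hy]; simp [smul_add]
    | add x y hx hy => simp only [map_add, hx, hy]

variable (K V)

/-- The symmetric algebra as a signed power. -/
def symPower : SignedPower (SymmetricAlgebra.ι K V) (1 : K) where
  contract := symContract
  contract_one l := by
    have := symContractAux_algebraMap l 1
    rwa [map_one] at this
  contract_ι_mul l v x := by
    change symContractAux l _ = _ + (1 : K) • (_ * symContractAux l x)
    rw [symContractAux_mul, symContractAux_ι, one_smul, add_comm, mul_comm x, ← Algebra.smul_def]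
  aug := SymmetricAlgebra.algebraMapInv.toLinearMap
  aug_one := by simp
  sign_sq := one_mul 1
  swap v w := by rw [one_smul, mul_comm]
  perm n σ := ⟨1, fun v => by
    rw [one_smul, List.prod_ofFn, List.prod_ofFn]
    exact Equiv.prod_comp σ fun i => SymmetricAlgebra.ι K V (v i)⟩

/-- The exterior algebra as a signed power. -/
def extPower : SignedPower (ExteriorAlgebra.ι K : V →ₗ[K] ExteriorAlgebra K V) (-1 : K) where
  contract := CliffordAlgebra.contractLeft
  contract_one l := CliffordAlgebra.contractLeft_one (Q := 0) l
  contract_ι_mul l v x := by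
    rw [neg_smul, one_smul, ← sub_eq_add_neg]
    exact CliffordAlgebra.contractLeft_ι_mul (Q := 0) l v x
  aug := ExteriorAlgebra.algebraMapInv.toLinearMap
  aug_one := by simp
  sign_sq := by ring
  swap v w := by rw [neg_smul, one_smul, ext_mul_comm_neg]
  perm n σ := ⟨((Equiv.Perm.sign σ : ℤ) : K), fun v => by
    have := (ExteriorAlgebra.ιMulti K n).map_perm v σ
    rw [ExteriorAlgebra.ιMulti_apply, ExteriorAlgebra.ιMulti_apply] at this
    simp only [Function.comp_apply] at this
    rw [this, Units.smul_def, Int.cast_smul_eq_zsmul]⟩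

end Instances

/-! ### Euler's identity and reconstruction from iterated contractions. -/

namespace SignedPower

variable {K V R : Type*} [Field K] [AddCommGroup V] [Module K V] [Ring R]
    [Algebra K R] {ι : V →ₗ[K] R} {e : K} (h : SignedPower ι e)

/-- The ordered product of a finite family of generators. -/
def prodι (ι : V →ₗ[K] R) {n : ℕ} (v : Fin n → V) : R := (List.ofFn fun i => ι (v i)).prod

lemma prodι_zero (v : Fin 0 → V) : prodι ι v = 1 := by simp [prodι]

lemma prodι_succ {n : ℕ} (v : Fin (n + 1) → V) :
    prodι ι v = ι (v 0) * prodι ι (fun i => v i.succ) := by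
  simp [prodι, List.ofFn_succ]

lemma prodι_mem {n : ℕ} (v : Fin n → V) : prodι ι v ∈ LinearMap.range ι ^ n := by
  induction n with
  | zero => rw [prodι_zero, pow_zero]; exact Submodule.one_le.1 le_rfl
  | succ n ih =>
    rw [prodι_succ, pow_succ']
    exact Submodule.mul_mem_mul ⟨_, rfl⟩ (ih _)

include h in
lemma contract_mem (l : Module.Dual K V) {n : ℕ} {x : R} (hx : x ∈ LinearMap.range ι ^ (n + 1)) :
    h.contract l x ∈ LinearMap.range ι ^ n := by
  -- Truncated subtraction includes degree 0, where contraction gives 0; this lets the induction on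
  -- the degree start.
  have key : ∀ {n : ℕ} {x : R} (hx : x ∈ LinearMap.range ι ^ n),
      h.contract l x ∈ LinearMap.range ι ^ (n - 1) := by
    intro n x hx
    induction hx using Submodule.pow_induction_on_left' with
    | algebraMap r =>
      rw [Algebra.algebraMap_eq_smul_one, map_smul, h.contract_one, smul_zero]
      exact Submodule.zero_mem _
    | add x y i hx hy ihx ihy => rw [map_add]; exact Submodule.add_mem _ ihx ihy
    | mem_mul m hm i x hx ih =>
      obtain ⟨v, rfl⟩ := hm
      rw [h.contract_ι_mul]
      refine Submodule.add_mem _ (Submodule.smul_mem _ _ hx) (Submodule.smul_mem _ _ ?_)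
      cases i with
      | zero =>
        have : h.contract l x = 0 := by
          rw [pow_zero] at hx
          obtain ⟨r, rfl⟩ := Submodule.mem_one.1 hx
          rw [Algebra.algebraMap_eq_smul_one, map_smul, h.contract_one, smul_zero]
        rw [this, mul_zero]
        exact Submodule.zero_mem _
      | succ i =>
        change _ ∈ LinearMap.range ι ^ (i + 1)
        rw [pow_succ']
        exact Submodule.mul_mem_mul ⟨v, rfl⟩ ih
  exact key hx

/-- Iterated contraction with `n` covectors, followed by the augmentation. -/
def lam : (n : ℕ) → (Fin n → Module.Dual K V) → R →ₗ[K] K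
  | 0, _ => h.aug
  | n + 1, l => lam n (fun i => l i.succ) ∘ₗ h.contract (l 0)

lemma lam_succ {n : ℕ} (l : Fin (n + 1) → Module.Dual K V) (x : R) :
    h.lam (n + 1) l x = h.lam n (fun i => l i.succ) (h.contract (l 0) x) := rfl

section Frame

variable {κ : Type*} [Fintype κ] {b : κ → V} {l : κ → Module.Dual K V} {c : K}

/-- Moving ι(b_k) past a generator costs `e`, which cancels the sign in the contraction rule. The
Euler operator is therefore an unsigned derivation for both parities, and it multiplies each
generator by `c`. -/
lemma euler (hb : ∀ v, ∑ k, l k v • b k = c • v) {n : ℕ} {x : R}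
    (hx : x ∈ LinearMap.range ι ^ n) :
    ∑ k, ι (b k) * h.contract (l k) x = ((n : K) * c) • x := by
  induction hx using Submodule.pow_induction_on_left' with
  | algebraMap r =>
    simp [Algebra.algebraMap_eq_smul_one, h.contract_one]
  | add x y i hx hy ihx ihy =>
    simp only [map_add, mul_add, Finset.sum_add_distrib, ihx, ihy, smul_add]
  | mem_mul m hm i x hx ih =>
    obtain ⟨v, rfl⟩ := hm
    have h1 : ∀ k, ι (b k) * h.contract (l k) (ι v * x) =
        ι (l k v • b k) * x + ι v * (ι (b k) * h.contract (l k) x) := by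
      intro k
      rw [h.contract_ι_mul, mul_add, mul_smul_comm, mul_smul_comm, ← mul_assoc, h.swap (b k) v,
        smul_mul_assoc, smul_smul, h.sign_sq, one_smul, map_smul, smul_mul_assoc, mul_assoc]
    rw [Finset.sum_congr rfl fun k _ => h1 k, Finset.sum_add_distrib, ← Finset.mul_sum,
      ← Finset.sum_mul, ← map_sum, hb, ih, map_smul, smul_mul_assoc, mul_smul_comm, ← add_smul]
    congr 1
    push_cast
    ring

lemma sum_fin_succ {κ M : Type*} [Fintype κ] [AddCommMonoid M] {n : ℕ} (f : (Fin (n + 1) → κ) → M) :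
    ∑ z, f z = ∑ k, ∑ z : Fin n → κ, f (Fin.cons k z) := by
  rw [← Fintype.sum_prod_type']
  exact (Fintype.sum_equiv (Fin.consEquiv fun _ => κ) _ _ fun _ => rfl).symm

/-- Reconstruction of an element of degree `n` from its iterated contractions. -/
lemma reconstruct (hb : ∀ v, ∑ k, l k v • b k = c • v) {n : ℕ} {x : R}
    (hx : x ∈ LinearMap.range ι ^ n) :
    ∑ z : Fin n → κ, h.lam n (fun i => l (z i)) x • prodι ι (fun i => b (z i)) =
      ((n.factorial : K) * c ^ n) • x := by
  induction n generalizing x with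
  | zero =>
    rw [pow_zero] at hx
    obtain ⟨r, rfl⟩ := Submodule.mem_one.1 hx
    simp [lam, Algebra.algebraMap_eq_smul_one, h.aug_one, prodι_zero]
  | succ n ih =>
    rw [sum_fin_succ]
    have h1 : ∀ k, ∑ z : Fin n → κ, h.lam (n + 1) (fun i => l ((Fin.cons k z : Fin (n + 1) → κ) i)) x •
        prodι ι (fun i => b ((Fin.cons k z : Fin (n + 1) → κ) i)) =
        ((n.factorial : K) * c ^ n) • (ι (b k) * h.contract (l k) x) := by
      intro k
      rw [← mul_smul_comm, ← ih (h.contract_mem (l k) hx), Finset.mul_sum]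
      refine Finset.sum_congr rfl fun z _ => ?_
      rw [lam_succ, prodι_succ, mul_smul_comm]
      simp only [Fin.cons_zero, Fin.cons_succ]
    rw [Finset.sum_congr rfl fun k _ => h1 k, ← Finset.smul_sum, h.euler hb hx, smul_smul,
      Nat.factorial_succ]
    congr 1
    push_cast
    ring

end Frame

/-- Multilinear expansion of iterated contractions. -/
lemma lam_sum {κ : Type*} [Fintype κ] {n : ℕ} (g : Fin n → κ → K)
    (l : Fin n → κ → Module.Dual K V) (x : R) :
    h.lam n (fun i => ∑ k, g i k • l i k) x =
      ∑ z : Fin n → κ, (∏ i, g i (z i)) * h.lam n (fun i => l i (z i)) x := by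
  induction n generalizing x with
  | zero => simp [lam]
  | succ n ih =>
    rw [lam_succ, sum_fin_succ]
    simp only [map_sum, map_smul, LinearMap.sum_apply, LinearMap.smul_apply, smul_eq_mul]
    refine Finset.sum_congr rfl fun k _ => ?_
    rw [ih, Finset.mul_sum]
    refine Finset.sum_congr rfl fun z _ => ?_
    rw [lam_succ, Fin.prod_univ_succ]
    simp only [Fin.cons_zero, Fin.cons_succ, mul_assoc]

/-- Equivariance of contraction: covectors are pulled back along `s`. Iterated, this transports the
group action to the coordinate tensors. -/
lemma contract_map {s : V →ₗ[K] V} {σ : R →ₐ[K] R} (hσ : ∀ v, σ (ι v) = ι (s v))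
    (l : Module.Dual K V) {n : ℕ} {x : R} (hx : x ∈ LinearMap.range ι ^ n) :
    h.contract l (σ x) = σ (h.contract (l ∘ₗ s) x) := by
  induction hx using Submodule.pow_induction_on_left' with
  | algebraMap r => simp [Algebra.algebraMap_eq_smul_one, h.contract_one]
  | add x y i hx hy ihx ihy => simp only [map_add, ihx, ihy]
  | mem_mul m hm i x hx ih =>
    obtain ⟨v, rfl⟩ := hm
    rw [map_mul, hσ, h.contract_ι_mul, h.contract_ι_mul, ih]
    simp [hσ]

lemma lam_map {s : V →ₗ[K] V} {σ : R →ₐ[K] R} (hσ : ∀ v, σ (ι v) = ι (s v))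
    {n : ℕ} (l : Fin n → Module.Dual K V) {x : R} (hx : x ∈ LinearMap.range ι ^ n) :
    h.lam n l (σ x) = h.lam n (fun i => l i ∘ₗ s) x := by
  induction n generalizing x with
  | zero =>
    rw [pow_zero] at hx
    obtain ⟨r, rfl⟩ := Submodule.mem_one.1 hx
    rw [AlgHom.commutes]
    rfl
  | succ n ih => rw [lam_succ, h.contract_map hσ _ hx, ih _ (h.contract_mem _ hx), lam_succ]

end SignedPower

/-! ### The first fundamental theorem for tensors -/

namespace FFT

/-! ### Matrix units acting on tensors, and the Casimir operator. -/

section Lie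

variable {K : Type*} [Field K] {I : Type*} [Fintype I] [DecidableEq I]

/-- The action of the matrix unit `E_{ij}` on functions of multi-indices. -/
def lieOp {S : Type*} [Fintype S] [DecidableEq S] (i j : I) (f : (S → I) → K) (P : S → I) : K :=
  ∑ a, if P a = i then f (Function.update P a j) else 0

/-- E_ij and E_ji are adjoint for the standard pairing: replacing the value i at slot a by j is a
bijection from {P a = i} to {P a = j}. -/
lemma sum_lieOp_mul {S : Type*} [Fintype S] [DecidableEq S] (i j : I) (f h : (S → I) → K) :
    ∑ P, lieOp i j f P * h P = ∑ P, f P * lieOp j i h P := by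
  simp only [lieOp, Finset.sum_mul, Finset.mul_sum, ite_mul, mul_ite, zero_mul, mul_zero]
  rw [Finset.sum_comm]
  conv_rhs => rw [Finset.sum_comm]
  refine Finset.sum_congr rfl fun a _ => ?_
  rw [← Finset.sum_filter, ← Finset.sum_filter]
  refine Finset.sum_bij' (fun P _ => Function.update P a j) (fun P _ => Function.update P a i)
    ?_ ?_ ?_ ?_ ?_ <;> intro P hP <;> simp only [Finset.mem_filter, Finset.mem_univ, true_and] at hP ⊢
  · simp
  · simp
  · rw [Function.update_idem, ← hP, Function.update_eq_self]
  · rw [Function.update_idem, ← hP, Function.update_eq_self]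
  · rw [Function.update_idem]
    congr 2
    rw [← hP, Function.update_eq_self]

/-- The Casimir operator. -/
def casimir {S : Type*} [Fintype S] [DecidableEq S] (f : (S → I) → K) : (S → I) → K :=
  ∑ i, ∑ k, lieOp i k (lieOp k i f)

/-- The identity matrix acts by the degree: each slot a contributes `f P` exactly once, for i = P a.
-/
lemma sum_lieOp_self {S : Type*} [Fintype S] [DecidableEq S] (f : (S → I) → K) (P : S → I) :
    ∑ i, lieOp i i f P = Fintype.card S * f P := by
  simp only [lieOp]
  rw [Finset.sum_comm]
  have : ∀ a, ∑ i, (if P a = i then f (Function.update P a i) else 0) = f P := by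
    intro a
    rw [Finset.sum_ite_eq]
    simp
  simp [this]

/-- By adjointness the pairing of `casimir f` with f is the sum of the squares of all values of all
E_ki f. If it vanishes, every E_ki kills f, and so does the degree operator Σ E_ii, which is a
nonzero scalar because there is at least one slot. -/
lemma casimir_eq_zero_rat {S : Type*} [Fintype S] [DecidableEq S] [Nonempty S]
    (f : (S → I) → ℚ) (hf : casimir f = 0) : f = 0 := by
  have h1 : ∑ i, ∑ k, ∑ P, lieOp k i f P * lieOp k i f P = 0 := by
    have h2 : ∑ P, casimir f P * f P = 0 := by simp [hf]
    rw [← h2]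
    simp only [casimir, Finset.sum_apply, Finset.sum_mul]
    conv_rhs => rw [Finset.sum_comm]
    refine Finset.sum_congr rfl fun i _ => ?_
    conv_rhs => rw [Finset.sum_comm]
    refine Finset.sum_congr rfl fun k _ => ?_
    rw [sum_lieOp_mul i k (lieOp k i f) f]
  have h3 : ∀ i k P, lieOp k i f P = 0 := by
    intro i k P
    have hk : ∀ i k, 0 ≤ ∑ P, lieOp k i f P * lieOp k i f P := fun i k =>
      Finset.sum_nonneg fun P _ => mul_self_nonneg _
    have h4 := (Finset.sum_eq_zero_iff_of_nonneg fun i _ =>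
      Finset.sum_nonneg fun k _ => hk i k).1 h1 i (Finset.mem_univ _)
    have h5 := (Finset.sum_eq_zero_iff_of_nonneg fun k _ => hk i k).1 h4 k (Finset.mem_univ _)
    have h6 := (Finset.sum_eq_zero_iff_of_nonneg fun P _ => mul_self_nonneg _).1 h5 P
      (Finset.mem_univ _)
    exact mul_self_eq_zero.1 h6
  ext P
  have h4 := sum_lieOp_self f P
  simp only [h3, Finset.sum_const_zero] at h4
  exact (mul_eq_zero.1 h4.symm).resolve_left (Nat.cast_ne_zero.2 Fintype.card_ne_zero)

lemma lieOp_comp_dual [CharZero K] {S : Type*} [Fintype S] [DecidableEq S] (φ : K →ₗ[ℚ] ℚ) (i j : I)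
    (f : (S → I) → K) : lieOp i j (fun P => φ (f P)) = fun P => φ (lieOp i j f P) := by
  ext P
  simp only [lieOp, map_sum]
  refine Finset.sum_congr rfl fun a _ => ?_
  split_ifs <;> simp

/-- The Casimir operator is defined over ℚ, so it commutes with ℚ-linear functionals K → ℚ. These
separate the points of K, which reduces the claim to the ordered field ℚ. -/
lemma casimir_eq_zero [CharZero K] {S : Type*} [Fintype S] [DecidableEq S] [Nonempty S]
    (f : (S → I) → K) (hf : casimir f = 0) : f = 0 := by
  ext P
  refine (Module.forall_dual_apply_eq_zero_iff ℚ (f P)).1 fun φ => ?_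
  have h1 : casimir (fun P => φ (f P)) = 0 := by
    simp only [casimir, lieOp_comp_dual φ]
    ext Q
    have := congrArg φ (congrFun hf Q)
    simpa [casimir] using this
  exact congrFun (casimir_eq_zero_rat _ h1) P

end Lie

/-! ### Tensors invariant under the Lie algebra are spanned by bijections of slots. -/

section Tensor

variable {K : Type*} [Field K] {I : Type*} [Fintype I] [DecidableEq I]

/-- The functions of pairs of multi-indices annihilated by `𝔤𝔩(I)`. -/
def lieInv (K I : Type*) [Field K] [Fintype I] [DecidableEq I] (S R : Type*) [Fintype S]
    [DecidableEq S] [Fintype R] [DecidableEq R] : Submodule K ((S → I) → (R → I) → K) where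
  carrier := {F | ∀ i j P Q, lieOp i j (fun P => F P Q) P = lieOp j i (F P) Q}
  zero_mem' := by intro i j P Q; simp [lieOp]
  add_mem' := by
    intro F G hF hG i j P Q
    have h1 := hF i j P Q
    have h2 := hG i j P Q
    simp only [lieOp, ← Finset.sum_filter] at h1 h2
    simp only [lieOp, ← Finset.sum_filter, Pi.add_apply, Finset.sum_add_distrib, h1, h2]
  smul_mem' := by
    intro c F hF i j P Q
    have h1 := hF i j P Q
    simp only [lieOp, ← Finset.sum_filter] at h1
    simp only [lieOp, ← Finset.sum_filter, Pi.smul_apply, ← Finset.smul_sum, h1]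

/-- The invariant attached to a bijection of slots. -/
def delta (K : Type*) [Field K] {I S R : Type*} [Fintype R] [DecidableEq I] (σ : R ≃ S) :
    (S → I) → (R → I) → K :=
  fun P Q => if Q = P ∘ σ then 1 else 0

/-- The span of the invariants attached to bijections of slots. -/
def deltaSpan (K I S R : Type*) [Field K] [Fintype R] [DecidableEq I] :
    Submodule K ((S → I) → (R → I) → K) :=
  Submodule.span K (Set.range fun σ : R ≃ S => delta K σ)

lemma delta_mem_lieInv {S R : Type*} [Fintype S] [DecidableEq S] [Fintype R] [DecidableEq R]
    (σ : R ≃ S) : delta K σ ∈ lieInv K I S R := by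
  intro i j P Q
  simp only [lieOp, delta]
  refine Fintype.sum_equiv σ.symm _ _ fun a => ?_
  obtain ⟨b, rfl⟩ := σ.surjective a
  rw [Equiv.symm_apply_apply, ← ite_and, ← ite_and]
  congr 1
  apply propext
  constructor
  · rintro ⟨h1, h2⟩
    have hQ : ∀ c, Q c = Function.update P (σ b) j (σ c) := fun c => congrFun h2 c
    refine ⟨by rw [hQ]; simp, ?_⟩
    ext c
    by_cases hc : c = b
    · subst hc; simp [h1]
    · simp [hc, hQ]
  · rintro ⟨h1, h2⟩
    have hQ : ∀ c, Function.update Q b i c = P (σ c) := fun c => congrFun h2 c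
    refine ⟨by rw [← hQ]; simp, ?_⟩
    ext c
    by_cases hc : c = b
    · subst hc; simp [h1]
    · have := hQ c
      simp [hc] at this ⊢
      exact this

/-- Summing the invariance condition over i = j compares the degree operators on the two sides. -/
lemma card_eq_of_mem_lieInv [CharZero K] {S R : Type*} [Fintype S] [DecidableEq S] [Fintype R]
    [DecidableEq R] {F : (S → I) → (R → I) → K} (hF : F ∈ lieInv K I S R) (h0 : F ≠ 0) :
    Fintype.card S = Fintype.card R := by
  by_contra hne
  apply h0
  ext P Q
  have h1 := sum_lieOp_self (fun P => F P Q) P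
  have h2 := sum_lieOp_self (F P) Q
  rw [Finset.sum_congr rfl fun i _ => hF i i P Q, h2] at h1
  have h3 : ((Fintype.card R : K) - Fintype.card S) * F P Q = 0 := by rw [sub_mul, h1, sub_self]
  refine (mul_eq_zero.1 h3).resolve_left fun h4 => hne ?_
  exact_mod_cast (sub_eq_zero.1 h4).symm

/-- Contraction of two slots. -/
def slotContract {n m : ℕ} (a : Fin (n + 1)) (b : Fin (m + 1))
    (F : (Fin (n + 1) → I) → (Fin (m + 1) → I) → K) : (Fin n → I) → (Fin m → I) → K :=
  fun P Q => ∑ k, F (a.insertNth k P) (b.insertNth k Q)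

lemma lieOp_insertNth {n : ℕ} (a : Fin (n + 1)) (i j k : I) (f : (Fin (n + 1) → I) → K)
    (P : Fin n → I) :
    lieOp i j f (a.insertNth k P) = (if k = i then f (a.insertNth j P) else 0) +
      lieOp i j (fun P => f (a.insertNth k P)) P := by
  rw [lieOp, Fin.sum_univ_succAbove _ a]
  have h1 : ∀ c, Function.update (a.insertNth k P : Fin (n + 1) → I) (a.succAbove c) j =
      a.insertNth k (Function.update P c j) := by
    intro c
    ext d
    induction d using a.succAboveCases with
    | x => simp
    | p d => simp [Function.update_apply]
  simp only [Fin.insertNth_apply_same, Fin.insertNth_apply_succAbove, Fin.update_insertNth, h1]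
  rfl

lemma lieOp_sum {S κ : Type*} [Fintype S] [DecidableEq S] [Fintype κ] (i j : I)
    (f : κ → (S → I) → K) (P : S → I) :
    lieOp i j (fun P => ∑ k, f k P) P = ∑ k, lieOp i j (f k) P := by
  simp only [lieOp]
  rw [Finset.sum_comm]
  refine Finset.sum_congr rfl fun a _ => ?_
  split_ifs <;> simp

/-- The matrix unit also acts on the contracted pair. Summed over k, its contributions on the two
sides are both the value of F with j inserted at a and i inserted at b, so they cancel. -/
lemma slotContract_mem {n m : ℕ} (a : Fin (n + 1)) (b : Fin (m + 1))
    {F : (Fin (n + 1) → I) → (Fin (m + 1) → I) → K}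
    (hF : F ∈ lieInv K I (Fin (n + 1)) (Fin (m + 1))) :
    slotContract a b F ∈ lieInv K I (Fin n) (Fin m) := by
  intro i j P Q
  have h1 : ∀ k, lieOp i j (fun P => F (a.insertNth k P) (b.insertNth k Q)) P =
      lieOp i j (fun P => F P (b.insertNth k Q)) (a.insertNth k P) -
        (if k = i then F (a.insertNth j P) (b.insertNth k Q) else 0) := fun k => by
    rw [lieOp_insertNth, add_sub_cancel_left]
  have h2 : ∀ k, lieOp j i (fun Q => F (a.insertNth k P) (b.insertNth k Q)) Q =
      lieOp j i (F (a.insertNth k P)) (b.insertNth k Q) -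
        (if k = j then F (a.insertNth k P) (b.insertNth i Q) else 0) := fun k => by
    rw [lieOp_insertNth, add_sub_cancel_left]
  change lieOp i j (fun P => ∑ k, F (a.insertNth k P) (b.insertNth k Q)) P =
    lieOp j i (fun Q => ∑ k, F (a.insertNth k P) (b.insertNth k Q)) Q
  rw [lieOp_sum, lieOp_sum, Finset.sum_congr rfl fun k _ => h1 k,
    Finset.sum_congr rfl fun k _ => h2 k, Finset.sum_sub_distrib, Finset.sum_sub_distrib,
    Finset.sum_congr rfl fun k _ => hF i j _ _]
  simp

/-- Insertion of an identity tensor into two slots. -/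
def slotInsert {n m : ℕ} (a : Fin (n + 1)) (b : Fin (m + 1)) :
    ((Fin n → I) → (Fin m → I) → K) →ₗ[K] (Fin (n + 1) → I) → (Fin (m + 1) → I) → K where
  toFun F := fun P Q => if P a = Q b then F (a.removeNth P) (b.removeNth Q) else 0
  map_add' F G := by ext P Q; simp only [Pi.add_apply]; split_ifs <;> simp
  map_smul' c F := by ext P Q; simp

/-- The new bijection extends σ by b ↦ a. -/
lemma slotInsert_delta {n m : ℕ} (a : Fin (n + 1)) (b : Fin (m + 1)) (σ : Fin m ≃ Fin n) :
    slotInsert a b (delta K σ : (Fin n → I) → (Fin m → I) → K) =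
      delta K (((finSuccEquiv' b).trans σ.optionCongr).trans (finSuccEquiv' a).symm) := by
  ext P Q
  simp only [slotInsert, delta, LinearMap.coe_mk, AddHom.coe_mk, ← ite_and]
  congr 1
  apply propext
  constructor
  · rintro ⟨h1, h2⟩
    ext c
    induction c using b.succAboveCases with
    | x => simpa using h1.symm
    | p c => simpa [Fin.removeNth] using congrFun h2 c
  · intro h
    refine ⟨by simpa using (congrFun h b).symm, ?_⟩
    ext c
    simpa [Fin.removeNth] using congrFun h (b.succAbove c)

/-- The sum of all contractions followed by the corresponding insertions. -/
def contractInsert (n m : ℕ) (F : (Fin (n + 1) → I) → (Fin (m + 1) → I) → K) :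
    (Fin (n + 1) → I) → (Fin (m + 1) → I) → K :=
  ∑ a, ∑ b, slotInsert a b (slotContract a b F)

/-- Invariance moves the inner operator E_ki from P to Q. What remains is the sum over slots a, b
and indices i, k of F with P a = Q b = i both replaced by k, which is contraction followed by
insertion. -/
lemma contractInsert_eq_casimir {n m : ℕ} {F : (Fin (n + 1) → I) → (Fin (m + 1) → I) → K}
    (hF : F ∈ lieInv K I (Fin (n + 1)) (Fin (m + 1))) (P : Fin (n + 1) → I)
    (Q : Fin (m + 1) → I) : contractInsert n m F P Q = casimir (fun P => F P Q) P := by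
  have h1 : ∀ i k, lieOp k i (fun P => F P Q) =
      fun P => ∑ b, if Q b = i then F P (Function.update Q b k) else 0 := by
    intro i k; ext P; rw [hF]; rfl
  simp only [contractInsert, casimir, h1, Finset.sum_apply, lieOp_sum]
  simp only [slotInsert, slotContract, LinearMap.coe_mk, AddHom.coe_mk, lieOp,
    Fin.insertNth_removeNth]
  conv_rhs => rw [Finset.sum_comm]; enter [2, k]; rw [Finset.sum_comm]; enter [2, b]; rw [Finset.sum_comm]
  conv_rhs => rw [Finset.sum_comm]; enter [2, b]; rw [Finset.sum_comm]
  rw [Finset.sum_comm]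
  refine Finset.sum_congr rfl fun b _ => Finset.sum_congr rfl fun a _ => ?_
  simp only [← ite_and]
  by_cases hab : P a = Q b
  · rw [if_pos hab]
    refine Finset.sum_congr rfl fun k _ => ?_
    rw [Finset.sum_eq_single (P a)]
    · simp [hab]
    · intro i _ hi
      rw [if_neg]
      exact fun h => hi h.1.symm
    · simp
  · rw [if_neg hab]
    symm
    refine Finset.sum_eq_zero fun k _ => Finset.sum_eq_zero fun i _ => ?_
    rw [if_neg]
    exact fun h => hab (h.1.trans h.2.symm)

lemma contractInsert_add {n m : ℕ} (F G : (Fin (n + 1) → I) → (Fin (m + 1) → I) → K) :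
    contractInsert n m (F + G) = contractInsert n m F + contractInsert n m G := by
  have : ∀ a b, slotContract a b (F + G) = slotContract a b F + slotContract a b G := by
    intro a b; ext P Q; simp [slotContract, Finset.sum_add_distrib]
  simp [contractInsert, this, Finset.sum_add_distrib]

lemma contractInsert_smul {n m : ℕ} (c : K) (F : (Fin (n + 1) → I) → (Fin (m + 1) → I) → K) :
    contractInsert n m (c • F) = c • contractInsert n m F := by
  have : ∀ a b, slotContract a b (c • F) = c • slotContract a b F := by
    intro a b; ext P Q; simp [slotContract, Finset.mul_sum]
  simp [contractInsert, this, Finset.smul_sum]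

lemma deltaSpan_le_lieInv {S R : Type*} [Fintype S] [DecidableEq S] [Fintype R] [DecidableEq R] :
    deltaSpan K I S R ≤ lieInv K I S R := by
  rw [deltaSpan, Submodule.span_le]
  rintro _ ⟨σ, rfl⟩
  exact delta_mem_lieInv σ

/-- Each contraction has fewer slots and lies in the span by induction, so `contractInsert` maps
invariants into the span. It agrees with the Casimir operator there, hence is injective, hence
surjective by finite dimension, and every invariant lies in its image. -/
lemma lieInv_fin_le [CharZero K] (n m : ℕ) :
    lieInv K I (Fin n) (Fin m) ≤ deltaSpan K I (Fin n) (Fin m) := by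
  induction n generalizing m with
  | zero =>
    intro F hF
    by_cases h0 : F = 0
    · rw [h0]; exact Submodule.zero_mem _
    have hc := card_eq_of_mem_lieInv hF h0
    simp only [Fintype.card_fin] at hc
    subst hc
    have : F = F Fin.elim0 Fin.elim0 • delta K (Equiv.refl (Fin 0)) := by
      ext P Q
      rw [Subsingleton.elim P Fin.elim0, Subsingleton.elim Q Fin.elim0]
      simp only [Pi.smul_apply, delta]
      rw [if_pos (Subsingleton.elim _ _)]
      simp
    rw [this]
    exact Submodule.smul_mem _ _ (Submodule.subset_span ⟨_, rfl⟩)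
  | succ n ih =>
    cases m with
    | zero =>
      intro F hF
      by_cases h0 : F = 0
      · rw [h0]; exact Submodule.zero_mem _
      have hc := card_eq_of_mem_lieInv hF h0
      simp at hc
    | succ m =>
      have h1 : ∀ F ∈ lieInv K I (Fin (n + 1)) (Fin (m + 1)),
          contractInsert n m F ∈ deltaSpan K I (Fin (n + 1)) (Fin (m + 1)) := by
        intro F hF
        refine Submodule.sum_mem _ fun a _ => Submodule.sum_mem _ fun b _ => ?_
        have h2 := ih m (slotContract_mem a b hF)
        have h3 : deltaSpan K I (Fin n) (Fin m) ≤
            (deltaSpan K I (Fin (n + 1)) (Fin (m + 1))).comap (slotInsert a b) := by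
          rw [deltaSpan, Submodule.span_le]
          rintro _ ⟨σ, rfl⟩
          rw [SetLike.mem_coe, Submodule.mem_comap, slotInsert_delta]
          exact Submodule.subset_span ⟨_, rfl⟩
        exact h3 h2
      -- An endomorphism of the space of invariants, since its values lie in the span of the δ_σ,
      -- which are invariant.
      let L : lieInv K I (Fin (n + 1)) (Fin (m + 1)) →ₗ[K] lieInv K I (Fin (n + 1)) (Fin (m + 1)) :=
        { toFun := fun F => ⟨contractInsert n m F, deltaSpan_le_lieInv (h1 F F.2)⟩
          map_add' := fun F G => Subtype.ext (contractInsert_add _ _)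
          map_smul' := fun c F => Subtype.ext (contractInsert_smul _ _) }
      have hL : Function.Injective L := by
        rw [← LinearMap.ker_eq_bot, LinearMap.ker_eq_bot']
        intro F hF
        have h2 : contractInsert n m F.1 = 0 := congrArg Subtype.val hF
        apply Subtype.ext
        ext P Q
        have h3 : casimir (fun P => F.1 P Q) = 0 := by
          ext P
          rw [← contractInsert_eq_casimir F.2, h2]
          rfl
        exact congrFun (casimir_eq_zero _ h3) P
      intro F hF
      obtain ⟨G, hG⟩ := LinearMap.injective_iff_surjective.1 hL ⟨F, hF⟩
      have := h1 G G.2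
      rwa [show contractInsert n m G.1 = F from congrArg Subtype.val hG] at this

lemma lieOp_reindex {S T : Type*} [Fintype S] [DecidableEq S] [Fintype T] [DecidableEq T]
    (e : S ≃ T) (i j : I) (f : (S → I) → K) (P : T → I) :
    lieOp i j (fun P => f (P ∘ e)) P = lieOp i j f (P ∘ e) := by
  refine (Fintype.sum_equiv e _ _ fun a => ?_).symm
  simp only [Function.comp_apply]
  congr 2
  ext b
  simp [Function.update_apply]

/-- An invariant function is a linear combination of those attached to bijections. -/
lemma lieInv_le [CharZero K] {S R : Type*} [Fintype S] [DecidableEq S] [Fintype R]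
    [DecidableEq R] : lieInv K I S R ≤ deltaSpan K I S R := by
  intro F hF
  let e := Fintype.equivFin S
  let e' := Fintype.equivFin R
  have h1 : (fun P Q => F (P ∘ e) (Q ∘ e')) ∈ lieInv K I (Fin (Fintype.card S))
      (Fin (Fintype.card R)) := by
    intro i j P Q
    have h2 := lieOp_reindex e i j (fun P => F P (Q ∘ e')) P
    have h3 := lieOp_reindex e' j i (F (P ∘ e)) Q
    rw [h2, h3]
    exact hF i j _ _
  have h2 := lieInv_fin_le _ _ h1
  let T : ((Fin (Fintype.card S) → I) → (Fin (Fintype.card R) → I) → K) →ₗ[K]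
      ((S → I) → (R → I) → K) :=
    { toFun := fun G P Q => G (P ∘ e.symm) (Q ∘ e'.symm)
      map_add' := fun _ _ => rfl
      map_smul' := fun _ _ => rfl }
  have h3 : deltaSpan K I (Fin (Fintype.card S)) (Fin (Fintype.card R)) ≤
      (deltaSpan K I S R).comap T := by
    rw [deltaSpan, Submodule.span_le]
    rintro _ ⟨σ, rfl⟩
    have : T (delta K σ) = delta K ((e'.trans σ).trans e.symm) := by
      ext P Q
      simp only [T, delta, LinearMap.coe_mk, AddHom.coe_mk]
      congr 1
      apply propext
      constructor
      · intro h; ext c; simpa using congrFun h (e' c)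
      · intro h; ext c; simpa using congrFun h (e'.symm c)
    rw [SetLike.mem_coe, Submodule.mem_comap, this]
    exact Submodule.subset_span ⟨_, rfl⟩
  have h4 : T (fun P Q => F (P ∘ e) (Q ∘ e')) = F := by
    ext P Q
    simp [T, Function.comp_assoc]
  rw [← h4]
  exact h3 h2

end Tensor
end FFT

namespace FFT

/-! ### From invariance under SL to invariance under the Lie algebra. -/

section Group

variable {K : Type*} [Field K] {I : Type*} [Fintype I] [DecidableEq I]
  {S R : Type*} [Fintype S] [DecidableEq S] [Fintype R] [DecidableEq R]

/-- The action of a matrix `g` with inverse `g'` on functions of pairs of multi-indices. -/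
def tensorAct (g g' : Matrix I I K) (F : (S → I) → (R → I) → K) : (S → I) → (R → I) → K :=
  fun P Q => ∑ P', ∑ Q', (∏ a, g (P a) (P' a)) * (∏ b, g' (Q' b) (Q b)) * F P' Q'

lemma prod_ite_eq {T : Type*} [Fintype T] [DecidableEq T] (d : I → K) (P P' : T → I) :
    ∏ a, (if P a = P' a then d (P a) else 0) = if P = P' then ∏ a, d (P a) else 0 := by
  split_ifs with h
  · subst h; simp
  · obtain ⟨a, ha⟩ := Function.ne_iff.1 h
    exact Finset.prod_eq_zero (Finset.mem_univ a) (if_neg ha)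

lemma tensorAct_diagonal (d d' : I → K) (F : (S → I) → (R → I) → K) (P : S → I) (Q : R → I) :
    tensorAct (Matrix.diagonal d) (Matrix.diagonal d') F P Q =
      (∏ a, d (P a)) * (∏ b, d' (Q b)) * F P Q := by
  have h1 : ∀ P' : S → I, ∏ a, Matrix.diagonal d (P a) (P' a) =
      if P = P' then ∏ a, d (P a) else 0 := fun P' => by
    rw [← prod_ite_eq]; simp [Matrix.diagonal_apply]
  have h2 : ∀ Q' : R → I, ∏ b, Matrix.diagonal d' (Q' b) (Q b) =
      if Q = Q' then ∏ b, d' (Q b) else 0 := fun Q' => by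
    rw [← prod_ite_eq]
    refine Finset.prod_congr rfl fun b _ => ?_
    rw [Matrix.diagonal_apply]
    by_cases hb : Q b = Q' b
    · rw [if_pos hb, if_pos hb.symm, hb]
    · rw [if_neg hb, if_neg (Ne.symm hb)]
  simp [tensorAct, h1, h2]

lemma card_eq_of_two_pow [CharZero K] {s r : ℕ} (h : (2 : K) ^ s * (2⁻¹ : K) ^ r = 1) : s = r := by
  have h1 : (2 : K) ^ s = 2 ^ r := by
    rw [inv_pow] at h
    exact (mul_inv_eq_one₀ (pow_ne_zero _ two_ne_zero)).1 h
  exact Nat.pow_right_injective le_rfl (by exact_mod_cast h1)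

/-- The scalar matrix 2 multiplies every value of F by 2 to the power |S| - |R|, and distinct powers
of 2 differ in characteristic 0. -/
lemma eq_zero_of_scalar [CharZero K] {F : (S → I) → (R → I) → K}
    (hF : ∀ g g' : Matrix I I K, g * g' = 1 → tensorAct g g' F = F)
    (hne : Fintype.card S ≠ Fintype.card R) : F = 0 := by
  ext P Q
  by_contra h0
  have h1 := congrFun (congrFun (hF (Matrix.diagonal fun _ => 2) (Matrix.diagonal fun _ => 2⁻¹)
    (by simp)) P) Q
  rw [tensorAct_diagonal] at h1
  have h2 := mul_right_cancel₀ h0 (h1.trans (one_mul _).symm)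
  simp only [Finset.prod_const, Finset.card_univ] at h2
  exact hne (card_eq_of_two_pow h2)

/-- The number of slots with a given index. -/
def weight {T : Type*} [Fintype T] (P : T → I) (i : I) : ℕ := (Finset.univ.filter fun a => P a = i).card

lemma sum_weight {T : Type*} [Fintype T] (P : T → I) : ∑ i, weight P i = Fintype.card T := by
  rw [← Finset.card_univ]
  exact (Finset.card_eq_sum_card_fiberwise fun _ _ => Finset.mem_coe.2 (Finset.mem_univ _)).symm

lemma prod_ite_weight {T : Type*} [Fintype T] (P : T → I) (i : I) (c : K) :
    ∏ a, (if P a = i then c else 1) = c ^ weight P i := by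
  rw [Finset.prod_ite, Finset.prod_const, Finset.prod_const_one, mul_one, weight]

/-- The test element is the diagonal matrix with entry 2 at i, 1/2 at j and 1 elsewhere; it has
determinant 1. -/
lemma weight_eq [CharZero K] {F : (S → I) → (R → I) → K}
    (hF : ∀ g g' : Matrix I I K, g * g' = 1 → g.det = 1 → tensorAct g g' F = F)
    {P : S → I} {Q : R → I} (h0 : F P Q ≠ 0) (i j : I) :
    weight P i + weight Q j = weight P j + weight Q i := by
  by_cases hij : i = j
  · rw [hij]
  let d : I → K := fun x => (if x = i then 2 else 1) * (if x = j then 2⁻¹ else 1)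
  let d' : I → K := fun x => (if x = i then 2⁻¹ else 1) * (if x = j then 2 else 1)
  have h1 := congrFun (congrFun (hF (Matrix.diagonal d) (Matrix.diagonal d') ?_ ?_) P) Q
  · rw [tensorAct_diagonal] at h1
    have h2 := mul_right_cancel₀ h0 (h1.trans (one_mul _).symm)
    simp only [d, d', Finset.prod_mul_distrib, prod_ite_weight] at h2
    refine card_eq_of_two_pow (K := K) ?_
    rw [← h2, pow_add, pow_add]
    ring
  · rw [Matrix.diagonal_mul_diagonal, ← Matrix.diagonal_one]
    congr 1
    ext x
    simp only [d, d']
    by_cases hi : x = i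
    · subst hi; simp [hij]
    · by_cases hj : x = j
      · subst hj; simp [hi]
      · simp [hi, hj]
  · rw [Matrix.det_diagonal]
    simp only [d]
    rw [Finset.prod_mul_distrib]
    simp

/-- Where F is nonzero, the difference of the weights of P and Q is the same for every index. These
card I equal differences add up to |S| - |R|. -/
lemma dvd_of_ne_zero [CharZero K] {F : (S → I) → (R → I) → K}
    (hF : ∀ g g' : Matrix I I K, g * g' = 1 → g.det = 1 → tensorAct g g' F = F) (h0 : F ≠ 0) :
    (Fintype.card I : ℤ) ∣ Fintype.card S - Fintype.card R := by
  obtain ⟨P, hP⟩ := Function.ne_iff.1 h0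
  obtain ⟨Q, hQ⟩ := Function.ne_iff.1 hP
  rw [← sum_weight P, ← sum_weight Q]
  push_cast
  rw [← Finset.sum_sub_distrib]
  rcases isEmpty_or_nonempty I with hI | ⟨⟨i⟩⟩
  · simp
  refine ⟨weight P i - weight Q i, ?_⟩
  rw [Finset.sum_congr rfl fun j _ => show (weight P j : ℤ) - weight Q j = weight P i - weight Q i by
    have := weight_eq hF hQ i j; omega]
  simp [mul_sub]

/-- The polynomial `∏ (δ + X A)` over the slots. -/
def slotPoly {T : Type*} [Fintype T] (A : I → I → K) (P P' : T → I) : Polynomial K :=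
  ∏ a, (Polynomial.C (if P a = P' a then 1 else 0) + Polynomial.X * Polynomial.C (A (P a) (P' a)))

lemma eval_slotPoly {T : Type*} [Fintype T] (A : I → I → K) (P P' : T → I) (t : K) :
    (slotPoly A P P').eval t = ∏ a, ((if P a = P' a then 1 else 0) + t * A (P a) (P' a)) := by
  rw [slotPoly, Polynomial.eval_prod]
  refine Finset.prod_congr rfl fun a _ => ?_
  rw [Polynomial.eval_add, Polynomial.eval_mul, Polynomial.eval_C, Polynomial.eval_C,
    Polynomial.eval_X]

lemma sum_slotPoly_eval_zero {T : Type*} [Fintype T] [DecidableEq T] (A : I → I → K)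
    (f : (T → I) → K) (P : T → I) : ∑ P', (slotPoly A P P').eval 0 * f P' = f P := by
  have : ∀ P' : T → I, (slotPoly A P P').eval 0 = if P = P' then 1 else 0 := fun P' => by
    have := prod_ite_eq (fun _ => (1 : K)) P P'
    simp only [Finset.prod_const_one] at this
    rw [eval_slotPoly, ← this]
    simp
  simp [this]

/-- In the Leibniz rule at t = 0, all factors but one become Kronecker deltas, so only those P'
contribute that agree with P outside one slot. -/
lemma sum_slotPoly_derivative {T : Type*} [Fintype T] [DecidableEq T] (A : I → I → K)
    (f : (T → I) → K) (P : T → I) :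
    ∑ P', (slotPoly A P P').derivative.eval 0 * f P' =
      ∑ a, ∑ j, A (P a) j * f (Function.update P a j) := by
  have h1 : ∀ P' : T → I, (slotPoly A P P').derivative.eval 0 =
      ∑ a, (if P' = Function.update P a (P' a) then A (P a) (P' a) else 0) := by
    intro P'
    rw [slotPoly, Polynomial.derivative_prod_finset, Polynomial.eval_finsetSum]
    refine Finset.sum_congr rfl fun a _ => ?_
    rw [Polynomial.eval_mul, Polynomial.eval_prod]
    simp only [Polynomial.derivative_add, Polynomial.derivative_C, Polynomial.derivative_mul,
      Polynomial.derivative_X, Polynomial.eval_add, Polynomial.eval_C, Polynomial.eval_mul,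
      Polynomial.eval_X, zero_mul, add_zero, zero_add, one_mul, mul_zero]
    split_ifs with h
    · rw [Finset.prod_eq_one, one_mul]
      intro b hb
      rw [if_pos]
      rw [h, Function.update_of_ne (Finset.ne_of_mem_erase hb)]
    · obtain ⟨b, hb⟩ := Function.ne_iff.1 h
      have hba : b ≠ a := by rintro rfl; simp at hb
      rw [Function.update_of_ne hba] at hb
      rw [Finset.prod_eq_zero (Finset.mem_erase.2 ⟨hba, Finset.mem_univ b⟩) (if_neg (Ne.symm hb)),
        zero_mul]
  simp only [h1, Finset.sum_mul, ite_mul, zero_mul]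
  rw [Finset.sum_comm]
  refine Finset.sum_congr rfl fun a _ => ?_
  rw [← Finset.sum_filter]
  refine Finset.sum_bij' (fun P' _ => P' a) (fun j _ => Function.update P a j) ?_ ?_ ?_ ?_ ?_
  · simp
  · simp
  · intro P' hP'
    exact (Finset.mem_filter.1 hP').2.symm
  · simp
  · intro P' hP'
    rw [← (Finset.mem_filter.1 hP').2]

/-- The transvections 1 + tE_ij act polynomially in t. Invariance for every t in the infinite field
K is an identity of polynomials, and its derivative at t = 0 is invariance under E_ij. -/
lemma lieOp_eq_of_ne [CharZero K] {F : (S → I) → (R → I) → K}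
    (hF : ∀ g g' : Matrix I I K, g * g' = 1 → g.det = 1 → tensorAct g g' F = F)
    {i j : I} (hij : i ≠ j) (P : S → I) (Q : R → I) :
    lieOp i j (fun P => F P Q) P = lieOp j i (F P) Q := by
  let A : I → I → K := fun x y => if x = i then if y = j then 1 else 0 else 0
  -- The inverse of 1 + tE_ij is 1 - tE_ij, and it enters `tensorAct` transposed, whence the sign
  -- and the exchanged arguments.
  let A' : I → I → K := fun x y => -A y x
  have h1 : ∑ P', ∑ Q', slotPoly A P P' * slotPoly A' Q Q' * Polynomial.C (F P' Q') =
      Polynomial.C (F P Q) := by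
    apply Polynomial.funext
    intro t
    simp only [Polynomial.eval_finsetSum, Polynomial.eval_mul, Polynomial.eval_C, eval_slotPoly]
    have h2 := congrFun (congrFun (hF (Matrix.transvection i j t) (Matrix.transvection i j (-t))
      (by rw [Matrix.transvection_mul_transvection_same _ _ hij, add_neg_cancel,
        Matrix.transvection_zero]) (Matrix.det_transvection_of_ne _ _ hij t)) P) Q
    rw [← h2, tensorAct]
    refine Finset.sum_congr rfl fun P' _ => Finset.sum_congr rfl fun Q' _ => ?_
    congr 2
    · refine Finset.prod_congr rfl fun a _ => ?_
      simp only [Matrix.transvection, Matrix.add_apply, Matrix.one_apply, Matrix.single_apply, A]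
      congr 1
      simp only [← ite_and, mul_ite, mul_one, mul_zero, eq_comm]
    · refine Finset.prod_congr rfl fun a _ => ?_
      simp only [Matrix.transvection, Matrix.add_apply, Matrix.one_apply, Matrix.single_apply, A,
        A']
      congr 1
      · simp only [eq_comm]
      · simp only [← ite_and, mul_neg, mul_ite, mul_one, mul_zero, eq_comm (a := i),
          eq_comm (a := j)]
        split_ifs <;> simp
  have h2 := congrArg (fun p => Polynomial.eval 0 (Polynomial.derivative p)) h1
  simp only [Polynomial.derivative_sum, Polynomial.derivative_mul, Polynomial.derivative_C,
    mul_zero, add_zero, Polynomial.eval_finsetSum, Polynomial.eval_mul, Polynomial.eval_add,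
    Polynomial.eval_C, Polynomial.eval_zero, add_mul, Finset.sum_add_distrib] at h2
  have h3 : ∑ P', ∑ Q', (slotPoly A P P').derivative.eval 0 * (slotPoly A' Q Q').eval 0 *
      F P' Q' = lieOp i j (fun P => F P Q) P := by
    simp only [mul_assoc, ← Finset.mul_sum, sum_slotPoly_eval_zero]
    rw [sum_slotPoly_derivative A (fun P => F P Q), lieOp]
    refine Finset.sum_congr rfl fun a _ => ?_
    simp only [A]
    split_ifs <;> simp
  have h4 : ∑ P', ∑ Q', (slotPoly A P P').eval 0 * (slotPoly A' Q Q').derivative.eval 0 *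
      F P' Q' = -lieOp j i (F P) Q := by
    simp only [mul_assoc, ← Finset.mul_sum, sum_slotPoly_derivative]
    rw [sum_slotPoly_eval_zero A (fun P' => ∑ b, ∑ k, A' (Q b) k * F P' (Function.update Q b k)),
      lieOp, ← Finset.sum_neg_distrib]
    refine Finset.sum_congr rfl fun a _ => ?_
    simp only [A', A]
    rw [Finset.sum_eq_single i] <;> simp +contextual
  rw [h3, h4] at h2
  exact eq_of_sub_eq_zero (by rw [sub_eq_add_neg]; exact h2)

lemma lieOp_self_eq {T : Type*} [Fintype T] [DecidableEq T] (f : (T → I) → K) (i : I) (P : T → I) :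
    lieOp i i f P = weight P i * f P := by
  rw [lieOp, weight, ← Finset.sum_filter, Finset.sum_congr rfl (g := fun _ => f P)]
  · simp
  · intro a ha
    rw [← (Finset.mem_filter.1 ha).2, Function.update_eq_self]

/-- The first fundamental theorem for `SL`, in coordinates. -/
theorem mem_deltaSpan [CharZero K] {F : (S → I) → (R → I) → K}
    (hF : ∀ g g' : Matrix I I K, g * g' = 1 → g.det = 1 → tensorAct g g' F = F)
    (hc : Fintype.card S = Fintype.card R) : F ∈ deltaSpan K I S R := by
  apply lieInv_le
  intro i j P Q
  by_cases hij : i = j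
  · subst hij
    rw [lieOp_self_eq, lieOp_self_eq (F P)]
    by_cases h0 : F P Q = 0
    · rw [h0, mul_zero, mul_zero]
    congr 2
    -- Equality of the numbers of slots makes the weight differences sum to 0. They are all equal,
    -- so each is 0: this supplies the diagonal matrix units without using elements outside SL.
    have h1 : (∑ j, ((weight P j : ℤ) - weight Q j)) = 0 := by
      rw [Finset.sum_sub_distrib]
      have := sum_weight P
      have := sum_weight Q
      zify at *
      omega
    rw [Finset.sum_congr rfl fun j _ => show (weight P j : ℤ) - weight Q j =
      weight P i - weight Q i by have := weight_eq hF h0 i j; omega] at h1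
    simp only [Finset.sum_const, Finset.card_univ, nsmul_eq_mul, mul_eq_zero, Nat.cast_eq_zero] at h1
    rcases h1 with h1 | h1
    · exact absurd h1 (Fintype.card_pos_iff.2 ⟨i⟩).ne'
    · omega
  · exact lieOp_eq_of_ne hF hij P Q

end Group
end FFT

/-! ### Pair spaces: the degree two part of a symmetric or exterior algebra -/

/-- The structure common to `S^2(V)` (`e = 1`) and `Λ^2(V)` (`e = -1`). -/
structure PairSpace (K V M : Type*) [Field K] [AddCommGroup V] [Module K V] [AddCommGroup M]
    [Module K M] (e : K) where
  pair : V →ₗ[K] V →ₗ[K] M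
  dual : Module.Dual K V →ₗ[K] Module.Dual K V →ₗ[K] Module.Dual K M
  dual_pair : ∀ φ ψ x y, dual φ ψ (pair x y) = φ x * ψ y + e * (φ y * ψ x)
  swap : ∀ x y, pair x y = e • pair y x
  span : ⊤ ≤ Submodule.span K (Set.range fun z : V × V => pair z.1 z.2)

/-- The degree two part of a signed power is a pair space. -/
def SignedPower.pairSpace {K V R : Type*} [Field K] [AddCommGroup V] [Module K V] [Ring R]
    [Algebra K R] {ι : V →ₗ[K] R} {e : K} (h : SignedPower ι e) :
    PairSpace K V (LinearMap.range ι ^ 2 : Submodule K R) e where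
  pair := LinearMap.mk₂ K (fun x y => ⟨ι x * ι y, by
      rw [pow_two]; exact Submodule.mul_mem_mul ⟨x, rfl⟩ ⟨y, rfl⟩⟩)
    (fun x y z => by ext; simp [add_mul]) (fun c x y => by ext; simp)
    (fun x y z => by ext; simp [mul_add]) (fun c x y => by ext; simp)
  dual := LinearMap.mk₂ K
    (fun φ ψ => (h.aug ∘ₗ h.contract ψ ∘ₗ h.contract φ) ∘ₗ Submodule.subtype _)
    (fun x y z => by ext; simp) (fun c x y => by ext; simp)
    (fun x y z => by ext; simp) (fun c x y => by ext; simp)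
  dual_pair φ ψ x y := by
    have h1 : ∀ l v, h.contract l (ι v) = l v • 1 := fun l v => by
      have := h.contract_ι_mul l v 1
      rwa [mul_one, h.contract_one, mul_zero, smul_zero, add_zero] at this
    simp only [LinearMap.mk₂_apply, LinearMap.comp_apply, Submodule.subtype_apply,
      h.contract_ι_mul, map_add, map_smul, h1, mul_smul_comm, mul_one, h.aug_one, smul_eq_mul]
  swap x y := Subtype.ext (h.swap x y)
  span := by
    rintro ⟨x, hx⟩ -
    have key : ∀ x ∈ LinearMap.range ι ^ 2, ∃ y ∈ Submodule.span K (Set.range fun z : V × V =>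
        (⟨ι z.1 * ι z.2, by rw [pow_two]; exact Submodule.mul_mem_mul ⟨_, rfl⟩ ⟨_, rfl⟩⟩ :
          (LinearMap.range ι ^ 2 : Submodule K R))), (y : R) = x := by
      intro x hx
      rw [pow_two] at hx
      induction hx using Submodule.mul_induction_on' with
      | mem_mul_mem m hm n hn =>
        obtain ⟨v, rfl⟩ := hm
        obtain ⟨w, rfl⟩ := hn
        exact ⟨_, Submodule.subset_span ⟨(v, w), rfl⟩, rfl⟩
      | add x hx y hy ihx ihy =>
        obtain ⟨x', hx', rfl⟩ := ihx
        obtain ⟨y', hy', rfl⟩ := ihy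
        exact ⟨_, Submodule.add_mem _ hx' hy', rfl⟩
    obtain ⟨y, hy, hyx⟩ := key x hx
    have : (⟨x, hx⟩ : (LinearMap.range ι ^ 2 : Submodule K R)) = y := Subtype.ext hyx.symm
    rw [this]
    exact hy

namespace PairSpace

variable {K V M : Type*} [Field K] [AddCommGroup V] [Module K V] [AddCommGroup M]
    [Module K M] {e : K} (h : PairSpace K V M e)

lemma induction {C : M → Prop} (h0 : ∀ x y, C (h.pair x y)) (hadd : ∀ x y, C x → C y → C (x + y))
    (hsmul : ∀ (c : K) x, C x → C (c • x)) (m : M) : C m := by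
  have hm := h.span (Submodule.mem_top (x := m))
  induction hm using Submodule.span_induction with
  | mem x hx => obtain ⟨z, rfl⟩ := hx; exact h0 _ _
  | zero => simpa using h0 0 0
  | add x y _ _ hx hy => exact hadd _ _ hx hy
  | smul c x _ hx => exact hsmul c x hx

/-- The sum runs over ordered pairs of indices, so each of the two terms of `dual_pair` reproduces m
once; hence the factor 2. -/
lemma frame {I : Type*} [Fintype I] (a : Module.Basis I K V) (m : M) :
    ∑ z : I × I, h.dual (a.coord z.1) (a.coord z.2) m • h.pair (a z.1) (a z.2) = (2 : K) • m := by
  induction m using h.induction with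
  | h0 x y =>
    have h1 : ∀ x y, ∑ z : I × I, (a.coord z.1 x * a.coord z.2 y) • h.pair (a z.1) (a z.2) =
        h.pair x y := by
      intro x y
      rw [Fintype.sum_prod_type]
      conv_rhs => rw [← a.sum_repr x, ← a.sum_repr y]
      simp only [map_sum, map_smul, LinearMap.sum_apply, LinearMap.smul_apply, Finset.smul_sum,
        smul_smul, Module.Basis.coord_apply]
      rw [Finset.sum_comm]
      simp only [mul_comm]
    simp only [h.dual_pair, add_smul, mul_smul e, Finset.sum_add_distrib, ← Finset.smul_sum]
    rw [h1, h1, ← h.swap, two_smul]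
  | hadd x y hx hy => simp only [map_add, add_smul, Finset.sum_add_distrib, hx, hy, smul_add]
  | hsmul c x hx =>
    simp only [map_smul, smul_eq_mul, mul_smul, ← Finset.smul_sum, hx]
    rw [smul_comm]

lemma dual_comp {s : V →ₗ[K] V} {t : M →ₗ[K] M} (ht : ∀ x y, t (h.pair x y) = h.pair (s x) (s y))
    (φ ψ : Module.Dual K V) : h.dual φ ψ ∘ₗ t = h.dual (φ ∘ₗ s) (ψ ∘ₗ s) := by
  ext m
  induction m using h.induction with
  | h0 x y => simp [ht, h.dual_pair]
  | hadd x y hx hy => rw [map_add, map_add, hx, hy]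
  | hsmul c x hx => rw [map_smul, map_smul, hx]

end PairSpace

/-! ### Threefold tensor products of signed powers -/

/-- The slots of `S^p(M) ⊗ P^q(N ⊗ W)` taking values in `N`. -/
abbrev Slots (p q : ℕ) : Type := (Fin p × Fin 2) ⊕ Fin q

/-- Assemble a function on slots from its values on pairs and on single slots. -/
def slotEquiv (p q : ℕ) (I : Type*) : (Fin p → I × I) × (Fin q → I) ≃ (Slots p q → I) where
  toFun z := Sum.elim (fun k => ![(z.1 k.1).1, (z.1 k.1).2] k.2) z.2
  invFun P := (fun k => (P (.inl (k, 0)), P (.inl (k, 1))), fun l => P (.inr l))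
  left_inv z := by ext <;> simp
  right_inv P := by
    ext x
    rcases x with ⟨k, i⟩ | l
    · fin_cases i <;> simp
    · simp

lemma sum_slots {p q : ℕ} {I M : Type*} [Fintype I] [AddCommMonoid M] (f : (Slots p q → I) → M) :
    ∑ P, f P = ∑ z : Fin p → I × I, ∑ y : Fin q → I, f (slotEquiv p q I (z, y)) := by
  rw [← Fintype.sum_prod_type']
  exact (Fintype.sum_equiv (slotEquiv p q I) _ _ fun _ => rfl).symm

lemma sum_arrow_prod {T X Y M : Type*} [Fintype T] [DecidableEq T] [Fintype X] [Fintype Y]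
    [AddCommMonoid M] (f : (T → X × Y) → M) :
    ∑ t, f t = ∑ x : T → X, ∑ y : T → Y, f fun k => (x k, y k) := by
  rw [← Fintype.sum_prod_type']
  exact Fintype.sum_equiv (Equiv.arrowProdEquivProdArrow _ _ _) _ _ fun _ => rfl

section Triple

variable {K N N' W U M R₁ R₂ R₃ : Type*} [Field K] [AddCommGroup N] [Module K N]
  [AddCommGroup N'] [Module K N']
  [AddCommGroup W] [Module K W] [AddCommGroup U] [Module K U] [AddCommGroup M] [Module K M]
  [Ring R₁] [Algebra K R₁] [Ring R₂] [Algebra K R₂] [Ring R₃] [Algebra K R₃]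
  {e₀ e₁ e₂ e₃ : K} {ι₁ : M →ₗ[K] R₁} {ι₂ : N ⊗[K] W →ₗ[K] R₂}
  {ι₃ : N' ⊗[K] U →ₗ[K] R₃}
  (h₀ : PairSpace K N M e₀) (h₁ : SignedPower ι₁ e₁) (h₂ : SignedPower ι₂ e₂)
  (h₃ : SignedPower ι₃ e₃) (ev : N →ₗ[K] Module.Dual K N')

/-- The tensor product of three linear forms. -/
def triForm (l₁ : R₁ →ₗ[K] K) (l₂ : R₂ →ₗ[K] K) (l₃ : R₃ →ₗ[K] K) :
    (R₁ ⊗[K] R₂) ⊗[K] R₃ →ₗ[K] K :=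
  LinearMap.mul' K K ∘ₗ TensorProduct.map (LinearMap.mul' K K ∘ₗ TensorProduct.map l₁ l₂) l₃

@[simp]
lemma triForm_tmul (l₁ : R₁ →ₗ[K] K) (l₂ : R₂ →ₗ[K] K) (l₃ : R₃ →ₗ[K] K) (x : R₁) (y : R₂)
    (z : R₃) : triForm l₁ l₂ l₃ ((x ⊗ₜ y) ⊗ₜ z) = l₁ x * l₂ y * l₃ z := by
  simp [triForm]

variable (ι₁ ι₂ ι₃) in
/-- The part of tridegree `(p, q, r)`. -/
def triGraded (p q r : ℕ) : Submodule K ((R₁ ⊗[K] R₂) ⊗[K] R₃) :=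
  LinearMap.range (TensorProduct.map
    (TensorProduct.map (LinearMap.range ι₁ ^ p).subtype (LinearMap.range ι₂ ^ q).subtype)
    (LinearMap.range ι₃ ^ r).subtype)

@[elab_as_elim]
lemma triGraded_induction {p q r : ℕ} {C : (R₁ ⊗[K] R₂) ⊗[K] R₃ → Prop}
    (h0 : ∀ x ∈ LinearMap.range ι₁ ^ p, ∀ y ∈ LinearMap.range ι₂ ^ q,
      ∀ z ∈ LinearMap.range ι₃ ^ r, C ((x ⊗ₜ y) ⊗ₜ z))
    (hadd : ∀ x y, C x → C y → C (x + y)) {f : (R₁ ⊗[K] R₂) ⊗[K] R₃}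
    (hf : f ∈ triGraded ι₁ ι₂ ι₃ p q r) : C f := by
  obtain ⟨t, rfl⟩ := hf
  induction t with
  | zero =>
    have := h0 0 (Submodule.zero_mem _) 0 (Submodule.zero_mem _) 0 (Submodule.zero_mem _)
    simpa using this
  | add x y hx hy => rw [map_add]; exact hadd _ _ hx hy
  | tmul x z =>
    induction x with
    | zero =>
      have := h0 0 (Submodule.zero_mem _) 0 (Submodule.zero_mem _) 0 (Submodule.zero_mem _)
      simpa using this
    | add x y hx hy => rw [TensorProduct.add_tmul, map_add]; exact hadd _ _ hx hy
    | tmul x y => exact h0 _ x.2 _ y.2 _ z.2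

variable (ι₁ ι₂ ι₃) in
/-- The monomial attached to vectors in all slots. -/
def triMonomial {p q r : ℕ} (x : Slots p q → N) (w : Fin q → W) (φ : Fin r → N')
    (u : Fin r → U) : (R₁ ⊗[K] R₂) ⊗[K] R₃ :=
  (SignedPower.prodι ι₁ (fun k => h₀.pair (x (.inl (k, 0))) (x (.inl (k, 1)))) ⊗ₜ[K]
    SignedPower.prodι ι₂ (fun l => x (.inr l) ⊗ₜ w l)) ⊗ₜ[K]
    SignedPower.prodι ι₃ (fun k => φ k ⊗ₜ u k)

lemma triMonomial_mem {p q r : ℕ} (x : Slots p q → N) (w : Fin q → W)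
    (φ : Fin r → N') (u : Fin r → U) :
    triMonomial ι₁ ι₂ ι₃ h₀ x w φ u ∈ triGraded ι₁ ι₂ ι₃ p q r :=
  ⟨(⟨_, SignedPower.prodι_mem _⟩ ⊗ₜ ⟨_, SignedPower.prodι_mem _⟩) ⊗ₜ
    ⟨_, SignedPower.prodι_mem _⟩, rfl⟩

/-- The linear form attached to covectors in all slots. -/
def triLam {p q r : ℕ} (φ : Slots p q → Module.Dual K N) (ω : Fin q → Module.Dual K W)
    (x : Fin r → N) (υ : Fin r → Module.Dual K U) : (R₁ ⊗[K] R₂) ⊗[K] R₃ →ₗ[K] K :=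
  triForm (h₁.lam p fun k => h₀.dual (φ (.inl (k, 0))) (φ (.inl (k, 1))))
    (h₂.lam q fun l => TensorProduct.dualDistrib K N W (φ (.inr l) ⊗ₜ ω l))
    (h₃.lam r fun k => TensorProduct.dualDistrib K N' U
      (ev (x k) ⊗ₜ υ k))

variable {I β γ : Type*} [Fintype I] [Fintype β] [Fintype γ]

lemma triLam_sum {p q r : ℕ} (g : Slots p q → I → K) (φ : I → Module.Dual K N)
    (ω : Fin q → Module.Dual K W) (g' : Fin r → I → K) (x : I → N) (υ : Fin r → Module.Dual K U)
    (f : (R₁ ⊗[K] R₂) ⊗[K] R₃) :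
    triLam h₀ h₁ h₂ h₃ ev (fun s => ∑ i, g s i • φ i) ω (fun k => ∑ i, g' k i • x i) υ f =
      ∑ P : Slots p q → I, ∑ Q : Fin r → I, (∏ s, g s (P s)) * (∏ k, g' k (Q k)) *
        triLam h₀ h₁ h₂ h₃ ev (fun s => φ (P s)) ω (fun k => x (Q k)) υ f := by
  induction f with
  | zero => simp
  | add f f' hf hf' => simp only [map_add, hf, hf', mul_add, Finset.sum_add_distrib]
  | tmul f z =>
  induction f with
  | zero => simp
  | add f f' hf hf' =>
    simp only [TensorProduct.add_tmul, map_add, hf, hf', mul_add, Finset.sum_add_distrib]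
  | tmul x' y =>
    simp only [triLam, triForm_tmul]
    have e1 : (fun k : Fin p => h₀.dual (∑ i, g (.inl (k, 0)) i • φ i)
        (∑ i, g (.inl (k, 1)) i • φ i)) = fun k => ∑ z : I × I,
          (g (.inl (k, 0)) z.1 * g (.inl (k, 1)) z.2) • h₀.dual (φ z.1) (φ z.2) := by
      ext1 k
      rw [Fintype.sum_prod_type]
      simp only [map_sum, map_smul, LinearMap.sum_apply, LinearMap.smul_apply, Finset.smul_sum,
        smul_smul]
      rw [Finset.sum_comm]
      simp only [mul_comm]
    have e2 : (fun l : Fin q => TensorProduct.dualDistrib K N W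
        ((∑ i, g (.inr l) i • φ i) ⊗ₜ ω l)) = fun l => ∑ i, g (.inr l) i •
          TensorProduct.dualDistrib K N W (φ i ⊗ₜ ω l) := by
      ext1 l
      simp only [TensorProduct.sum_tmul, ← TensorProduct.smul_tmul', map_sum, map_smul]
    have e3 : (fun k : Fin r => TensorProduct.dualDistrib K N' U
        (ev (∑ i, g' k i • x i) ⊗ₜ υ k)) = fun k => ∑ i, g' k i •
          TensorProduct.dualDistrib K N' U
            (ev (x i) ⊗ₜ υ k) := by
      ext1 k
      simp only [map_sum, map_smul, TensorProduct.sum_tmul, ← TensorProduct.smul_tmul']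
    rw [e1, e2, e3, h₁.lam_sum, h₂.lam_sum, h₃.lam_sum, sum_slots, Finset.sum_mul_sum,
      Finset.sum_mul]
    refine Finset.sum_congr rfl fun a _ => ?_
    rw [Finset.sum_mul_sum]
    refine Finset.sum_congr rfl fun b _ => Finset.sum_congr rfl fun c _ => ?_
    rw [Fintype.prod_sum_type, Fintype.prod_prod_type]
    simp only [Fin.prod_univ_two, slotEquiv, Equiv.coe_fn_mk, Sum.elim_inl, Sum.elim_inr,
      Matrix.cons_val_zero, Matrix.cons_val_one]
    ring

section Act

variable {s : N ≃ₗ[K] N} {t : M →ₗ[K] M} {σ₁ : R₁ →ₐ[K] R₁} {σ₂ : R₂ →ₐ[K] R₂}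
  {σ₃ : R₃ →ₐ[K] R₃} {τ : N' →ₗ[K] N'}

lemma triLam_act (ht : ∀ x y, t (h₀.pair x y) = h₀.pair (s x) (s y))
    (hσ₁ : ∀ m, σ₁ (ι₁ m) = ι₁ (t m))
    (hσ₂ : ∀ x w, σ₂ (ι₂ (x ⊗ₜ w)) = ι₂ (s x ⊗ₜ w))
    (hσ₃ : ∀ φ u, σ₃ (ι₃ (φ ⊗ₜ u)) = ι₃ (τ φ ⊗ₜ u))
    (hτ : ∀ x φ, ev x (τ φ) = ev (s.symm x) φ)
    {p q r : ℕ} (φ : Slots p q → Module.Dual K N) (ω : Fin q → Module.Dual K W)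
    (x : Fin r → N) (υ : Fin r → Module.Dual K U) {f : (R₁ ⊗[K] R₂) ⊗[K] R₃}
    (hf : f ∈ triGraded ι₁ ι₂ ι₃ p q r) :
    triLam h₀ h₁ h₂ h₃ ev φ ω x υ (Algebra.TensorProduct.map (Algebra.TensorProduct.map σ₁ σ₂) σ₃ f) =
      triLam h₀ h₁ h₂ h₃ ev (fun k => φ k ∘ₗ s) ω (fun k => s.symm (x k)) υ f := by
  have hσ₂' : ∀ v, σ₂ (ι₂ v) = ι₂ (TensorProduct.map s.toLinearMap LinearMap.id v) := by
    intro v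
    induction v with
    | zero => simp
    | tmul x w => rw [hσ₂]; rfl
    | add x y hx hy => simp only [map_add, hx, hy]
  have hσ₃' : ∀ v, σ₃ (ι₃ v) =
      ι₃ (TensorProduct.map τ LinearMap.id v) := by
    intro v
    induction v with
    | zero => simp
    | tmul x w => rw [hσ₃]; rfl
    | add x y hx hy => simp only [map_add, hx, hy]
  refine triGraded_induction (fun a ha b hb c hc => ?_) (fun a b ha hb => ?_) hf
  · simp only [Algebra.TensorProduct.map_tmul, triLam, triForm_tmul]
    rw [h₁.lam_map hσ₁ _ ha, h₂.lam_map hσ₂' _ hb, h₃.lam_map hσ₃' _ hc]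
    have e2 : ∀ (φ : Module.Dual K N) (ω : Module.Dual K W),
        TensorProduct.dualDistrib K N W (φ ⊗ₜ ω) ∘ₗ TensorProduct.map s.toLinearMap LinearMap.id =
          TensorProduct.dualDistrib K N W ((φ ∘ₗ s.toLinearMap) ⊗ₜ ω) := fun φ ω => by
      apply TensorProduct.ext'
      simp
    have e3 : ∀ (x : N) (υ : Module.Dual K U),
        TensorProduct.dualDistrib K N' U (ev x ⊗ₜ υ) ∘ₗ TensorProduct.map τ LinearMap.id =
          TensorProduct.dualDistrib K N' U (ev (s.symm x) ⊗ₜ υ) := fun x υ => by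
      apply TensorProduct.ext'
      simp [hτ]
    simp only [h₀.dual_comp ht, e2, e3]
  · simp only [map_add, ha, hb]

end Act

variable (a : Module.Basis I K N) (a' : Module.Basis I K N') (b : Module.Basis β K W) (c : Module.Basis γ K U)

/-- The coordinate functions of an element. -/
def triCoord (p q r : ℕ) (w : Fin q → β) (u : Fin r → γ) (f : (R₁ ⊗[K] R₂) ⊗[K] R₃) :
    (Slots p q → I) → (Fin r → I) → K := fun P Q =>
  triLam h₀ h₁ h₂ h₃ ev (fun s => a.coord (P s)) (fun l => b.coord (w l)) (fun k => a (Q k))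
    (fun k => c.coord (u k)) f

lemma frame_tensor {X Y : Type*} [AddCommGroup X] [Module K X] [AddCommGroup Y] [Module K Y]
    {I J : Type*} [Fintype I] [Fintype J] (x : I → X) (x' : I → Module.Dual K X)
    (hx : ∀ v, ∑ i, x' i v • x i = v) (y : Module.Basis J K Y) (v : X ⊗[K] Y) :
    ∑ z : I × J, TensorProduct.dualDistrib K X Y (x' z.1 ⊗ₜ y.coord z.2) v • (x z.1 ⊗ₜ[K] y z.2) =
      (1 : K) • v := by
  rw [one_smul]
  induction v with
  | zero => simp
  | add v w hv hw => simp only [map_add, add_smul, Finset.sum_add_distrib, hv, hw]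
  | tmul v w =>
    rw [Fintype.sum_prod_type]
    conv_rhs => rw [← hx v, ← y.sum_repr w]
    simp only [TensorProduct.dualDistrib_apply, TensorProduct.sum_tmul, TensorProduct.tmul_sum,
      TensorProduct.smul_tmul_smul, Module.Basis.coord_apply]
    rw [Finset.sum_comm]

/-- The indices c and e, which will run over bases of W and U, are pulled to the outside, because
the tensor argument is applied with them fixed. -/
lemma sum_tmul_sum_tmul_sum {X Y Z : Type*} [AddCommGroup X] [Module K X] [AddCommGroup Y]
    [Module K Y] [AddCommGroup Z] [Module K Z] {i₁ i₂ i₃ i₄ i₅ : Type*} [Fintype i₁] [Fintype i₂]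
    [Fintype i₃] [Fintype i₄] [Fintype i₅] (x : i₁ → X) (y : i₂ → i₃ → Y) (z : i₄ → i₅ → Z) :
    ((∑ a, x a) ⊗ₜ[K] (∑ b, ∑ c, y b c)) ⊗ₜ[K] (∑ d, ∑ e, z d e) =
      ∑ c, ∑ e, ∑ a, ∑ b, ∑ d, (x a ⊗ₜ[K] y b c) ⊗ₜ[K] z d e := by
  have hy : ∑ b, ∑ c, y b c = ∑ c, ∑ b, y b c := Finset.sum_comm
  have hz : ∑ d, ∑ e, z d e = ∑ e, ∑ d, z d e := Finset.sum_comm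
  rw [hy, hz, TensorProduct.tmul_sum (∑ a, x a), TensorProduct.sum_tmul]
  congr 1; ext1 c
  rw [TensorProduct.tmul_sum]
  congr 1; ext1 e
  rw [TensorProduct.sum_tmul, TensorProduct.sum_tmul]
  congr 1; ext1 a
  rw [TensorProduct.tmul_sum (x a), TensorProduct.sum_tmul]
  congr 1; ext1 b
  rw [TensorProduct.tmul_sum]

/-- The three factors are reconstructed separately. The constant is p!·2^p, from frames of pair
spaces with c = 2, times q! and r!, from frames with c = 1. -/
lemma triReconstruct [DecidableEq I]
    (hev : ∀ i j, ev (a i) (a' j) = if i = j then 1 else 0) {p q r : ℕ} {f : (R₁ ⊗[K] R₂) ⊗[K] R₃}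
    (hf : f ∈ triGraded ι₁ ι₂ ι₃ p q r) :
    ∑ w : Fin q → β, ∑ u : Fin r → γ, ∑ P : Slots p q → I, ∑ Q : Fin r → I,
      triCoord h₀ h₁ h₂ h₃ ev a b c p q r w u f P Q •
        triMonomial ι₁ ι₂ ι₃ h₀ (fun s => a (P s)) (fun l => b (w l)) (fun k => a' (Q k))
          (fun k => c (u k)) =
      ((p.factorial : K) * 2 ^ p * q.factorial * r.factorial) • f := by
  refine triGraded_induction (fun x hx y hy z hz => ?_) (fun x y hx hy => ?_) hf
  swap
  · simp only [triCoord] at hx hy ⊢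
    simp only [map_add, add_smul, Finset.sum_add_distrib, hx, hy, smul_add]
  · have r1 := h₁.reconstruct (h₀.frame a) hx
    have r2 := h₂.reconstruct (frame_tensor (fun i => a i) (fun i => a.coord i)
      (fun v => a.sum_repr v) b) hy
    have r3 := h₃.reconstruct (frame_tensor (fun i => a' i)
      (fun i => ev (a i)) (fun v => by
        have : ∀ i, ev (a i) = a'.coord i := fun i => a'.ext fun j => by
          simp [hev, Finsupp.single_apply, eq_comm]
        simp only [this]
        exact a'.sum_repr v) c) hz
    simp only [one_pow, mul_one] at r2 r3
    have h4 : ((p.factorial : K) * 2 ^ p * q.factorial * r.factorial) • ((x ⊗ₜ[K] y) ⊗ₜ[K] z) =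
        ((((p.factorial : K) * 2 ^ p) • x) ⊗ₜ[K] ((q.factorial : K) • y)) ⊗ₜ[K]
          ((r.factorial : K) • z) := by
      rw [TensorProduct.smul_tmul_smul, TensorProduct.smul_tmul_smul]
    rw [h4, ← r1, ← r2, ← r3]
    simp only [sum_arrow_prod (X := I) (Y := β), sum_arrow_prod (X := I) (Y := γ), sum_slots]
    rw [sum_tmul_sum_tmul_sum]
    simp only [triCoord, triLam, triForm_tmul, triMonomial, slotEquiv, Equiv.coe_fn_mk,
      Sum.elim_inl, Sum.elim_inr, Matrix.cons_val_zero, Matrix.cons_val_one,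
      TensorProduct.smul_tmul_smul]

end Triple

section Triple

variable {K N N' W U M R₁ R₂ R₃ : Type*} [Field K] [AddCommGroup N] [Module K N]
  [AddCommGroup N'] [Module K N']
  [AddCommGroup W] [Module K W] [AddCommGroup U] [Module K U] [AddCommGroup M] [Module K M]
  [Ring R₁] [Algebra K R₁] [Ring R₂] [Algebra K R₂] [Ring R₃] [Algebra K R₃]
  {e₀ e₁ e₂ e₃ : K} {ι₁ : M →ₗ[K] R₁} {ι₂ : N ⊗[K] W →ₗ[K] R₂}
  {ι₃ : N' ⊗[K] U →ₗ[K] R₃}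
  (h₀ : PairSpace K N M e₀) (h₁ : SignedPower ι₁ e₁) (h₂ : SignedPower ι₂ e₂)
  (h₃ : SignedPower ι₃ e₃) (ev : N →ₗ[K] Module.Dual K N')

/-! ### Invariants of a threefold tensor product -/

/-- The action of `GL(N)` on `R₁ ⊗ R₂ ⊗ R₃` by algebra endomorphisms extending the actions on
generators. -/
structure TriAction (ι₁ : M →ₗ[K] R₁) (ι₂ : N ⊗[K] W →ₗ[K] R₂) (ι₃ : N' ⊗[K] U →ₗ[K] R₃)
    (h₀ : PairSpace K N M e₀) (ev : N →ₗ[K] Module.Dual K N') where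
  onPair : (N ≃ₗ[K] N) → M →ₗ[K] M
  onDual : (N ≃ₗ[K] N) → N' →ₗ[K] N'
  act₁ : (N ≃ₗ[K] N) → R₁ →ₐ[K] R₁
  act₂ : (N ≃ₗ[K] N) → R₂ →ₐ[K] R₂
  act₃ : (N ≃ₗ[K] N) → R₃ →ₐ[K] R₃
  onPair_pair : ∀ s x y, onPair s (h₀.pair x y) = h₀.pair (s x) (s y)
  ev_onDual : ∀ s x φ, ev x (onDual s φ) = ev (s.symm x) φ
  act₁_ι : ∀ s m, act₁ s (ι₁ m) = ι₁ (onPair s m)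
  act₂_ι : ∀ s x w, act₂ s (ι₂ (x ⊗ₜ w)) = ι₂ (s x ⊗ₜ w)
  act₃_ι : ∀ s φ u, act₃ s (ι₃ (φ ⊗ₜ u)) = ι₃ (onDual s φ ⊗ₜ u)

variable {h₀ ev}

/-- The algebra endomorphism by which an element of `GL(N)` acts. -/
def TriAction.act (α : TriAction ι₁ ι₂ ι₃ h₀ ev) (s : N ≃ₗ[K] N) :
    (R₁ ⊗[K] R₂) ⊗[K] R₃ →ₐ[K] (R₁ ⊗[K] R₂) ⊗[K] R₃ :=
  Algebra.TensorProduct.map (Algebra.TensorProduct.map (α.act₁ s) (α.act₂ s)) (α.act₃ s)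

variable (α : TriAction ι₁ ι₂ ι₃ h₀ ev)
variable {I β γ : Type*} [Fintype I] [Fintype β] [Fintype γ] [DecidableEq I]
variable (a : Module.Basis I K N) (a' : Module.Basis I K N') (b : Module.Basis β K W)
  (c : Module.Basis γ K U)

/-- Invariance is required only under the element with matrix `g`, so that the statement serves both
GL and SL. -/
lemma triCoord_tensorAct {p q r : ℕ} {f : (R₁ ⊗[K] R₂) ⊗[K] R₃}
    (hf : f ∈ triGraded ι₁ ι₂ ι₃ p q r) {g g' : Matrix I I K} (hg : g * g' = 1)
    (hinv : ∀ s : N ≃ₗ[K] N, s.toLinearMap = Matrix.toLin a a g → α.act s f = f)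
    (w : Fin q → β) (u : Fin r → γ) :
    FFT.tensorAct g g' (triCoord h₀ h₁ h₂ h₃ ev a b c p q r w u f) =
      triCoord h₀ h₁ h₂ h₃ ev a b c p q r w u f := by
  have hg' : g' * g = 1 := mul_eq_one_comm.1 hg
  let s : N ≃ₗ[K] N := LinearEquiv.ofLinearMap (Matrix.toLin a a g) (Matrix.toLin a a g')
    (by rw [← Matrix.toLin_mul, hg, Matrix.toLin_one]) (by rw [← Matrix.toLin_mul, hg', Matrix.toLin_one])
  have hs := hinv s rfl
  ext P Q
  conv_rhs => rw [triCoord, ← hs, TriAction.act]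
  rw [triLam_act h₀ h₁ h₂ h₃ ev (α.onPair_pair s) (α.act₁_ι s) (α.act₂_ι s) (α.act₃_ι s)
    (α.ev_onDual s) _ _ _ _ hf]
  have e1 : ∀ i, a.coord i ∘ₗ s.toLinearMap = ∑ j, g i j • a.coord j := by
    intro i
    apply a.ext
    intro j
    simp [s, Matrix.toLin_self, Finsupp.single_apply]
  have e2 : ∀ i, s.symm (a i) = ∑ j, g' j i • a j := by
    intro i
    exact Matrix.toLin_self a a g' i
  simp only [e1, e2]
  rw [triLam_sum h₀ h₁ h₂ h₃ ev (fun k => g (P k)) (fun j => a.coord j) _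
    (fun k j => g' j (Q k)) a]
  rfl

section Vanish

variable [CharZero K] (hev : ∀ i j, ev (a i) (a' j) = if i = j then 1 else 0)

include hev in
lemma eq_zero_of_triCoord {p q r : ℕ} {f : (R₁ ⊗[K] R₂) ⊗[K] R₃}
    (hf : f ∈ triGraded ι₁ ι₂ ι₃ p q r)
    (h : ∀ w u, triCoord h₀ h₁ h₂ h₃ ev a b c p q r w u f = 0) : f = 0 := by
  have h1 := triReconstruct h₀ h₁ h₂ h₃ ev a a' b c hev hf
  simp only [h, Pi.zero_apply, zero_smul, Finset.sum_const_zero] at h1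
  refine (smul_eq_zero.1 h1.symm).resolve_left ?_
  have := Nat.factorial_ne_zero
  simp [this]

include h₁ h₂ h₃ hev b c in
theorem eq_zero_of_GL_invariant {p q r : ℕ} {f : (R₁ ⊗[K] R₂) ⊗[K] R₃}
    (hf : f ∈ triGraded ι₁ ι₂ ι₃ p q r) (hinv : ∀ s, α.act s f = f) (hne : 2 * p + q ≠ r) :
    f = 0 := by
  refine eq_zero_of_triCoord (h₀ := h₀) h₁ h₂ h₃ a a' b c hev hf fun w u => ?_
  refine FFT.eq_zero_of_scalar (fun g g' hg =>
    triCoord_tensorAct h₁ h₂ h₃ α a b c hf hg (fun s _ => hinv s) w u) ?_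
  simpa [mul_comm] using hne

lemma SL_tensorAct {p q r : ℕ} {f : (R₁ ⊗[K] R₂) ⊗[K] R₃}
    (hf : f ∈ triGraded ι₁ ι₂ ι₃ p q r)
    (hinv : ∀ s : N ≃ₗ[K] N, LinearMap.det s.toLinearMap = 1 → α.act s f = f)
    (w : Fin q → β) (u : Fin r → γ) (g g' : Matrix I I K) (hg : g * g' = 1) (hdet : g.det = 1) :
    FFT.tensorAct g g' (triCoord h₀ h₁ h₂ h₃ ev a b c p q r w u f) =
      triCoord h₀ h₁ h₂ h₃ ev a b c p q r w u f :=
  triCoord_tensorAct h₁ h₂ h₃ α a b c hf hg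
    (fun s hs => hinv s (by rw [hs, LinearMap.det_toLin, hdet])) w u

include h₁ h₂ h₃ hev b c in
theorem eq_zero_of_SL_invariant {p q r : ℕ} {f : (R₁ ⊗[K] R₂) ⊗[K] R₃}
    (hf : f ∈ triGraded ι₁ ι₂ ι₃ p q r)
    (hinv : ∀ s : N ≃ₗ[K] N, LinearMap.det s.toLinearMap = 1 → α.act s f = f)
    (hdvd : ¬ (Fintype.card I : ℤ) ∣ 2 * (p : ℤ) + q - r) : f = 0 := by
  refine eq_zero_of_triCoord (h₀ := h₀) h₁ h₂ h₃ a a' b c hev hf fun w u => ?_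
  by_contra h0
  have := FFT.dvd_of_ne_zero (SL_tensorAct h₁ h₂ h₃ α a b c hf hinv w u) h0
  apply hdvd
  simpa [mul_comm] using this

variable (ι₁ ι₂ ι₃ h₀) in
/-- The invariant attached to a bijection of slots and vectors of `W` and `U`. -/
def theta {p q r : ℕ} (σ : Fin r ≃ Slots p q) (w : Fin q → W) (u : Fin r → U) :
    (R₁ ⊗[K] R₂) ⊗[K] R₃ :=
  ∑ P : Slots p q → I,
    triMonomial ι₁ ι₂ ι₃ h₀ (fun s => a (P s)) w (fun k => a' (P (σ k))) u

include h₃ in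
-- Generators of R₃ may be reordered at the cost of a scalar. This brings any bijection to the fixed
-- one `σ₀`, permuting only the vectors of U.
lemma theta_perm {p q r : ℕ} (σ σ₀ : Fin r ≃ Slots p q) (w : Fin q → W) (u : Fin r → U) :
    ∃ d : K, theta ι₁ ι₂ ι₃ h₀ a a' σ w u =
      d • theta ι₁ ι₂ ι₃ h₀ a a' σ₀ w (fun k => u (σ.symm (σ₀ k))) := by
  obtain ⟨d, hd⟩ := h₃.perm r (σ.trans σ₀.symm)
  refine ⟨d, ?_⟩
  rw [theta, theta, Finset.smul_sum]
  refine Finset.sum_congr rfl fun P _ => ?_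
  have := hd fun k => a' (P (σ₀ k)) ⊗ₜ u (σ.symm (σ₀ k))
  simp only [Equiv.trans_apply, Equiv.apply_symm_apply, Equiv.symm_apply_apply] at this
  have h1 : SignedPower.prodι ι₃ (fun k => a' (P (σ k)) ⊗ₜ u k) =
    d • SignedPower.prodι ι₃ fun k => a' (P (σ₀ k)) ⊗ₜ u (σ.symm (σ₀ k)) := this
  rw [triMonomial, triMonomial, h1, TensorProduct.tmul_smul]

include h₁ h₂ h₃ hev b c in
/-- The first fundamental theorem for `SL(N)` on a threefold tensor product. -/
theorem mem_of_SL_invariant {p q r : ℕ} {f : (R₁ ⊗[K] R₂) ⊗[K] R₃}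
    (hf : f ∈ triGraded ι₁ ι₂ ι₃ p q r)
    (hinv : ∀ s : N ≃ₗ[K] N, LinearMap.det s.toLinearMap = 1 → α.act s f = f)
    (σ₀ : Fin r ≃ Slots p q) {X : Submodule K ((R₁ ⊗[K] R₂) ⊗[K] R₃)}
    (hX : ∀ w u, theta ι₁ ι₂ ι₃ h₀ a a' σ₀ w u ∈ X) : f ∈ X := by
  have h1 := triReconstruct h₀ h₁ h₂ h₃ ev a a' b c hev hf
  have hne : ((p.factorial : K) * 2 ^ p * q.factorial * r.factorial) ≠ 0 := by
    have := Nat.factorial_ne_zero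
    simp [this]
  rw [← Submodule.smul_mem_iff _ hne, ← h1]
  refine Submodule.sum_mem _ fun w _ => Submodule.sum_mem _ fun u _ => ?_
  let T : ((Slots p q → I) → (Fin r → I) → K) →ₗ[K] (R₁ ⊗[K] R₂) ⊗[K] R₃ :=
    { toFun := fun F => ∑ P : Slots p q → I, ∑ Q : Fin r → I, F P Q •
        triMonomial ι₁ ι₂ ι₃ h₀ (fun s => a (P s)) (fun l => b (w l)) (fun k => a' (Q k))
          (fun k => c (u k))
      map_add' := fun F G => by simp only [Pi.add_apply, add_smul, Finset.sum_add_distrib]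
      map_smul' := fun d F => by
        simp only [Pi.smul_apply, smul_eq_mul, mul_smul, Finset.smul_sum, RingHom.id_apply] }
  have h2 : FFT.deltaSpan K I (Slots p q) (Fin r) ≤ X.comap T := by
    rw [FFT.deltaSpan, Submodule.span_le]
    rintro _ ⟨σ, rfl⟩
    -- On δ_σ the sum over Q collapses to the single term Q = P ∘ σ.
    have h3 : T (FFT.delta K σ) = theta ι₁ ι₂ ι₃ h₀ a a' σ (fun l => b (w l)) (fun k => c (u k)) := by
      rw [theta]
      refine Finset.sum_congr rfl fun P _ => ?_
      rw [Finset.sum_eq_single (P ∘ σ)]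
      · simp [FFT.delta]
      · intro Q _ hQ
        rw [FFT.delta, if_neg hQ, zero_smul]
      · simp
    rw [SetLike.mem_coe, Submodule.mem_comap, h3]
    obtain ⟨d, hd⟩ := theta_perm (h₀ := h₀) (ι₁ := ι₁) (ι₂ := ι₂) h₃ a a' σ σ₀ (fun l => b (w l))
      (fun k => c (u k))
    rw [hd]
    exact Submodule.smul_mem _ _ (hX _ _)
  exact h2 (FFT.mem_deltaSpan (SL_tensorAct h₁ h₂ h₃ α a b c hf hinv w u)
    (Fintype.card_congr σ₀).symm)

end Vanish

end Triple

/-! ### The standard order of the slots -/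

section Slots

variable {K V R : Type*} [Field K] [AddCommGroup V] [Module K V] [Ring R] [Algebra K R]

/-- The slots in their standard order. -/
def stdSlot {p q r : ℕ} (h : r = p * 2 + q) : Fin r ≃ Slots p q :=
  (finCongr h).trans (finSumFinEquiv.symm.trans
    (Equiv.sumCongr finProdFinEquiv.symm (Equiv.refl _)))

/-- The product of generators in all slots, in their standard order. -/
def slotProd (ι : V →ₗ[K] R) {p q : ℕ} (v : Slots p q → V) : R :=
  (List.ofFn fun k => ι (v (.inl (k, 0))) * ι (v (.inl (k, 1)))).prod *
    SignedPower.prodι ι fun l => v (.inr l)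

/-- Position 2k + i holds the i-th member of the k-th pair, and the single slots follow all pairs;
this is the order in which the factors from R₃ appear in G and H. -/
lemma prodι_stdSlot (ι : V →ₗ[K] R) {p q r : ℕ} (h : r = p * 2 + q) (v : Slots p q → V) :
    SignedPower.prodι ι (fun k => v (stdSlot h k)) = slotProd ι v := by
  subst h
  rw [SignedPower.prodι, List.ofFn_add, List.prod_append, List.ofFn_mul, List.prod_flatten,
    List.map_ofFn]
  congr 1
  · congr 2
    ext k
    simp only [Function.comp_apply, List.ofFn_succ, List.ofFn_zero, List.prod_cons, List.prod_nil,
      mul_one]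
    have h1 : ∀ i : Fin 2, stdSlot (p := p) (q := q) rfl
        (Fin.castLE (Nat.le_add_right _ _) ⟨k * 2 + i, by omega⟩) = .inl (k, i) := by
      intro i
      rw [← Equiv.eq_symm_apply]
      ext
      simp [stdSlot, finProdFinEquiv, mul_comm, add_comm]
    have h2 := h1 0
    have h3 := h1 1
    exact congrArg₂ (fun x y => ι (v x) * ι (v y)) h2 h3
  · congr 2
    ext l
    have h1 : stdSlot (p := p) (q := q) rfl (Fin.natAdd (p * 2) l) = .inr l := by
      rw [← Equiv.eq_symm_apply]
      ext
      simp [stdSlot]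
    rw [h1]

end Slots

section Source

variable {K N N' W U M R₁ R₂ R₃ M' R₁' R₂' : Type*} [Field K] [AddCommGroup N] [Module K N]
  [AddCommGroup N'] [Module K N']
  [AddCommGroup W] [Module K W] [AddCommGroup U] [Module K U] [AddCommGroup M] [Module K M]
  [Ring R₁] [Algebra K R₁] [Ring R₂] [Algebra K R₂] [Ring R₃] [Algebra K R₃]
  [AddCommGroup M'] [Module K M'] [Ring R₁'] [Algebra K R₁'] [Ring R₂'] [Algebra K R₂']
  {e₀ e₁ e₂ e₃ f₀ f₁ f₂ : K} {ι₁ : M →ₗ[K] R₁} {ι₂ : N ⊗[K] W →ₗ[K] R₂}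
  {ι₃ : N' ⊗[K] U →ₗ[K] R₃} {ι₁' : M' →ₗ[K] R₁'} {ι₂' : W ⊗[K] U →ₗ[K] R₂'}
  {h₀ : PairSpace K N M e₀} {ev : N →ₗ[K] Module.Dual K N'}
  {h₀' : PairSpace K U M' f₀}
  {I γ : Type*} [Fintype I] [Fintype γ] [DecidableEq I]
  {a : Module.Basis I K N} {a' : Module.Basis I K N'}

/-! ### Algebra maps given by canonical elements -/

/-- An algebra map `R₁' ⊗ R₂' → R₁ ⊗ R₂ ⊗ R₃` given on generators by the canonical elements of
`N ⊗ N'`. -/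
structure CanonicalHom (ι₁ : M →ₗ[K] R₁) (ι₂ : N ⊗[K] W →ₗ[K] R₂) (ι₃ : N' ⊗[K] U →ₗ[K] R₃)
    (ι₁' : M' →ₗ[K] R₁') (ι₂' : W ⊗[K] U →ₗ[K] R₂') (h₀ : PairSpace K N M e₀)
    (h₀' : PairSpace K U M' f₀) (a : Module.Basis I K N) (a' : Module.Basis I K N') where
  hom : R₁' ⊗[K] R₂' →ₐ[K] (R₁ ⊗[K] R₂) ⊗[K] R₃
  hom_pair : ∀ u v, hom (ι₁' (h₀'.pair u v) ⊗ₜ 1) = ∑ i, ∑ j,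
    (ι₁ (h₀.pair (a i) (a j)) ⊗ₜ[K] (1 : R₂)) ⊗ₜ[K] (ι₃ (a' i ⊗ₜ u) * ι₃ (a' j ⊗ₜ v))
  hom_single : ∀ w u, hom (1 ⊗ₜ ι₂' (w ⊗ₜ u)) = ∑ i,
    ((1 : R₁) ⊗ₜ[K] ι₂ (a i ⊗ₜ w)) ⊗ₜ[K] ι₃ (a' i ⊗ₜ u)

variable (G : CanonicalHom ι₁ ι₂ ι₃ ι₁' ι₂' h₀ h₀' a a')

namespace CanonicalHom

include G in
lemma hom_pairs {p : ℕ} (u v : Fin p → U) :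
    G.hom (SignedPower.prodι ι₁' (fun k => h₀'.pair (u k) (v k)) ⊗ₜ 1) =
      ∑ z : Fin p → I × I,
        (SignedPower.prodι ι₁ (fun k => h₀.pair (a (z k).1) (a (z k).2)) ⊗ₜ[K] (1 : R₂)) ⊗ₜ[K]
          (List.ofFn fun k => ι₃ (a' (z k).1 ⊗ₜ u k) * ι₃ (a' (z k).2 ⊗ₜ v k)).prod := by
  induction p with
  | zero => simp [SignedPower.prodι_zero, ← Algebra.TensorProduct.one_def]
  | succ p ih =>
    have h1 : ∀ (x y : R₁'), (x * y) ⊗ₜ[K] (1 : R₂') = (x ⊗ₜ 1) * (y ⊗ₜ 1) := by simp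
    rw [SignedPower.prodι_succ, h1, map_mul, ih, G.hom_pair, SignedPower.sum_fin_succ,
      Fintype.sum_prod_type, Finset.sum_mul]
    refine Finset.sum_congr rfl fun i _ => ?_
    rw [Finset.sum_mul]
    refine Finset.sum_congr rfl fun j _ => ?_
    rw [Finset.mul_sum]
    refine Finset.sum_congr rfl fun z _ => ?_
    rw [SignedPower.prodι_succ, List.ofFn_succ, List.prod_cons]
    simp only [Algebra.TensorProduct.tmul_mul_tmul, Fin.cons_zero, Fin.cons_succ, mul_one]

include G in
lemma hom_singles {q : ℕ} (w : Fin q → W) (u : Fin q → U) :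
    G.hom (1 ⊗ₜ SignedPower.prodι ι₂' (fun k => w k ⊗ₜ u k)) =
      ∑ y : Fin q → I,
        ((1 : R₁) ⊗ₜ[K] SignedPower.prodι ι₂ (fun k => a (y k) ⊗ₜ w k)) ⊗ₜ[K]
          SignedPower.prodι ι₃ (fun k => a' (y k) ⊗ₜ u k) := by
  induction q with
  | zero => simp [SignedPower.prodι_zero, ← Algebra.TensorProduct.one_def]
  | succ q ih =>
    have h1 : ∀ (x y : R₂'), (1 : R₁') ⊗ₜ[K] (x * y) = (1 ⊗ₜ x) * (1 ⊗ₜ y) := by simp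
    rw [SignedPower.prodι_succ, h1, map_mul, ih, G.hom_single, SignedPower.sum_fin_succ,
      Finset.sum_mul]
    refine Finset.sum_congr rfl fun i _ => ?_
    rw [Finset.mul_sum]
    refine Finset.sum_congr rfl fun z _ => ?_
    rw [SignedPower.prodι_succ, SignedPower.prodι_succ]
    simp only [Algebra.TensorProduct.tmul_mul_tmul, Fin.cons_zero, Fin.cons_succ, mul_one]

/-- The monomial of the source attached to vectors in all slots. -/
def srcMonomial (ι₁' : M' →ₗ[K] R₁') (ι₂' : W ⊗[K] U →ₗ[K] R₂') (h₀' : PairSpace K U M' f₀)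
    {p q : ℕ} (w : Fin q → W) (u : Slots p q → U) : R₁' ⊗[K] R₂' :=
  SignedPower.prodι ι₁' (fun k => h₀'.pair (u (.inl (k, 0))) (u (.inl (k, 1)))) ⊗ₜ
    SignedPower.prodι ι₂' (fun l => w l ⊗ₜ u (.inr l))

/-- The part of bidegree `(p, q)` of the source. -/
def srcGraded (ι₁' : M' →ₗ[K] R₁') (ι₂' : W ⊗[K] U →ₗ[K] R₂') (p q : ℕ) :
    Submodule K (R₁' ⊗[K] R₂') :=
  LinearMap.range (TensorProduct.map (LinearMap.range ι₁' ^ p).subtype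
    (LinearMap.range ι₂' ^ q).subtype)

lemma srcMonomial_mem {p q : ℕ} (w : Fin q → W) (u : Slots p q → U) :
    srcMonomial ι₁' ι₂' h₀' w u ∈ srcGraded ι₁' ι₂' p q :=
  ⟨⟨_, SignedPower.prodι_mem _⟩ ⊗ₜ ⟨_, SignedPower.prodι_mem _⟩, rfl⟩

@[elab_as_elim]
lemma srcGraded_induction {p q : ℕ} {C : R₁' ⊗[K] R₂' → Prop}
    (h0 : ∀ x ∈ LinearMap.range ι₁' ^ p, ∀ y ∈ LinearMap.range ι₂' ^ q, C (x ⊗ₜ y))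
    (hadd : ∀ x y, C x → C y → C (x + y)) {f : R₁' ⊗[K] R₂'}
    (hf : f ∈ srcGraded ι₁' ι₂' p q) : C f := by
  obtain ⟨t, rfl⟩ := hf
  induction t with
  | zero =>
    have := h0 0 (Submodule.zero_mem _) 0 (Submodule.zero_mem _)
    simpa using this
  | add x y hx hy => rw [map_add]; exact hadd _ _ hx hy
  | tmul x y => exact h0 _ x.2 _ y.2

/-- Expanding the canonical elements gives one basis index per slot, shared by the vector of N and
its dual partner. This is the defining sum of `theta` for the standard bijection. -/
lemma hom_srcMonomial {p q r : ℕ} (h : r = p * 2 + q) (w : Fin q → W) (u : Slots p q → U) :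
    G.hom (srcMonomial ι₁' ι₂' h₀' w u) =
      theta ι₁ ι₂ ι₃ h₀ a a' (stdSlot h) w (fun k => u (stdSlot h k)) := by
  have h1 : srcMonomial ι₁' ι₂' h₀' w u =
      (SignedPower.prodι ι₁' (fun k => h₀'.pair (u (.inl (k, 0))) (u (.inl (k, 1)))) ⊗ₜ 1) *
        (1 ⊗ₜ SignedPower.prodι ι₂' (fun l => w l ⊗ₜ u (.inr l))) := by
    simp [srcMonomial]
  rw [h1, map_mul, G.hom_pairs, G.hom_singles, theta, sum_slots, Finset.sum_mul_sum]
  refine Finset.sum_congr rfl fun z _ => Finset.sum_congr rfl fun y _ => ?_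
  rw [triMonomial, prodι_stdSlot ι₃ h fun s => a' (slotEquiv p q I (z, y) s) ⊗ₜ u s]
  simp only [slotProd, Algebra.TensorProduct.tmul_mul_tmul, mul_one, one_mul, slotEquiv,
    Equiv.coe_fn_mk, Sum.elim_inl, Sum.elim_inr, Matrix.cons_val_zero, Matrix.cons_val_one]

lemma theta_mem_map {p q r : ℕ} (h : r = p * 2 + q) (w : Fin q → W) (u : Fin r → U) :
    theta ι₁ ι₂ ι₃ h₀ a a' (stdSlot h) w u ∈
      (srcGraded ι₁' ι₂' p q).map G.hom.toLinearMap := by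
  refine ⟨srcMonomial ι₁' ι₂' h₀' w fun s => u ((stdSlot h).symm s), srcMonomial_mem _ _, ?_⟩
  have := G.hom_srcMonomial h w fun s => u ((stdSlot h).symm s)
  simpa using this

/-! ### Invariance of the image -/

/-- The sum of the a_i ⊗ a'_i corresponds to the identity of N, and `hτ` says that τ is
contragredient to s, so s ⊗ τ fixes it. -/
lemma sum_canonical {X : Type*} [AddCommGroup X] [Module K X] (B : N →ₗ[K] N' →ₗ[K] X)
    (hev : ∀ i j, ev (a i) (a' j) = if i = j then 1 else 0) {s : N ≃ₗ[K] N} {τ : N' →ₗ[K] N'}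
    (hτ : ∀ x φ, ev x (τ φ) = ev (s.symm x) φ) :
    ∑ i, B (s (a i)) (τ (a' i)) = ∑ i, B (a i) (a' i) := by
  have h1 : ∀ i, ev (a i) = a'.coord i := fun i => a'.ext fun j => by
    simp [hev, Finsupp.single_apply, eq_comm]
  have h2' : ∀ i, ev.flip (a' i) = a.coord i := fun i => a.ext fun j => by
    simp [hev, Finsupp.single_apply]
  have h2 : ∀ x i, ev x (a' i) = a.repr x i := fun x i => LinearMap.congr_fun (h2' i) x
  have h3 : ∀ i, τ (a' i) = ∑ k, a.repr (s.symm (a k)) i • a' k := by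
    intro i
    conv_lhs => rw [← a'.sum_repr (τ (a' i))]
    refine Finset.sum_congr rfl fun k _ => ?_
    rw [← Module.Basis.coord_apply, ← h1, hτ, h2]
  simp only [h3, map_sum, map_smul]
  rw [Finset.sum_comm]
  refine Finset.sum_congr rfl fun k _ => ?_
  have h4 : s (∑ i, a.repr (s.symm (a k)) i • a i) = a k := by
    rw [a.sum_repr, s.apply_symm_apply]
  conv_rhs => rw [← h4]
  simp only [map_sum, map_smul, LinearMap.sum_apply, LinearMap.smul_apply]

variable (α : TriAction ι₁ ι₂ ι₃ h₀ ev)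

lemma act_hom_pair (hev : ∀ i j, ev (a i) (a' j) = if i = j then 1 else 0) (s : N ≃ₗ[K] N)
    (u v : U) :
    α.act s (G.hom (ι₁' (h₀'.pair u v) ⊗ₜ 1)) = G.hom (ι₁' (h₀'.pair u v) ⊗ₜ 1) := by
  let B : N → N' → N →ₗ[K] N' →ₗ[K] (R₁ ⊗[K] R₂) ⊗[K] R₃ := fun x φ => LinearMap.mk₂ K
    (fun y ψ => (ι₁ (h₀.pair x y) ⊗ₜ[K] (1 : R₂)) ⊗ₜ[K] (ι₃ (φ ⊗ₜ u) * ι₃ (ψ ⊗ₜ v)))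
    (by intros; simp [TensorProduct.add_tmul])
    (by intros; simp [TensorProduct.smul_tmul'])
    (by intros; simp [TensorProduct.add_tmul, TensorProduct.tmul_add, mul_add])
    (by intros; simp [← TensorProduct.smul_tmul'])
  let B' : N →ₗ[K] N' →ₗ[K] (R₁ ⊗[K] R₂) ⊗[K] R₃ := LinearMap.mk₂ K
    (fun x φ => ∑ j, (ι₁ (h₀.pair x (a j)) ⊗ₜ[K] (1 : R₂)) ⊗ₜ[K]
      (ι₃ (φ ⊗ₜ u) * ι₃ (a' j ⊗ₜ v)))
    (by intros; simp [TensorProduct.add_tmul, Finset.sum_add_distrib])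
    (by intros; simp [TensorProduct.smul_tmul', Finset.smul_sum])
    (by intros; simp [TensorProduct.add_tmul, TensorProduct.tmul_add, add_mul,
      Finset.sum_add_distrib])
    (by intros; simp [← TensorProduct.smul_tmul', Finset.smul_sum])
  rw [G.hom_pair]
  -- The double sum contains two canonical elements: the inner one is absorbed with the first pair
  -- of arguments fixed, then the outer one.
  have h1 := fun x φ => sum_canonical (B x φ) hev (α.ev_onDual s)
  have h2 := sum_canonical B' hev (α.ev_onDual s)
  simp only [B, B', LinearMap.mk₂_apply] at h1 h2
  refine Eq.trans ?_ h2
  simp only [map_sum, TriAction.act, Algebra.TensorProduct.map_tmul, map_mul, map_one, α.act₁_ι,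
    α.act₃_ι, α.onPair_pair]
  exact Finset.sum_congr rfl fun i _ => h1 (s (a i)) (α.onDual s (a' i))

lemma act_hom_single (hev : ∀ i j, ev (a i) (a' j) = if i = j then 1 else 0) (s : N ≃ₗ[K] N)
    (w : W) (u : U) :
    α.act s (G.hom (1 ⊗ₜ ι₂' (w ⊗ₜ u))) = G.hom (1 ⊗ₜ ι₂' (w ⊗ₜ u)) := by
  let B : N →ₗ[K] N' →ₗ[K] (R₁ ⊗[K] R₂) ⊗[K] R₃ := LinearMap.mk₂ K
    (fun x φ => ((1 : R₁) ⊗ₜ[K] ι₂ (x ⊗ₜ w)) ⊗ₜ[K] ι₃ (φ ⊗ₜ u))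
    (by intros; simp [TensorProduct.add_tmul, TensorProduct.tmul_add])
    (by intros; simp [← TensorProduct.smul_tmul'])
    (by intros; simp [TensorProduct.add_tmul, TensorProduct.tmul_add])
    (by intros; simp [← TensorProduct.smul_tmul'])
  rw [G.hom_single]
  have h1 := sum_canonical B hev (α.ev_onDual s)
  simp only [B, LinearMap.mk₂_apply] at h1
  refine Eq.trans ?_ h1
  simp [TriAction.act, α.act₂_ι, α.act₃_ι]

lemma act_hom (hev : ∀ i j, ev (a i) (a' j) = if i = j then 1 else 0) (s : N ≃ₗ[K] N)
    {p q : ℕ} {x : R₁' ⊗[K] R₂'} (hf : x ∈ srcGraded ι₁' ι₂' p q) :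
    α.act s (G.hom x) = G.hom x := by
  refine srcGraded_induction (fun x hx y hy => ?_) (fun x y hx hy => ?_) hf
  swap
  · rw [map_add, map_add, hx, hy]
  clear hf
  have h1 : α.act s (G.hom (x ⊗ₜ 1)) = G.hom (x ⊗ₜ 1) := by
    induction hx using Submodule.pow_induction_on_left' with
    | algebraMap r =>
      have : algebraMap K R₁' r ⊗ₜ[K] (1 : R₂') = algebraMap K _ r := rfl
      rw [this, AlgHom.commutes, AlgHom.commutes]
    | add x y i hx hy ihx ihy => simp only [TensorProduct.add_tmul, map_add, ihx, ihy]
    | mem_mul m hm i x hx ih =>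
      obtain ⟨v, rfl⟩ := hm
      have h2 : (ι₁' v * x) ⊗ₜ[K] (1 : R₂') = (ι₁' v ⊗ₜ 1) * (x ⊗ₜ 1) := by simp
      rw [h2, map_mul, map_mul, ih]
      congr 1
      clear h2 ih
      induction v using h₀'.induction with
      | h0 u v => exact G.act_hom_pair α hev s u v
      | hadd x y hx hy => simp only [map_add, TensorProduct.add_tmul, hx, hy]
      | hsmul c x hx =>
        rw [map_smul, ← TensorProduct.smul_tmul', map_smul, map_smul, hx]
  have h2 : α.act s (G.hom (1 ⊗ₜ y)) = G.hom (1 ⊗ₜ y) := by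
    induction hy using Submodule.pow_induction_on_left' with
    | algebraMap r =>
      have : (1 : R₁') ⊗ₜ[K] algebraMap K R₂' r = algebraMap K _ r := by
        rw [Algebra.TensorProduct.algebraMap_apply, Algebra.algebraMap_eq_smul_one,
          Algebra.algebraMap_eq_smul_one, TensorProduct.smul_tmul]
      rw [this, AlgHom.commutes, AlgHom.commutes]
    | add x y i hx hy ihx ihy => simp only [TensorProduct.tmul_add, map_add, ihx, ihy]
    | mem_mul m hm i x hx ih =>
      obtain ⟨v, rfl⟩ := hm
      have h2 : (1 : R₁') ⊗ₜ[K] (ι₂' v * x) = (1 ⊗ₜ ι₂' v) * (1 ⊗ₜ x) := by simp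
      rw [h2, map_mul, map_mul, ih]
      congr 1
      clear h2 ih
      induction v with
      | zero => simp
      | tmul w u => exact G.act_hom_single α hev s w u
      | add x y hx hy => simp only [map_add, TensorProduct.tmul_add, hx, hy]
  have h3 : x ⊗ₜ[K] y = (x ⊗ₜ 1) * (1 ⊗ₜ y) := by simp
  rw [h3, map_mul, map_mul, h1, h2]

end CanonicalHom
end Source

section Contractions

variable {K M X R₁ R₂ R₃ : Type*} [Field K] [AddCommGroup M] [Module K M] [AddCommGroup X]
  [Module K X] [Ring R₁] [Algebra K R₁] [Ring R₂] [Algebra K R₂] [Ring R₃] [Algebra K R₃]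
  {e₁ e₂ : K} {ι₁ : M →ₗ[K] R₁} {ι₂ : X →ₗ[K] R₂} (h₁ : SignedPower ι₁ e₁)
  (h₂ : SignedPower ι₂ e₂)

/-! ### Contractions of a threefold tensor product -/

variable (R₂ R₃) in
/-- Contraction of the first factor. -/
def contractFst (l : Module.Dual K M) : (R₁ ⊗[K] R₂) ⊗[K] R₃ →ₗ[K] (R₁ ⊗[K] R₂) ⊗[K] R₃ :=
  TensorProduct.map (TensorProduct.map (h₁.contract l) LinearMap.id) LinearMap.id

variable (R₁ R₃) in
/-- Contraction of the second factor. -/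
def contractSnd (l : Module.Dual K X) : (R₁ ⊗[K] R₂) ⊗[K] R₃ →ₗ[K] (R₁ ⊗[K] R₂) ⊗[K] R₃ :=
  TensorProduct.map (TensorProduct.map LinearMap.id (h₂.contract l)) LinearMap.id

@[elab_as_elim]
lemma tri_induction {C : (R₁ ⊗[K] R₂) ⊗[K] R₃ → Prop} (h : ∀ x y z, C ((x ⊗ₜ y) ⊗ₜ z))
    (hadd : ∀ x y, C x → C y → C (x + y)) (f : (R₁ ⊗[K] R₂) ⊗[K] R₃) : C f := by
  induction f with
  | zero => simpa using h 0 0 0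
  | add x y hx hy => exact hadd _ _ hx hy
  | tmul x z =>
    induction x with
    | zero => simpa using h 0 0 0
    | add x y hx hy => rw [TensorProduct.add_tmul]; exact hadd _ _ hx hy
    | tmul x y => exact h _ _ _

lemma contractFst_mul (l : Module.Dual K M) (x : M) (r : R₃) (f : (R₁ ⊗[K] R₂) ⊗[K] R₃) :
    contractFst R₂ R₃ h₁ l (((ι₁ x ⊗ₜ 1) ⊗ₜ r) * f) =
      l x • (((1 ⊗ₜ 1) ⊗ₜ r) * f) + e₁ • (((ι₁ x ⊗ₜ 1) ⊗ₜ r) * contractFst R₂ R₃ h₁ l f) := by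
  induction f using tri_induction with
  | h a b c =>
    simp [contractFst, h₁.contract_ι_mul, TensorProduct.add_tmul, TensorProduct.smul_tmul']
  | hadd a b ha hb => simp only [mul_add, map_add, ha, hb, smul_add]; abel

lemma contractFst_mul_of_one (l : Module.Dual K M) (y : R₂) (r : R₃)
    (f : (R₁ ⊗[K] R₂) ⊗[K] R₃) :
    contractFst R₂ R₃ h₁ l (((1 ⊗ₜ y) ⊗ₜ r) * f) =
      ((1 ⊗ₜ y) ⊗ₜ r) * contractFst R₂ R₃ h₁ l f := by
  induction f using tri_induction with
  | h a b c => simp [contractFst]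
  | hadd a b ha hb => simp only [mul_add, map_add, ha, hb]

lemma contractSnd_mul (l : Module.Dual K X) (x : X) (r : R₃) (f : (R₁ ⊗[K] R₂) ⊗[K] R₃) :
    contractSnd R₁ R₃ h₂ l (((1 ⊗ₜ ι₂ x) ⊗ₜ r) * f) =
      l x • (((1 ⊗ₜ 1) ⊗ₜ r) * f) + e₂ • (((1 ⊗ₜ ι₂ x) ⊗ₜ r) * contractSnd R₁ R₃ h₂ l f) := by
  induction f using tri_induction with
  | h a b c =>
    simp [contractSnd, h₂.contract_ι_mul, TensorProduct.tmul_add, TensorProduct.add_tmul,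
      TensorProduct.smul_tmul']
  | hadd a b ha hb => simp only [mul_add, map_add, ha, hb, smul_add]; abel

lemma triForm_lam_succ_fst {n : ℕ} (l : Fin (n + 1) → Module.Dual K M) (l₂ : R₂ →ₗ[K] K)
    (l₃ : R₃ →ₗ[K] K) (f : (R₁ ⊗[K] R₂) ⊗[K] R₃) :
    triForm (h₁.lam (n + 1) l) l₂ l₃ f =
      triForm (h₁.lam n fun i => l i.succ) l₂ l₃ (contractFst R₂ R₃ h₁ (l 0) f) := by
  induction f using tri_induction with
  | h a b c => simp [contractFst, h₁.lam_succ]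
  | hadd a b ha hb => simp only [map_add, ha, hb]

lemma triForm_lam_succ_snd {n : ℕ} (l : Fin (n + 1) → Module.Dual K X) (l₁ : R₁ →ₗ[K] K)
    (l₃ : R₃ →ₗ[K] K) (f : (R₁ ⊗[K] R₂) ⊗[K] R₃) :
    triForm l₁ (h₂.lam (n + 1) l) l₃ f =
      triForm l₁ (h₂.lam n fun i => l i.succ) l₃ (contractSnd R₁ R₃ h₂ (l 0) f) := by
  induction f using tri_induction with
  | h a b c => simp [contractSnd, h₂.lam_succ]
  | hadd a b ha hb => simp only [map_add, ha, hb]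

lemma triForm_mul_right (l₁ : R₁ →ₗ[K] K) (l₂ : R₂ →ₗ[K] K) (l₃ : R₃ →ₗ[K] K) (r : R₃)
    (f : (R₁ ⊗[K] R₂) ⊗[K] R₃) :
    triForm l₁ l₂ l₃ (((1 ⊗ₜ 1) ⊗ₜ r) * f) = triForm l₁ l₂ (l₃ ∘ₗ LinearMap.mulLeft K r) f := by
  induction f using tri_induction with
  | h a b c => simp
  | hadd a b ha hb => simp only [mul_add, map_add, ha, hb]

namespace SignedPower

include h₁ in
/-- Products of two generators commute with each other. -/
lemma mul_mul_commute (v w v' w' : M) :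
    ι₁ v * ι₁ w * (ι₁ v' * ι₁ w') = ι₁ v' * ι₁ w' * (ι₁ v * ι₁ w) := by
  have key : ∀ x, ι₁ v * ι₁ w * ι₁ x = ι₁ x * (ι₁ v * ι₁ w) := by
    intro x
    rw [mul_assoc, h₁.swap w x, mul_smul_comm, ← mul_assoc, h₁.swap v x, smul_mul_assoc, smul_smul,
      h₁.sign_sq, one_smul, mul_assoc]
  rw [← mul_assoc, key, mul_assoc, key, mul_assoc]

/-- The full contraction is a signed sum over permutations; the vanishing of off-diagonal pairings
leaves only the identity. -/
lemma lam_prodι {n : ℕ} (l : Fin n → Module.Dual K M) (v : Fin n → M)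
    (hv : ∀ i j, i ≠ j → l i (v j) = 0) : h₁.lam n l (prodι ι₁ v) = ∏ i, l i (v i) := by
  induction n with
  | zero => simp [lam, prodι_zero, h₁.aug_one]
  | succ n ih =>
    have h0 : ∀ (m : ℕ) (k : Module.Dual K M) (v : Fin m → M), (∀ j, k (v j) = 0) →
        h₁.contract k (prodι ι₁ v) = 0 := by
      intro m k v hk
      induction m with
      | zero => rw [prodι_zero, h₁.contract_one]
      | succ m ihm =>
        rw [prodι_succ, h₁.contract_ι_mul, hk, ihm _ fun j => hk _]
        simp
    rw [lam_succ, prodι_succ, h₁.contract_ι_mul, h0 _ _ _ fun j => hv _ _ (Fin.succ_ne_zero j).symm,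
      mul_zero, smul_zero, add_zero, map_smul, ih _ _ fun i j hij => hv _ _ fun h =>
        hij (Fin.succ_injective _ h), Fin.prod_univ_succ, smul_eq_mul]

end SignedPower
end Contractions

section Injective

variable {K N N' W U M R₁ R₂ R₃ M' R₁' R₂' : Type*} [Field K] [AddCommGroup N] [Module K N]
  [AddCommGroup N'] [Module K N']
  [AddCommGroup W] [Module K W] [AddCommGroup U] [Module K U] [AddCommGroup M] [Module K M]
  [Ring R₁] [Algebra K R₁] [Ring R₂] [Algebra K R₂] [Ring R₃] [Algebra K R₃]
  [AddCommGroup M'] [Module K M'] [Ring R₁'] [Algebra K R₁'] [Ring R₂'] [Algebra K R₂']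
  {e₀ e₂ e₃ f₀ f₂ : K} {ι₁ : M →ₗ[K] R₁} {ι₂ : N ⊗[K] W →ₗ[K] R₂}
  {ι₃ : N' ⊗[K] U →ₗ[K] R₃} {ι₁' : M' →ₗ[K] R₁'} {ι₂' : W ⊗[K] U →ₗ[K] R₂'}
  {h₀ : PairSpace K N M e₀} {h₀' : PairSpace K U M' f₀}
  (h₁ : SignedPower ι₁ (1 : K)) (h₂ : SignedPower ι₂ e₂) (h₃ : SignedPower ι₃ e₃)
  (h₁' : SignedPower ι₁' (1 : K)) (h₂' : SignedPower ι₂' f₂)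
  {I γ : Type*} [Fintype I] [Fintype γ] [DecidableEq I]
  {a : Module.Basis I K N} {a' : Module.Basis I K N'} (c : Module.Basis γ K U)
  (G : CanonicalHom ι₁ ι₂ ι₃ ι₁' ι₂' h₀ h₀' a a')

namespace CanonicalHom

/-! ### Injectivity in small degrees -/

include h₁ h₃ in
-- Contraction selects the index pairs (i,j) and, with sign `e₀`, (j,i). Exchanging the two
-- R₃-generators in the second term costs `e₃`. The total sign `e₀ * e₃` is the sign of the pair
-- space of U, so the contraction is passed on to m.
lemma contractFst_pair (hf₀ : f₀ = e₀ * e₃) (i j : I) (m : M') (f : (R₁ ⊗[K] R₂) ⊗[K] R₃) :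
    contractFst R₂ R₃ h₁ (h₀.dual (a.coord i) (a.coord j)) (G.hom (ι₁' m ⊗ₜ 1) * f) =
      (∑ z : γ × γ, h₀'.dual (c.coord z.1) (c.coord z.2) m •
        (((1 ⊗ₜ 1) ⊗ₜ (ι₃ (a' i ⊗ₜ c z.1) * ι₃ (a' j ⊗ₜ c z.2))) * f)) +
      G.hom (ι₁' m ⊗ₜ 1) *
        contractFst R₂ R₃ h₁ (h₀.dual (a.coord i) (a.coord j)) f := by
  have hB : ∀ x y : U, ∑ z : γ × γ, (c.coord z.1 x * c.coord z.2 y) •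
      ((((1 : R₁) ⊗ₜ[K] (1 : R₂)) ⊗ₜ[K] (ι₃ (a' i ⊗ₜ c z.1) * ι₃ (a' j ⊗ₜ c z.2))) * f) =
      (((1 : R₁) ⊗ₜ[K] (1 : R₂)) ⊗ₜ[K] (ι₃ (a' i ⊗ₜ x) * ι₃ (a' j ⊗ₜ y))) * f := by
    intro x y
    rw [Fintype.sum_prod_type]
    conv_rhs => rw [← c.sum_repr x, ← c.sum_repr y]
    simp only [TensorProduct.tmul_sum, map_sum, TensorProduct.tmul_smul, map_smul, Finset.sum_mul,
      Finset.mul_sum, Finset.smul_sum, mul_smul_comm, Module.Basis.coord_apply, smul_mul_assoc,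
      smul_smul]
    rw [Finset.sum_comm]
    simp only [mul_comm]
  induction m using h₀'.induction with
  | h0 u v =>
    simp only [G.hom_pair, Finset.sum_mul, map_sum, contractFst_mul, h₀.dual_pair,
      Module.Basis.coord_apply, one_smul, Finset.sum_add_distrib]
    congr 1
    have h1 : ∀ k l : I, (a.repr (a k) i * a.repr (a l) j +
        e₀ * (a.repr (a l) i * a.repr (a k) j)) =
        (if l = j then if k = i then 1 else 0 else 0) +
          e₀ * (if l = i then if k = j then 1 else 0 else 0) := by
      intro k l
      simp only [Module.Basis.repr_self, Finsupp.single_apply]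
      grind
    simp only [h1, h₀'.dual_pair, add_smul, mul_smul e₀, mul_smul f₀, Finset.sum_add_distrib,
      ← Finset.smul_sum, ite_smul, one_smul, zero_smul, Finset.sum_ite_eq', Finset.mem_univ,
      if_true, hB]
    rw [h₃.swap (a' j ⊗ₜ u) (a' i ⊗ₜ v), hf₀, mul_smul, TensorProduct.tmul_smul, smul_mul_assoc]
  | hadd x y hx hy =>
    simp only [map_add, TensorProduct.add_tmul, add_mul, hx, hy, add_smul, Finset.sum_add_distrib]
    abel
  | hsmul d x hx =>
    simp only [map_smul, ← TensorProduct.smul_tmul', smul_mul_assoc, hx, smul_add, Finset.smul_sum,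
      smul_smul, smul_eq_mul]

include h₂ h₃ in
lemma contractSnd_single (i : I) (ω : Module.Dual K W) (v : W ⊗[K] U)
    (f : (R₁ ⊗[K] R₂) ⊗[K] R₃) :
    contractSnd R₁ R₃ h₂ (TensorProduct.dualDistrib K N W (a.coord i ⊗ₜ ω))
        (G.hom (1 ⊗ₜ ι₂' v) * f) =
      (∑ k, TensorProduct.dualDistrib K W U (ω ⊗ₜ c.coord k) v •
        (((1 ⊗ₜ 1) ⊗ₜ ι₃ (a' i ⊗ₜ c k)) * f)) +
      e₂ • (G.hom (1 ⊗ₜ ι₂' v) *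
        contractSnd R₁ R₃ h₂ (TensorProduct.dualDistrib K N W (a.coord i ⊗ₜ ω)) f) := by
  induction v with
  | zero => simp
  | tmul w u =>
    simp only [G.hom_single, Finset.sum_mul, map_sum, contractSnd_mul,
      TensorProduct.dualDistrib_apply, Module.Basis.coord_apply, Module.Basis.repr_self,
      Finsupp.single_apply, Finset.sum_add_distrib, ← Finset.smul_sum]
    congr 1
    simp only [ite_mul, one_mul, zero_mul, ite_smul, zero_smul, Finset.sum_ite_eq',
      Finset.mem_univ, if_true]
    conv_lhs => rw [← c.sum_repr u]
    simp only [TensorProduct.tmul_sum, map_sum, TensorProduct.tmul_smul, map_smul, Finset.sum_mul,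
      Finset.smul_sum, smul_mul_assoc, smul_smul]
  | add x y hx hy =>
    simp only [map_add, TensorProduct.tmul_add, add_mul, hx, hy, add_smul,
      Finset.sum_add_distrib, smul_add]
    abel

include h₃ in
-- In R₃ both elements involve only products of two generators, and these commute for either parity.
lemma hom_pair_commute (m : M') (x y : N' ⊗[K] U) (f : (R₁ ⊗[K] R₂) ⊗[K] R₃) :
    G.hom (ι₁' m ⊗ₜ 1) * (((1 ⊗ₜ 1) ⊗ₜ (ι₃ x * ι₃ y)) * f) =
      ((1 ⊗ₜ 1) ⊗ₜ (ι₃ x * ι₃ y)) * (G.hom (ι₁' m ⊗ₜ 1) * f) := by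
  rw [← mul_assoc, ← mul_assoc]
  congr 1
  induction m using h₀'.induction with
  | h0 u v =>
    rw [G.hom_pair]
    simp only [Finset.sum_mul, Finset.mul_sum, Algebra.TensorProduct.tmul_mul_tmul, mul_one,
      one_mul, h₃.mul_mul_commute x y]
  | hadd x y hx hy => simp only [map_add, TensorProduct.add_tmul, add_mul, mul_add, hx, hy]
  | hsmul d x hx =>
    simp only [map_smul, ← TensorProduct.smul_tmul', smul_mul_assoc, mul_smul_comm, hx]

include h₃ in
lemma hom_single_swap (v : W ⊗[K] U) (x : N' ⊗[K] U) (f : (R₁ ⊗[K] R₂) ⊗[K] R₃) :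
    G.hom (1 ⊗ₜ ι₂' v) * (((1 ⊗ₜ 1) ⊗ₜ ι₃ x) * f) =
      e₃ • (((1 ⊗ₜ 1) ⊗ₜ ι₃ x) * (G.hom (1 ⊗ₜ ι₂' v) * f)) := by
  rw [← mul_assoc, ← mul_assoc, ← smul_mul_assoc]
  congr 1
  induction v with
  | zero => simp
  | tmul w u =>
    rw [G.hom_single, Finset.sum_mul, Finset.mul_sum, Finset.smul_sum]
    refine Finset.sum_congr rfl fun i _ => ?_
    simp only [Algebra.TensorProduct.tmul_mul_tmul, mul_one, one_mul]
    rw [h₃.swap, TensorProduct.tmul_smul]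
  | add x y hx hy => simp only [map_add, TensorProduct.tmul_add, add_mul, mul_add, hx, hy, smul_add]

include h₁ in
lemma contractFst_hom_one (l : Module.Dual K M) {q : ℕ} {y : R₂'}
    (hy : y ∈ LinearMap.range ι₂' ^ q) :
    contractFst R₂ R₃ h₁ l (G.hom (1 ⊗ₜ y)) = 0 := by
  induction hy using Submodule.pow_induction_on_left' with
  | algebraMap r =>
    have : (1 : R₁') ⊗ₜ[K] algebraMap K R₂' r = r • 1 := by
      rw [Algebra.algebraMap_eq_smul_one, TensorProduct.tmul_smul, Algebra.TensorProduct.one_def]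
    rw [this, map_smul, map_smul, map_one]
    simp [contractFst, Algebra.TensorProduct.one_def, h₁.contract_one]
  | add x y i hx hy ihx ihy => simp only [TensorProduct.tmul_add, map_add, ihx, ihy, add_zero]
  | mem_mul m hm i x hx ih =>
    obtain ⟨v, rfl⟩ := hm
    have h2 : (1 : R₁') ⊗ₜ[K] (ι₂' v * x) = (1 ⊗ₜ ι₂' v) * (1 ⊗ₜ x) := by simp
    rw [h2, map_mul]
    clear h2
    induction v with
    | zero => simp
    | tmul w u =>
      rw [G.hom_single, Finset.sum_mul, map_sum]
      simp only [contractFst_mul_of_one, ih, mul_zero, Finset.sum_const_zero]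
    | add x y hx hy => simp only [map_add, TensorProduct.tmul_add, add_mul, hx, hy, add_zero]

include h₁ h₃ h₁' in
lemma contractFst_hom (hf₀ : f₀ = e₀ * e₃) (i j : I) {p q : ℕ} {x : R₁'}
    (hx : x ∈ LinearMap.range ι₁' ^ p) {y : R₂'} (hy : y ∈ LinearMap.range ι₂' ^ q) :
    contractFst R₂ R₃ h₁ (h₀.dual (a.coord i) (a.coord j)) (G.hom (x ⊗ₜ y)) =
      ∑ z : γ × γ, ((1 ⊗ₜ 1) ⊗ₜ (ι₃ (a' i ⊗ₜ c z.1) * ι₃ (a' j ⊗ₜ c z.2))) *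
        G.hom (h₁'.contract (h₀'.dual (c.coord z.1) (c.coord z.2)) x ⊗ₜ y) := by
  induction hx using Submodule.pow_induction_on_left' with
  | algebraMap r =>
    rw [Algebra.algebraMap_eq_smul_one, ← TensorProduct.smul_tmul', map_smul, map_smul,
      G.contractFst_hom_one h₁ _ hy]
    simp [h₁'.contract_one]
  | add x x' i hx hx' ihx ihx' =>
    simp only [TensorProduct.add_tmul, map_add, ihx, ihx', mul_add, Finset.sum_add_distrib]
  | mem_mul m hm i x hx ih =>
    obtain ⟨v, rfl⟩ := hm
    have h2 : ∀ x, (ι₁' v * x) ⊗ₜ[K] y = (ι₁' v ⊗ₜ 1) * (x ⊗ₜ y) := by simp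
    rw [h2, map_mul, G.contractFst_pair h₁ h₃ c hf₀, ih, Finset.mul_sum, ← Finset.sum_add_distrib]
    refine Finset.sum_congr rfl fun z _ => ?_
    rw [h₁'.contract_ι_mul, one_smul, TensorProduct.add_tmul, ← TensorProduct.smul_tmul', map_add,
      map_smul, h2, map_mul, mul_add, mul_smul_comm, G.hom_pair_commute h₃]

include h₂ h₃ h₂' in
-- Passing a contraction through a generator costs `e₂`, and moving the emitted R₃-generator to the
-- front costs `e₃`; together they give the sign `f₂` of the contraction in the source.
lemma contractSnd_hom (hf₂ : f₂ = e₂ * e₃) (i : I) (ω : Module.Dual K W) {q : ℕ} {y : R₂'}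
    (hy : y ∈ LinearMap.range ι₂' ^ q) :
    contractSnd R₁ R₃ h₂ (TensorProduct.dualDistrib K N W (a.coord i ⊗ₜ ω)) (G.hom (1 ⊗ₜ y)) =
      ∑ k, ((1 ⊗ₜ 1) ⊗ₜ ι₃ (a' i ⊗ₜ c k)) *
        G.hom (1 ⊗ₜ h₂'.contract (TensorProduct.dualDistrib K W U (ω ⊗ₜ c.coord k)) y) := by
  induction hy using Submodule.pow_induction_on_left' with
  | algebraMap r =>
    have : (1 : R₁') ⊗ₜ[K] algebraMap K R₂' r = r • 1 := by
      rw [Algebra.algebraMap_eq_smul_one, TensorProduct.tmul_smul, Algebra.TensorProduct.one_def]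
    rw [this, map_smul, map_smul, map_one]
    simp [contractSnd, Algebra.TensorProduct.one_def, h₂.contract_one, h₂'.contract_one,
      Algebra.algebraMap_eq_smul_one]
  | add x x' i hx hx' ihx ihx' =>
    simp only [TensorProduct.tmul_add, map_add, ihx, ihx', mul_add, Finset.sum_add_distrib]
  | mem_mul m hm i x hx ih =>
    obtain ⟨v, rfl⟩ := hm
    have h2 : ∀ x, (1 : R₁') ⊗ₜ[K] (ι₂' v * x) = (1 ⊗ₜ ι₂' v) * (1 ⊗ₜ x) := by simp
    rw [h2, map_mul, G.contractSnd_single h₂ h₃ c, ih, Finset.mul_sum, Finset.smul_sum,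
      ← Finset.sum_add_distrib]
    refine Finset.sum_congr rfl fun z _ => ?_
    rw [h₂'.contract_ι_mul, TensorProduct.tmul_add, TensorProduct.tmul_smul,
      TensorProduct.tmul_smul, map_add, map_smul, map_smul, h2, map_mul, mul_add, mul_smul_comm,
      mul_smul_comm, G.hom_single_swap h₃, smul_smul, ← hf₂]

include h₁ h₃ h₁' in
lemma triForm_hom_fst (hf₀ : f₀ = e₀ * e₃) (l₂ : R₂ →ₗ[K] K) {p q : ℕ} (P : Fin p → I × I)
    (l₃ : R₃ →ₗ[K] K) {x : R₁'} (hx : x ∈ LinearMap.range ι₁' ^ p) {y : R₂'}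
    (hy : y ∈ LinearMap.range ι₂' ^ q) :
    triForm (h₁.lam p fun k => h₀.dual (a.coord (P k).1) (a.coord (P k).2)) l₂ l₃
        (G.hom (x ⊗ₜ y)) =
      ∑ z : Fin p → γ × γ,
        h₁'.lam p (fun k => h₀'.dual (c.coord (z k).1) (c.coord (z k).2)) x *
          triForm h₁.aug l₂ (l₃ ∘ₗ LinearMap.mulLeft K (List.ofFn fun k =>
            ι₃ (a' (P k).1 ⊗ₜ c (z k).1) * ι₃ (a' (P k).2 ⊗ₜ c (z k).2)).prod)
              (G.hom (1 ⊗ₜ y)) := by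
  -- The form `l₃` varies in the induction because each contraction emits a factor in R₃, which is
  -- absorbed into `l₃` as a left multiplication.
  induction p generalizing x l₃ with
  | zero =>
    rw [pow_zero] at hx
    obtain ⟨r, rfl⟩ := Submodule.mem_one.1 hx
    rw [Algebra.algebraMap_eq_smul_one, ← TensorProduct.smul_tmul', map_smul, map_smul]
    simp [SignedPower.lam, h₁'.aug_one]
  | succ p ih =>
    rw [triForm_lam_succ_fst, G.contractFst_hom h₁ h₃ h₁' c hf₀ _ _ hx hy, map_sum,
      SignedPower.sum_fin_succ]
    refine Finset.sum_congr rfl fun z _ => ?_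
    rw [triForm_mul_right, ih (fun k => P k.succ) _ (h₁'.contract_mem _ hx)]
    refine Finset.sum_congr rfl fun z' _ => ?_
    rw [h₁'.lam_succ]
    simp only [Fin.cons_zero, Fin.cons_succ, List.ofFn_succ, List.prod_cons, LinearMap.comp_assoc,
      LinearMap.mulLeft_mul]

include h₂ h₃ h₂' in
lemma triForm_hom_snd (hf₂ : f₂ = e₂ * e₃) {l₁ : R₁ →ₗ[K] K} (hl₁ : l₁ 1 = 1) {q : ℕ}
    (P : Fin q → I) (ω : Fin q → Module.Dual K W) (l₃ : R₃ →ₗ[K] K) {y : R₂'}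
    (hy : y ∈ LinearMap.range ι₂' ^ q) :
    triForm l₁ (h₂.lam q fun l => TensorProduct.dualDistrib K N W (a.coord (P l) ⊗ₜ ω l)) l₃
        (G.hom (1 ⊗ₜ y)) =
      ∑ t : Fin q → γ,
        h₂'.lam q (fun l => TensorProduct.dualDistrib K W U (ω l ⊗ₜ c.coord (t l))) y *
          l₃ (SignedPower.prodι ι₃ fun l => a' (P l) ⊗ₜ c (t l)) := by
  induction q generalizing y l₃ with
  | zero =>
    rw [pow_zero] at hy
    obtain ⟨r, rfl⟩ := Submodule.mem_one.1 hy
    rw [Algebra.algebraMap_eq_smul_one, TensorProduct.tmul_smul, map_smul, map_smul,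
      ← Algebra.TensorProduct.one_def, map_one, Algebra.TensorProduct.one_def,
      Algebra.TensorProduct.one_def, triForm_tmul]
    simp [SignedPower.lam, h₂.aug_one, h₂'.aug_one, hl₁, SignedPower.prodι_zero]
  | succ q ih =>
    rw [triForm_lam_succ_snd, G.contractSnd_hom h₂ h₃ h₂' c hf₂ _ _ hy, map_sum,
      SignedPower.sum_fin_succ]
    refine Finset.sum_congr rfl fun z _ => ?_
    rw [triForm_mul_right, ih (fun k => P k.succ) _ _ (h₂'.contract_mem _ hy)]
    refine Finset.sum_congr rfl fun z' _ => ?_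
    rw [h₂'.lam_succ, SignedPower.prodι_succ]
    simp only [Fin.cons_zero, Fin.cons_succ, LinearMap.comp_apply, LinearMap.mulLeft_apply]

variable (h₀') in
/-- The linear form on the source attached to covectors in all slots. -/
def srcLam {f₁ : K} (h₁' : SignedPower ι₁' f₁) {p q : ℕ} (υ : Slots p q → Module.Dual K U) (ω : Fin q → Module.Dual K W) :
    R₁' ⊗[K] R₂' →ₗ[K] K :=
  LinearMap.mul' K K ∘ₗ TensorProduct.map
    (h₁'.lam p fun k => h₀'.dual (υ (.inl (k, 0))) (υ (.inl (k, 1))))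
    (h₂'.lam q fun l => TensorProduct.dualDistrib K W U (ω l ⊗ₜ υ (.inr l)))

variable {ev : N →ₗ[K] Module.Dual K N'}

include h₁ h₂ in
-- Moving all contractions through G leaves a pairing in R₃ of products with N'-indices P. Since P
-- is injective, no two factors can be exchanged, and the only surviving term has U-indices `u`.
lemma triLam_hom (hev : ∀ i j, ev (a i) (a' j) = if i = j then 1 else 0) (hf₀ : f₀ = e₀ * e₃)
    (hf₂ : f₂ = e₂ * e₃) {p q r : ℕ} (h : r = p * 2 + q) {P : Slots p q → I}
    (hP : Function.Injective P) (ω : Fin q → Module.Dual K W) (u : Slots p q → γ)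
    {x : R₁' ⊗[K] R₂'} (hx : x ∈ srcGraded ι₁' ι₂' p q) :
    triLam h₀ h₁ h₂ h₃ ev (fun s => a.coord (P s)) ω (fun k => a (P (stdSlot h k)))
      (fun k => c.coord (u (stdSlot h k))) (G.hom x) =
    srcLam h₀' h₂' h₁' (fun s => c.coord (u s)) ω x := by
  refine srcGraded_induction (fun x hx y hy => ?_) (fun x y hx hy => ?_) hx
  swap
  · rw [map_add, map_add, map_add, hx, hy]
  classical
  have key : ∀ v : Slots p q → γ,
      h₃.lam r (fun k => TensorProduct.dualDistrib K N' U
        (ev (a (P (stdSlot h k))) ⊗ₜ c.coord (u (stdSlot h k))))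
        (slotProd ι₃ fun s => a' (P s) ⊗ₜ c (v s)) = if v = u then 1 else 0 := by
    intro v
    rw [← prodι_stdSlot ι₃ h fun s => a' (P s) ⊗ₜ c (v s), h₃.lam_prodι]
    · simp only [TensorProduct.dualDistrib_apply, hev, if_true, one_mul,
        Module.Basis.coord_apply, Module.Basis.repr_self]
      rw [Equiv.prod_comp (stdSlot h) fun s => (Finsupp.single (v s) (1 : K)) (u s)]
      split_ifs with hvu
      · simp [hvu]
      · obtain ⟨s, hs⟩ := Function.ne_iff.1 hvu
        exact Finset.prod_eq_zero (Finset.mem_univ s) (Finsupp.single_eq_of_ne' hs)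
    · intro i j hij
      rw [TensorProduct.dualDistrib_apply, hev, if_neg, zero_mul]
      exact fun hc => hij ((stdSlot h).injective (hP hc))
  rw [triLam, G.triForm_hom_fst h₁ h₃ h₁' c hf₀ _
    (fun k => (P (.inl (k, 0)), P (.inl (k, 1)))) _ hx hy]
  simp only [G.triForm_hom_snd h₂ h₃ h₂' c hf₂ h₁.aug_one _ _ _ hy]
  have h1 := fun z t => key (slotEquiv p q γ (z, t))
  simp only [slotProd, slotEquiv, Equiv.coe_fn_mk, Sum.elim_inl, Sum.elim_inr,
    Matrix.cons_val_zero, Matrix.cons_val_one] at h1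
  simp only [LinearMap.comp_apply, LinearMap.mulLeft_apply, h1]
  obtain ⟨⟨z, t⟩, rfl⟩ := (slotEquiv p q γ).surjective u
  have h2 : ∀ z' t', ((Sum.elim (fun k => ![(z' k.1).1, (z' k.1).2] k.2) t' : Slots p q → γ) =
      slotEquiv p q γ (z, t)) ↔ (z' = z ∧ t' = t) := by
    intro z' t'
    rw [← Prod.mk_inj, ← (slotEquiv p q γ).injective.eq_iff]
    rfl
  simp only [h2, srcLam, LinearMap.comp_apply, TensorProduct.map_tmul, LinearMap.mul'_apply]
  rw [Finset.sum_eq_single z, Finset.sum_eq_single t]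
  · simp [slotEquiv]
  · intro t' _ ht'
    simp [ht']
  · simp
  · intro z' _ hz'
    simp [hz']
  · simp

lemma srcReconstruct {f₁ : K} (h₁' : SignedPower ι₁' f₁) {β : Type*} [Fintype β]
    (b : Module.Basis β K W) {p q : ℕ} {x : R₁' ⊗[K] R₂'} (hx : x ∈ srcGraded ι₁' ι₂' p q) :
    ∑ w : Fin q → β, ∑ u : Slots p q → γ,
      srcLam h₀' h₂' h₁' (fun s => c.coord (u s)) (fun l => b.coord (w l)) x •
        srcMonomial ι₁' ι₂' h₀' (fun l => b (w l)) (fun s => c (u s)) =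
      ((p.factorial : K) * 2 ^ p * q.factorial) • x := by
  refine srcGraded_induction (fun x hx y hy => ?_) (fun x y hx hy => ?_) hx
  swap
  · simp only [map_add, add_smul, Finset.sum_add_distrib, hx, hy, smul_add]
  · have r1 := h₁'.reconstruct (h₀'.frame c) hx
    have r2 := h₂'.reconstruct (frame_tensor (fun i => b i) (fun i => b.coord i)
      (fun v => b.sum_repr v) c) hy
    simp only [one_pow, mul_one] at r2
    rw [← TensorProduct.smul_tmul_smul, ← r1, ← r2]
    simp only [sum_arrow_prod (X := β) (Y := γ), sum_slots]
    rw [TensorProduct.tmul_sum]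
    refine Finset.sum_congr rfl fun w _ => ?_
    rw [TensorProduct.sum_tmul]
    refine Finset.sum_congr rfl fun z _ => ?_
    rw [TensorProduct.tmul_sum]
    simp only [srcLam, srcMonomial, slotEquiv, Equiv.coe_fn_mk, LinearMap.comp_apply,
      TensorProduct.map_tmul, LinearMap.mul'_apply, Sum.elim_inl, Sum.elim_inr,
      Matrix.cons_val_zero, Matrix.cons_val_one, TensorProduct.smul_tmul_smul]

include h₁ h₂ h₃ h₁' h₂' c in
-- The bound on the degree is exactly what allows distinct basis indices in all slots; `triLam_hom`
-- then reads every coordinate of x off its image.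
theorem eq_zero_of_hom_eq_zero [CharZero K] {β : Type*} [Fintype β] (b : Module.Basis β K W)
    (hev : ∀ i j, ev (a i) (a' j) = if i = j then 1 else 0) (hf₀ : f₀ = e₀ * e₃)
    (hf₂ : f₂ = e₂ * e₃) {p q : ℕ} (hcard : p * 2 + q ≤ Fintype.card I)
    {x : R₁' ⊗[K] R₂'} (hx : x ∈ srcGraded ι₁' ι₂' p q) (h0 : G.hom x = 0) : x = 0 := by
  obtain ⟨P⟩ : Nonempty (Slots p q ↪ I) := Function.Embedding.nonempty_of_card_le (by simpa)
  have h1 : ∀ (w : Fin q → β) (u : Slots p q → γ),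
      srcLam h₀' h₂' h₁' (fun s => c.coord (u s)) (fun l => b.coord (w l)) x = 0 := by
    intro w u
    rw [← G.triLam_hom h₁ h₂ h₃ h₁' h₂' c hev hf₀ hf₂ rfl P.injective _ u hx, h0, map_zero]
  have h2 := srcReconstruct (h₀' := h₀') h₂' c h₁' b hx
  simp only [h1, zero_smul, Finset.sum_const_zero] at h2
  refine (smul_eq_zero.1 h2.symm).resolve_left ?_
  have := Nat.factorial_ne_zero
  simp [this]

end CanonicalHom
end Injective

section Image

variable {K N N' W U M R₁ R₂ R₃ M' R₁' R₂' : Type*} [Field K] [AddCommGroup N] [Module K N]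
  [AddCommGroup N'] [Module K N']
  [AddCommGroup W] [Module K W] [AddCommGroup U] [Module K U] [AddCommGroup M] [Module K M]
  [Ring R₁] [Algebra K R₁] [Ring R₂] [Algebra K R₂] [Ring R₃] [Algebra K R₃]
  [AddCommGroup M'] [Module K M'] [Ring R₁'] [Algebra K R₁'] [Ring R₂'] [Algebra K R₂']
  {e₀ e₁ e₂ e₃ f₀ f₁ f₂ : K} {ι₁ : M →ₗ[K] R₁} {ι₂ : N ⊗[K] W →ₗ[K] R₂}
  {ι₃ : N' ⊗[K] U →ₗ[K] R₃} {ι₁' : M' →ₗ[K] R₁'} {ι₂' : W ⊗[K] U →ₗ[K] R₂'}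
  {h₀ : PairSpace K N M e₀} {ev : N →ₗ[K] Module.Dual K N'}
  {h₀' : PairSpace K U M' f₀}
  (h₁ : SignedPower ι₁ e₁) (h₂ : SignedPower ι₂ e₂) (h₃ : SignedPower ι₃ e₃)
  (h₁' : SignedPower ι₁' f₁) (h₂' : SignedPower ι₂' f₂)
  {I β γ : Type*} [Fintype I] [Fintype β] [Fintype γ] [DecidableEq I]
  {a : Module.Basis I K N} {a' : Module.Basis I K N'} (b : Module.Basis β K W)
  (c : Module.Basis γ K U) (G : CanonicalHom ι₁ ι₂ ι₃ ι₁' ι₂' h₀ h₀' a a')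
  (α : TriAction ι₁ ι₂ ι₃ h₀ ev)

namespace CanonicalHom

/-! ### The image -/

include h₁' h₂' b c in
-- After division by p!·2^p·q!, every element of the source is a combination of monomials, whose
-- images are explicit.
lemma hom_mem_triGraded [CharZero K] {p q r : ℕ} (h : r = p * 2 + q) {x : R₁' ⊗[K] R₂'}
    (hx : x ∈ srcGraded ι₁' ι₂' p q) : G.hom x ∈ triGraded ι₁ ι₂ ι₃ p q r := by
  have hne : ((p.factorial : K) * 2 ^ p * q.factorial) ≠ 0 := by
    have := Nat.factorial_ne_zero
    simp [this]
  rw [← Submodule.smul_mem_iff _ hne, ← map_smul, ← srcReconstruct (h₀' := h₀') h₂' c h₁' b hx, map_sum]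
  refine Submodule.sum_mem _ fun w _ => ?_
  rw [map_sum]
  refine Submodule.sum_mem _ fun u _ => ?_
  rw [map_smul, G.hom_srcMonomial h, theta]
  exact Submodule.smul_mem _ _ (Submodule.sum_mem _ fun P _ => triMonomial_mem _ _ _ _ _)

include h₁ h₂ h₃ h₁' h₂' b c in
/-- The image of the source is the space of invariants of every group between `SL(N)` and
`GL(N)`. -/
theorem map_srcGraded_eq [CharZero K] (hev : ∀ i j, ev (a i) (a' j) = if i = j then 1 else 0)
    {p q r : ℕ} (h : r = p * 2 + q) {Y : Submodule K ((R₁ ⊗[K] R₂) ⊗[K] R₃)}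
    (hGL : ∀ f ∈ triGraded ι₁ ι₂ ι₃ p q r, (∀ s, α.act s f = f) → f ∈ Y)
    (hSL : ∀ f ∈ Y, f ∈ triGraded ι₁ ι₂ ι₃ p q r ∧
      ∀ s : N ≃ₗ[K] N, LinearMap.det s.toLinearMap = 1 → α.act s f = f) :
    (srcGraded ι₁' ι₂' p q).map G.hom.toLinearMap = Y := by
  refine le_antisymm ?_ fun f hf => ?_
  -- The image lies in the GL-invariants, hence in Y; conversely Y lies in the SL-invariants, hence
  -- in the image.
  · rintro _ ⟨x, hx, rfl⟩
    exact hGL _ (G.hom_mem_triGraded h₁' h₂' b c h hx) fun s => G.act_hom α hev s hx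
  · exact mem_of_SL_invariant h₁ h₂ h₃ α a a' b c hev (hSL f hf).1 (hSL f hf).2 (stdSlot h)
      fun w u => G.theta_mem_map h w u

end CanonicalHom
end Image

/-! ### The two algebras -/

section Instances

variable {K : Type*} [Field K] {N : Type*} (W U : Type*)
  [AddCommGroup N] [Module K N] [AddCommGroup W] [Module K W] [AddCommGroup U] [Module K U]
  {I : Type*} [Fintype I] (a : Module.Basis I K N)

lemma symPow_pair {V : Type*} [AddCommGroup V] [Module K V] (x y : V) :
    (symPower K V).pairSpace.pair x y = symMul x y := rfl

lemma extPow_pair {V : Type*} [AddCommGroup V] [Module K V] (x y : V) :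
    (extPower K V).pairSpace.pair x y = extMul x y := by
  apply Subtype.ext
  simp [SignedPower.pairSpace, extMul, ExteriorAlgebra.ιMulti_apply]

/-- The action of `GL(N)` on `A`. -/
def triActionA : TriAction (SymmetricAlgebra.ι K (symPow K N 2))
    (SymmetricAlgebra.ι K (N ⊗[K] W))
    (ExteriorAlgebra.ι K : Module.Dual K N ⊗[K] U →ₗ[K] ExteriorAlgebra K (Module.Dual K N ⊗[K] U))
    (symPower K N).pairSpace (Module.Dual.eval K N) where
  onPair s := symPowRep 2 (stdRep K N) s
  onDual s := (stdRep K N).dual s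
  act₁ s := symMap (symPowRep 2 (stdRep K N) s)
  act₂ s := symMap ((stdRep K N).tprod (Representation.trivial K _ W) s)
  act₃ s := ExteriorAlgebra.map ((stdRep K N).dual.tprod (Representation.trivial K _ U) s)
  onPair_pair s x y := by
    apply Subtype.ext
    simp [symPow_pair, symMul, symPowRep, symMap, stdRep]
  ev_onDual s x φ := rfl
  act₁_ι s m := by simp [symMap]
  act₂_ι s x w := by simp [symMap]; rfl
  act₃_ι s φ u := by simp

/-- The action of `GL(N)` on `C`. -/
def triActionC : TriAction (SymmetricAlgebra.ι K (⋀[K]^2 N))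
    (ExteriorAlgebra.ι K : N ⊗[K] W →ₗ[K] ExteriorAlgebra K (N ⊗[K] W))
    (SymmetricAlgebra.ι K (Module.Dual K N ⊗[K] U))
    (extPower K N).pairSpace (Module.Dual.eval K N) where
  onPair s := extPowRep 2 (stdRep K N) s
  onDual s := (stdRep K N).dual s
  act₁ s := symMap (extPowRep 2 (stdRep K N) s)
  act₂ s := ExteriorAlgebra.map ((stdRep K N).tprod (Representation.trivial K _ W) s)
  act₃ s := symMap (K := K) (V := Module.Dual K N ⊗[K] U) (V' := Module.Dual K N ⊗[K] U)
    ((stdRep K N).dual.tprod (Representation.trivial K _ U) s)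
  onPair_pair s x y := by
    rw [extPow_pair, extPow_pair]
    apply Subtype.ext
    simp [extMul, extPowRep, stdRep, ExteriorAlgebra.ιMulti_apply, Matrix.vecTail]
  ev_onDual s x φ := rfl
  act₁_ι s m := by simp [symMap]
  act₂_ι s x w := by simp; rfl
  act₃_ι s φ u := by simp [symMap]

lemma mem_invGLA {p q r : ℕ} {f : AlgA K N W U} : f ∈ invGLA K N W U p q r ↔
    f ∈ gradedA K N W U p q r ∧ ∀ s, (triActionA W U).act s f = f := Iff.rfl

lemma mem_invGLC {p q r : ℕ} {f : AlgC K N W U} : f ∈ invGLC K N W U p q r ↔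
    f ∈ gradedC K N W U p q r ∧ ∀ s, (triActionC W U).act s f = f := Iff.rfl

lemma forall_SL {C : (N ≃ₗ[K] N) → Prop} :
    (∀ s : SpecialLinearGroup K N, C (SpecialLinearGroup.toLinearEquiv s)) ↔
      ∀ s : N ≃ₗ[K] N, LinearMap.det s.toLinearMap = 1 → C s := by
  constructor
  · intro h s hs
    exact h ⟨s, by rw [← Units.val_inj, LinearEquiv.coe_det, hs, Units.val_one]⟩
  · intro h s
    refine h _ ?_
    rw [← LinearEquiv.coe_det]
    exact congrArg Units.val s.2

lemma mem_invSLA {p q r : ℕ} {f : AlgA K N W U} : f ∈ invSLA K N W U p q r ↔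
    f ∈ gradedA K N W U p q r ∧
      ∀ s : N ≃ₗ[K] N, LinearMap.det s.toLinearMap = 1 → (triActionA W U).act s f = f := by
  rw [← forall_SL]
  exact Iff.rfl

lemma mem_invSLC {p q r : ℕ} {f : AlgC K N W U} : f ∈ invSLC K N W U p q r ↔
    f ∈ gradedC K N W U p q r ∧
      ∀ s : N ≃ₗ[K] N, LinearMap.det s.toLinearMap = 1 → (triActionC W U).act s f = f := by
  rw [← forall_SL]
  exact Iff.rfl

variable [CharZero K] [DecidableEq I]

/-- The map `G` as a map given by canonical elements. -/
def canonicalG : CanonicalHom (SymmetricAlgebra.ι K (symPow K N 2))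
    (SymmetricAlgebra.ι K (N ⊗[K] W))
    (ExteriorAlgebra.ι K : Module.Dual K N ⊗[K] U →ₗ[K] ExteriorAlgebra K (Module.Dual K N ⊗[K] U))
    (SymmetricAlgebra.ι K (⋀[K]^2 U))
    (ExteriorAlgebra.ι K : W ⊗[K] U →ₗ[K] ExteriorAlgebra K (W ⊗[K] U))
    (symPower K N).pairSpace (extPower K U).pairSpace a a.dualBasis where
  hom := mapG W U a
  hom_pair u v := by
    rw [extPow_pair, mapG, symExtLift_ι_left, phiA, extMul,
      exteriorPower.alternatingMapLinearEquiv_apply_ιMulti]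
    simp [phiAltA, symPow_pair, Module.Basis.coe_dualBasis]
  hom_single w u := by
    rw [mapG, symExtLift_ι_right, psiA, TensorProduct.lift.tmul]
    simp [Module.Basis.coe_dualBasis]

/-- The map `H` as a map given by canonical elements. -/
def canonicalH : CanonicalHom (SymmetricAlgebra.ι K (⋀[K]^2 N))
    (ExteriorAlgebra.ι K : N ⊗[K] W →ₗ[K] ExteriorAlgebra K (N ⊗[K] W))
    (SymmetricAlgebra.ι K (Module.Dual K N ⊗[K] U))
    (SymmetricAlgebra.ι K (⋀[K]^2 U))
    (ExteriorAlgebra.ι K : W ⊗[K] U →ₗ[K] ExteriorAlgebra K (W ⊗[K] U))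
    (extPower K N).pairSpace (extPower K U).pairSpace a a.dualBasis where
  hom := mapH W U a
  hom_pair u v := by
    rw [extPow_pair, mapH, symExtLift_ι_left, phiC, extMul,
      exteriorPower.alternatingMapLinearEquiv_apply_ιMulti]
    simp [phiAltC, extPow_pair, Module.Basis.coe_dualBasis]
  hom_single w u := by
    rw [mapH, symExtLift_ι_right, psiC, TensorProduct.lift.tmul]
    simp [Module.Basis.coe_dualBasis]

lemma eval_dualBasis (i j : I) :
    Module.Dual.eval K N (a i) (a.dualBasis j) = if i = j then 1 else 0 := by
  simp [Finsupp.single_apply]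

lemma srcIncl_injective (p q : ℕ) : Function.Injective (srcIncl K W U p q) :=
  TensorProduct.map_injective_of_flat_flat _ _ (Submodule.subtype_injective _)
    (Submodule.subtype_injective _)

variable [FiniteDimensional K W] [FiniteDimensional K U]

lemma invGLA_le_invSLA {p q r : ℕ} : invGLA K N W U p q r ≤ invSLA K N W U p q r :=
  fun _ hf => (mem_invSLA W U).2 ⟨hf.1, fun s _ => (mem_invGLA W U).1 hf |>.2 s⟩

include a in
lemma invGLA_eq_bot {p q r : ℕ} (h : 2 * p + q ≠ r) : invGLA K N W U p q r = ⊥ := by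
  rw [Submodule.eq_bot_iff]
  intro f hf
  rw [mem_invGLA] at hf
  exact eq_zero_of_GL_invariant (symPower K _) (symPower K _) (extPower K _)
    (triActionA W U) a a.dualBasis (Module.finBasis K W) (Module.finBasis K U)
    (eval_dualBasis a) hf.1 hf.2 h

include a in
lemma invSLA_eq_bot {p q r : ℕ} (h : ¬ (Fintype.card I : ℤ) ∣ 2 * (p : ℤ) + q - r) :
    invSLA K N W U p q r = ⊥ := by
  rw [Submodule.eq_bot_iff]
  intro f hf
  rw [mem_invSLA] at hf
  exact eq_zero_of_SL_invariant (symPower K _) (symPower K _) (extPower K _)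
    (triActionA W U) a a.dualBasis (Module.finBasis K W) (Module.finBasis K U)
    (eval_dualBasis a) hf.1 hf.2 h

lemma range_mapGpq {p q : ℕ} {Y : Submodule K (AlgA K N W U)}
    (hGL : invGLA K N W U p q (2 * p + q) ≤ Y) (hSL : Y ≤ invSLA K N W U p q (2 * p + q)) :
    LinearMap.range (mapGpq W U a p q) = Y := by
  rw [mapGpq, LinearMap.range_comp]
  exact (canonicalG W U a).map_srcGraded_eq (symPower K _) (symPower K _) (extPower K _)
    (symPower K _) (extPower K _) (Module.finBasis K W) (Module.finBasis K U)
    (triActionA W U) (eval_dualBasis a) (by rw [mul_comm]) (fun f hf hs => hGL ⟨hf, hs⟩)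
    (fun f hf => (mem_invSLA W U).1 (hSL hf))

lemma mapGpq_injective {p q : ℕ} (h : p * 2 + q ≤ Fintype.card I) :
    Function.Injective (mapGpq W U a p q) := by
  intro x y hxy
  refine srcIncl_injective W U p q (sub_eq_zero.1 ?_)
  exact (canonicalG W U a).eq_zero_of_hom_eq_zero (symPower K _) (symPower K _) (extPower K _)
    (symPower K _) (extPower K _) (Module.finBasis K U) (Module.finBasis K W)
    -- The two sign conditions `f₀ = e₀ * e₃` and `f₂ = e₂ * e₃` read -1 = 1·(-1) for A; for C they
    -- read -1 = (-1)·1.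
    (eval_dualBasis a) (by norm_num) (by norm_num) h
    (Submodule.sub_mem _ ⟨x, rfl⟩ ⟨y, rfl⟩) ((map_sub _ _ _).trans (sub_eq_zero.2 hxy))

lemma invGLC_le_invSLC {p q r : ℕ} : invGLC K N W U p q r ≤ invSLC K N W U p q r :=
  fun _ hf => (mem_invSLC W U).2 ⟨hf.1, fun s _ => (mem_invGLC W U).1 hf |>.2 s⟩

include a in
lemma invGLC_eq_bot {p q r : ℕ} (h : 2 * p + q ≠ r) : invGLC K N W U p q r = ⊥ := by
  rw [Submodule.eq_bot_iff]
  intro f hf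
  rw [mem_invGLC] at hf
  exact eq_zero_of_GL_invariant (symPower K _) (extPower K _) (symPower K _)
    (triActionC W U) a a.dualBasis (Module.finBasis K W) (Module.finBasis K U)
    (eval_dualBasis a) hf.1 hf.2 h

include a in
lemma invSLC_eq_bot {p q r : ℕ} (h : ¬ (Fintype.card I : ℤ) ∣ 2 * (p : ℤ) + q - r) :
    invSLC K N W U p q r = ⊥ := by
  rw [Submodule.eq_bot_iff]
  intro f hf
  rw [mem_invSLC] at hf
  exact eq_zero_of_SL_invariant (symPower K _) (extPower K _) (symPower K _)
    (triActionC W U) a a.dualBasis (Module.finBasis K W) (Module.finBasis K U)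
    (eval_dualBasis a) hf.1 hf.2 h

lemma range_mapHpq {p q : ℕ} {Y : Submodule K (AlgC K N W U)}
    (hGL : invGLC K N W U p q (2 * p + q) ≤ Y) (hSL : Y ≤ invSLC K N W U p q (2 * p + q)) :
    LinearMap.range (mapHpq W U a p q) = Y := by
  rw [mapHpq, LinearMap.range_comp]
  exact (canonicalH W U a).map_srcGraded_eq (symPower K _) (extPower K _) (symPower K _)
    (symPower K _) (extPower K _) (Module.finBasis K W) (Module.finBasis K U)
    (triActionC W U) (eval_dualBasis a) (by rw [mul_comm]) (fun f hf hs => hGL ⟨hf, hs⟩)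
    (fun f hf => (mem_invSLC W U).1 (hSL hf))

lemma mapHpq_injective {p q : ℕ} (h : p * 2 + q ≤ Fintype.card I) :
    Function.Injective (mapHpq W U a p q) := by
  intro x y hxy
  refine srcIncl_injective W U p q (sub_eq_zero.1 ?_)
  exact (canonicalH W U a).eq_zero_of_hom_eq_zero (symPower K _) (extPower K _) (symPower K _)
    (symPower K _) (extPower K _) (Module.finBasis K U) (Module.finBasis K W)
    (eval_dualBasis a) (by norm_num) (by norm_num) h
    (Submodule.sub_mem _ ⟨x, rfl⟩ ⟨y, rfl⟩) ((map_sub _ _ _).trans (sub_eq_zero.2 hxy))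

end Instances

end InvThy

end

theorem mainTheorem6 {K : Type*} [Field K] [CharZero K]
    {N W U : Type*} [AddCommGroup N] [Module K N] [FiniteDimensional K N]
    [AddCommGroup W] [Module K W] [FiniteDimensional K W]
    [AddCommGroup U] [Module K U] [FiniteDimensional K U]
    (a : Module.Basis (Fin (Module.finrank K N)) K N) :
    (∀ p q r : ℕ, 2 * p + q ≠ r →
      InvThy.invGLA K N W U p q r = ⊥ ∧ InvThy.invGLC K N W U p q r = ⊥) ∧
    (∀ p q r : ℕ, ¬ (Module.finrank K N : ℤ) ∣ 2 * (p : ℤ) + (q : ℤ) - (r : ℤ) →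
      InvThy.invSLA K N W U p q r = ⊥ ∧ InvThy.invSLC K N W U p q r = ⊥) ∧
    (∀ p q : ℕ,
      LinearMap.range (InvThy.mapGpq W U a p q) = InvThy.invGLA K N W U p q (2 * p + q) ∧
      LinearMap.range (InvThy.mapGpq W U a p q) = InvThy.invSLA K N W U p q (2 * p + q) ∧
      (2 * p + q ≤ Module.finrank K N → Function.Injective (InvThy.mapGpq W U a p q))) ∧
    (∀ p q : ℕ,
      LinearMap.range (InvThy.mapHpq W U a p q) = InvThy.invGLC K N W U p q (2 * p + q) ∧
      LinearMap.range (InvThy.mapHpq W U a p q) = InvThy.invSLC K N W U p q (2 * p + q) ∧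
      (2 * p + q ≤ Module.finrank K N → Function.Injective (InvThy.mapHpq W U a p q))) := by
  have key : ∀ p q : ℕ, (2 * p + q ≤ Module.finrank K N → p * 2 + q ≤
      Fintype.card (Fin (Module.finrank K N))) := fun p q h => by
    rwa [Fintype.card_fin, mul_comm]
  refine ⟨fun p q r h => ⟨?_, ?_⟩, fun p q r h => ⟨?_, ?_⟩, fun p q => ?_, fun p q => ?_⟩
  · exact InvThy.invGLA_eq_bot W U a h
  · exact InvThy.invGLC_eq_bot W U a h
  · exact InvThy.invSLA_eq_bot W U a (by simpa using h)
  · exact InvThy.invSLC_eq_bot W U a (by simpa using h)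
  -- The intermediate space Y is taken at its two extremes, the GL-invariants and the SL-invariants.
  · exact ⟨InvThy.range_mapGpq W U a le_rfl (InvThy.invGLA_le_invSLA W U),
      InvThy.range_mapGpq W U a (InvThy.invGLA_le_invSLA W U) le_rfl,
      fun h => InvThy.mapGpq_injective W U a (key p q h)⟩
  · exact ⟨InvThy.range_mapHpq W U a le_rfl (InvThy.invGLC_le_invSLC W U),
      InvThy.range_mapHpq W U a (InvThy.invGLC_le_invSLC W U) le_rfl,
      fun h => InvThy.mapHpq_injective W U a (key p q h)⟩
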